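/- Let $M$ be a smooth Riemannian manifold, let $J\subset\mathbb R$ be an interval with more than one point and let $c\colon J\to M$ be a non-constant geodesic. Put $E_t=\dot c(t)^\perp\subset T_{c(t)}M$, fix $t_0\in J$, and write $'$ for the covariant derivative along $c$ and $R(X,Y)Z=\nabla_X\nabla_YZ-\nabla_Y\nabla_XZ-\nabla_{[X,Y]}Z$. Let $A_t\colon E_{t_0}\to E_t$, $t\in J$, be a Lagrange tensor along $c$. This means that for every $v\in E_{t_0}$ the field $A_tv$ is a smooth Jacobi field along $c$, i.e. $A''+R(A\,\cdot,\dot c)\dot c=0$; that $A$ is non-degenerate, i.e. $A_tv$ does not vanish identically if $v\neq 0$; that $A_t$ is invertible for at least one $t\in J$; and that $S_t=A_t'A_t^{-1}\colon E_t\to E_t$ is symmetric at all regular points, i.e. at all $t\in J$ for which $A_t$ is invertible. Let $p\ge 1$ and let $W\subset E_{t_0}$ be a $p$-dimensional subspace with orthonormal basis $e_1,\dots,e_p$. At regular points put $$g_W(t)=(\det M_t)^{-1/2p},\qquad (M_t)_{ij}=\langle (A_t^*)^{-1}e_i,(A_t^*)^{-1}e_j\rangle=\langle (A_t^*A_t)^{-1}e_i,e_j\rangle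 ,$$ and at the other points of $J$ (which are isolated) let $g_W(t)$ be the limit of the values of $g_W$ at nearby regular points. One says that $M$ has non-negative (resp. positive) $p$-sectional curvature if for all $x\in M$ and all non-zero $v\in T_xM$ the sum of the $p$ smallest eigenvalues, counted with multiplicity, of $R(\cdot,v)v$ on $v^\perp$ is non-negative (resp. positive). Then: (a) If $M$ has non-negative (resp. positive) $p$-sectional curvature, then $g_W$ is concave (resp. strictly concave) on any interval $K\subset J$ on which $g_W$ is positive. (b) For every $t^*\in J$, the function $g_W$ is smooth and positive at $t^*$ if and only if $W\perp\ker A_{t^*}$. If $t^*$ is an interior point of $J$, then $g_W$ is smooth at $t^*$ if and only if $W\perp\ker A_{t^*}$. (At an endpoint of $J$ smoothness is one-sided.) (c) If $M$ has non-negative $p$-sectional curvature and $g_W$ is constant on $J$, then for every $v\in W$ the field $(A_t^*)^{-1}v$, defined at the regular points, extends to a vector field along $c$ on all of $J$ that is parallel and a Jacobi field. -/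

import Mathlib

set_option maxSynthPendingDepth 3

noncomputable section

namespace VirtualJacobi

section Coordinates

variable {E : Type*} [NormedAddCommGroup E] [NormedSpace ℝ E]

/-- The Christoffel symbols of the first kind of a field `g` of bilinear forms on a vector space,
`(u, v) ↦ (w ↦ 1/2 (∂_u g(v, w) + ∂_v g(u, w) - ∂_w g(u, v)))`. -/
def christoffelLower (g : E → E →L[ℝ] E →L[ℝ] ℝ) (y : E) : E →L[ℝ] E →L[ℝ] E →L[ℝ] ℝ :=
  let dg : E →L[ℝ] E →L[ℝ] E →L[ℝ] ℝ := fderiv ℝ g y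
  (1 / 2 : ℝ) • (dg + dg.flip - (ContinuousLinearMap.flipₗᵢ ℝ E E ℝ :
    (E →L[ℝ] E →L[ℝ] ℝ) →L[ℝ] E →L[ℝ] E →L[ℝ] ℝ) ∘L dg.flip)

theorem christoffelLower_apply (g : E → E →L[ℝ] E →L[ℝ] ℝ) (y u v w : E) :
    christoffelLower g y u v w =
      1 / 2 * (fderiv ℝ g y u v w + fderiv ℝ g y v u w - fderiv ℝ g y w u v) := by
  simp [christoffelLower]

/-- The Christoffel symbols `Γ(u, v)` of `g`, obtained from those of the first kind by raising the
last index: `g(Γ(u, v), w) = 1/2 (∂_u g(v, w) + ∂_v g(u, w) - ∂_w g(u, v))`. -/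
def christoffel (g : E → E →L[ℝ] E →L[ℝ] ℝ) (y : E) : E →L[ℝ] E →L[ℝ] E :=
  (ContinuousLinearMap.compL ℝ E (E →L[ℝ] ℝ) E (g y).inverse) ∘L christoffelLower g y

theorem christoffel_apply (g : E → E →L[ℝ] E →L[ℝ] ℝ) (y u v : E) :
    christoffel g y u v = (g y).inverse (christoffelLower g y u v) := rfl

/-- The curvature tensor `R(u, v)w = ∇_u ∇_v w - ∇_v ∇_u w - ∇_[u,v] w` of `g` in coordinates:
`(∂_u Γ)(v, w) - (∂_v Γ)(u, w) + Γ(u, Γ(v, w)) - Γ(v, Γ(u, w))`. -/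
def coordCurvature (g : E → E →L[ℝ] E →L[ℝ] ℝ) (y u v w : E) : E :=
  let Γ := christoffel g y
  let dΓ := fderiv ℝ (christoffel g) y
  dΓ u v w - dΓ v u w + Γ u (Γ v w) - Γ v (Γ u w)

theorem coordCurvature_add_left (g : E → E →L[ℝ] E →L[ℝ] ℝ) (y u u' v w : E) :
    coordCurvature g y (u + u') v w = coordCurvature g y u v w + coordCurvature g y u' v w := by
  simp only [coordCurvature, map_add, add_apply]
  abel

theorem coordCurvature_smul_left (g : E → E →L[ℝ] E →L[ℝ] ℝ) (a : ℝ) (y u v w : E) :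
    coordCurvature g y (a • u) v w = a • coordCurvature g y u v w := by
  simp only [coordCurvature, map_smul, smul_apply, smul_add, smul_sub]

/-- The sum of the `p` smallest eigenvalues, counted with multiplicity, of an endomorphism. -/
def sumSmallestEigenvalues {V : Type*} [AddCommGroup V] [Module ℝ V] [FiniteDimensional ℝ V]
    (p : ℕ) (f : V →ₗ[ℝ] V) : ℝ :=
  ((f.charpoly.roots.sort (· ≤ ·)).take p).sum

end Coordinates

open Bundle Manifold Set Filter Topology
open scoped ContDiff InnerProductSpace

section Riemannian

variable {E : Type*} [NormedAddCommGroup E] [NormedSpace ℝ E] [FiniteDimensional ℝ E]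
  {M : Type*} [TopologicalSpace M] [ChartedSpace E M] [IsManifold 𝓘(ℝ, E) ∞ M]

instance instFiniteDimensionalTangentSpace (x : M) :
    FiniteDimensional ℝ (TangentSpace 𝓘(ℝ, E) x) :=
  inferInstanceAs (FiniteDimensional ℝ E)

/-- The coordinates of a tangent vector at `x` in the preferred chart at `x₀`. -/
def toCoord (x₀ x : M) : TangentSpace 𝓘(ℝ, E) x →L[ℝ] E :=
  (trivializationAt E (TangentSpace 𝓘(ℝ, E) : M → Type _) x₀).continuousLinearMapAt ℝ x

/-- The tangent vector at `x` with given coordinates in the preferred chart at `x₀`. -/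
def ofCoord (x₀ x : M) : E →L[ℝ] TangentSpace 𝓘(ℝ, E) x :=
  (trivializationAt E (TangentSpace 𝓘(ℝ, E) : M → Type _) x₀).symmL ℝ x

variable [RiemannianBundle (fun x : M ↦ TangentSpace 𝓘(ℝ, E) x)]

/-- The Riemannian metric read in the preferred chart at `x₀`. -/
def chartMetric (x₀ : M) (y : E) : E →L[ℝ] E →L[ℝ] ℝ :=
  let x : M := (extChartAt 𝓘(ℝ, E) x₀).symm y
  (innerSL ℝ (E := TangentSpace 𝓘(ℝ, E) x)).bilinearComp (ofCoord x₀ x) (ofCoord x₀ x)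

/-- The Riemannian curvature tensor `R(u, v)w` at `x`, computed in the preferred chart at `x`. -/
def curvature (x : M) (u v w : TangentSpace 𝓘(ℝ, E) x) : TangentSpace 𝓘(ℝ, E) x :=
  ofCoord x x (coordCurvature (chartMetric x) (extChartAt 𝓘(ℝ, E) x x)
    (toCoord x x u) (toCoord x x v) (toCoord x x w))

/-- The curvature endomorphism `R(·, v)v` of the orthogonal complement of `v`. -/
def curvatureEndomorphism (x : M) (v : TangentSpace 𝓘(ℝ, E) x) :
    (ℝ ∙ v)ᗮ →ₗ[ℝ] (ℝ ∙ v)ᗮ where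
  toFun w := (ℝ ∙ v)ᗮ.orthogonalProjectionOnto (curvature x (w : TangentSpace 𝓘(ℝ, E) x) v v)
  map_add' w w' := by
    simp only [curvature, Submodule.coe_add, map_add, coordCurvature_add_left]
  map_smul' a w := by
    simp only [curvature, Submodule.coe_smul, map_smul, coordCurvature_smul_left, RingHom.id_apply]

variable (E M) in
/-- Non-negative `p`-sectional curvature. -/
def NonnegPCurvature (p : ℕ) : Prop :=
  ∀ (x : M) (v : TangentSpace 𝓘(ℝ, E) x), v ≠ 0 →
    0 ≤ sumSmallestEigenvalues p (curvatureEndomorphism x v)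

variable (E M) in
/-- Positive `p`-sectional curvature. -/
def PosPCurvature (p : ℕ) : Prop :=
  ∀ (x : M) (v : TangentSpace 𝓘(ℝ, E) x), v ≠ 0 →
    0 < sumSmallestEigenvalues p (curvatureEndomorphism x v)

/-- The velocity field of a curve `c` defined on the interval `J`. -/
def velocity (c : ℝ → M) (J : Set ℝ) (t : ℝ) : TangentSpace 𝓘(ℝ, E) (c t) :=
  mfderivWithin 𝓘(ℝ, ℝ) 𝓘(ℝ, E) c J t (1 : ℝ)

/-- The covariant derivative, for the Levi-Civita connection, of a vector field `X` along the curve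
`c` defined on the interval `J`; in coordinates it is `X' + Γ(c', X)`. -/
def covDeriv (c : ℝ → M) (J : Set ℝ) (X : ∀ t, TangentSpace 𝓘(ℝ, E) (c t)) (t : ℝ) :
    TangentSpace 𝓘(ℝ, E) (c t) :=
  ofCoord (c t) (c t)
    (derivWithin (fun s ↦ toCoord (c t) (c s) (X s)) J t
      + christoffel (chartMetric (c t)) (extChartAt 𝓘(ℝ, E) (c t) (c t))
          (toCoord (c t) (c t) (velocity c J t)) (toCoord (c t) (c t) (X t)))

/-- Smoothness on `J` of a vector field along `c`. -/
def IsSmoothAlong (c : ℝ → M) (J : Set ℝ) (X : ∀ t, TangentSpace 𝓘(ℝ, E) (c t)) : Prop :=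
  ContMDiffOn 𝓘(ℝ, ℝ) 𝓘(ℝ, E).tangent ∞
    (fun t ↦ (⟨c t, X t⟩ : TangentBundle 𝓘(ℝ, E) M)) J

/-- `c` is a (non-constant) geodesic on the interval `J`. -/
structure IsGeodesicOn (c : ℝ → M) (J : Set ℝ) : Prop where
  smooth : ContMDiffOn 𝓘(ℝ, ℝ) 𝓘(ℝ, E) ∞ c J
  velocity_ne_zero : ∀ t ∈ J, velocity (E := E) c J t ≠ 0
  covDeriv_velocity : ∀ t ∈ J, covDeriv (E := E) c J (velocity c J) t = 0

/-- `X` is a parallel vector field along `c`. -/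
def IsParallelOn (c : ℝ → M) (J : Set ℝ) (X : ∀ t, TangentSpace 𝓘(ℝ, E) (c t)) : Prop :=
  IsSmoothAlong c J X ∧ ∀ t ∈ J, covDeriv c J X t = 0

/-- `X` is a Jacobi field along `c`: `X'' + R(X, c')c' = 0`. -/
def IsJacobiFieldOn (c : ℝ → M) (J : Set ℝ) (X : ∀ t, TangentSpace 𝓘(ℝ, E) (c t)) : Prop :=
  IsSmoothAlong c J X ∧ ∀ t ∈ J,
    covDeriv c J (covDeriv c J X) t
      + curvature (c t) (X t) (velocity c J t) (velocity c J t) = 0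

/-- The orthogonal complement `E_t` of the velocity in the tangent space at `c t`. -/
abbrev normalSpace (c : ℝ → M) (J : Set ℝ) (t : ℝ) : Submodule ℝ (TangentSpace 𝓘(ℝ, E) (c t)) :=
  (ℝ ∙ velocity c J t)ᗮ

/-- A Lagrange tensor `A_t : E_{t₀} → E_t` along `c`. -/
structure IsLagrangeTensor (c : ℝ → M) (J : Set ℝ) (t₀ : ℝ)
    (A : ∀ t, normalSpace (E := E) c J t₀ →L[ℝ] normalSpace (E := E) c J t) : Prop where
  /-- `A'' + RA = 0`. -/
  jacobi : ∀ v, IsJacobiFieldOn c J (fun t ↦ (A t v : TangentSpace 𝓘(ℝ, E) (c t)))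
  /-- `A` is non-degenerate. -/
  nondegenerate : ∀ v, v ≠ 0 → ∃ t ∈ J, A t v ≠ 0
  /-- `S = A' A⁻¹` is defined somewhere. -/
  exists_regular : ∃ t ∈ J, (A t).IsInvertible
  /-- `S = A' A⁻¹` is symmetric at regular points. -/
  symmetric : ∀ t ∈ J, (A t).IsInvertible → ∀ x y : normalSpace (E := E) c J t,
    ⟪covDeriv c J (fun s ↦ (A s ((A t).inverse x) : TangentSpace 𝓘(ℝ, E) (c s))) t,
        (y : TangentSpace 𝓘(ℝ, E) (c t))⟫_ℝ
      = ⟪(x : TangentSpace 𝓘(ℝ, E) (c t)),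
        covDeriv c J (fun s ↦ (A s ((A t).inverse y) : TangentSpace 𝓘(ℝ, E) (c s))) t⟫_ℝ

/-- The inverse `(A_t^*)⁻¹ : E_{t₀} → E_t` of the adjoint of `A_t` (for `A_t` invertible). -/
def adjointInv {c : ℝ → M} {J : Set ℝ} {t₀ : ℝ}
    (A : ∀ t, normalSpace (E := E) c J t₀ →L[ℝ] normalSpace (E := E) c J t) (t : ℝ) :
    normalSpace (E := E) c J t₀ →L[ℝ] normalSpace (E := E) c J t :=
  (ContinuousLinearMap.adjoint (A t)).inverse

/-- The matrix `M_t` of the `W`-block of `(A_t^* A_t)⁻¹` in an orthonormal basis of `W`. -/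
def blockMatrix {c : ℝ → M} {J : Set ℝ} {t₀ : ℝ}
    (A : ∀ t, normalSpace (E := E) c J t₀ →L[ℝ] normalSpace (E := E) c J t)
    {W : Submodule ℝ (normalSpace (E := E) c J t₀)} {p : ℕ} (e : OrthonormalBasis (Fin p) ℝ W)
    (t : ℝ) : Matrix (Fin p) (Fin p) ℝ :=
  Matrix.of fun i j ↦
    ⟪adjointInv A t (e i : normalSpace (E := E) c J t₀),
      adjointInv A t (e j : normalSpace (E := E) c J t₀)⟫_ℝ

open scoped Classical in
/-- The function `g_W`: it is `(det M_t)^(-1/2p)` at regular points, and at the (isolated) singular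
points it is given by the limit of these values. -/
def gW {c : ℝ → M} {J : Set ℝ} {t₀ : ℝ}
    (A : ∀ t, normalSpace (E := E) c J t₀ →L[ℝ] normalSpace (E := E) c J t)
    {W : Submodule ℝ (normalSpace (E := E) c J t₀)} {p : ℕ} (e : OrthonormalBasis (Fin p) ℝ W)
    (t : ℝ) : ℝ :=
  if (A t).IsInvertible then (blockMatrix A e t).det ^ (-(1 / (2 * (p : ℝ))))
  else limUnder (𝓝[J \ {t}] t) fun s ↦ (blockMatrix A e s).det ^ (-(1 / (2 * (p : ℝ))))

end Riemannian

end VirtualJacobi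

end

open Bundle Manifold Set VirtualJacobi
open scoped ContDiff

/-
Write `virt v s = (A_s^*)⁻¹ v`. Its Gram matrix over a basis of `W` is `M_s`, so `g_W` is the
`-1/(2p)`-th power of a Gram determinant. The curve of subspaces `virt W` carries a Riccati
inequality: the logarithmic derivative of `g_W` is `tr(S) / p` on it, where `S = A' A⁻¹`, and its
derivative is controlled by `-tr(R)` on the same `p`-plane plus a square which Cauchy-Schwarz
dominates. By Ky Fan's principle `tr(R)` is at least the sum of the `p` smallest eigenvalues, so
`g_W'' ≤ 0`.

At a singular point `t` the symmetry of `S` splits the domain into `ker A_t` and its orthogonal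
complement: dividing `A_s u` by `s - t` for `u` in the kernel desingularizes `A`. Hence `virt v`
extends smoothly through `t` exactly for `v ⟂ ker A_t`, and otherwise blows up like `(s - t)⁻¹`,
which forces `g_W` to vanish at `t` with a corner.
-/

namespace VirtualJacobi

open Filter Topology
open scoped InnerProductSpace

section Coordinates

variable {E : Type*} [NormedAddCommGroup E] [NormedSpace ℝ E]

theorem fderiv_apply_apply {F G H : Type*} [NormedAddCommGroup F] [NormedSpace ℝ F]
    [NormedAddCommGroup G] [NormedSpace ℝ G] [NormedAddCommGroup H] [NormedSpace ℝ H]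
    {B : E → F →L[ℝ] G →L[ℝ] H} {y : E} (hB : DifferentiableAt ℝ B y) (u : E) (v : F) (w : G) :
    fderiv ℝ (fun z ↦ B z v w) y u = fderiv ℝ B y u v w := by
  have h := (hB.hasFDerivAt.clm_apply (hasFDerivAt_const v y)).clm_apply (hasFDerivAt_const w y)
  simp [h.fderiv]

theorem coordCurvature_self (g : E → E →L[ℝ] E →L[ℝ] ℝ) (y u w : E) :
    coordCurvature g y u u w = 0 := by
  simp [coordCurvature]

/-- A smooth pseudo-Riemannian metric on an open subset of a vector space. -/
structure IsMetricOn (g : E → E →L[ℝ] E →L[ℝ] ℝ) (s : Set E) : Prop where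
  isOpen : IsOpen s
  contDiffOn : ContDiffOn ℝ ∞ g s
  isInvertible : ∀ y ∈ s, (g y).IsInvertible
  symm : ∀ y ∈ s, ∀ v w, g y v w = g y w v

namespace IsMetricOn

theorem mono {g : E → E →L[ℝ] E →L[ℝ] ℝ} {s t : Set E} (hg : IsMetricOn g s) (ht : IsOpen t)
    (hts : t ⊆ s) : IsMetricOn g t :=
  ⟨ht, hg.contDiffOn.mono hts, fun y hy ↦ hg.isInvertible y (hts hy),
    fun y hy ↦ hg.symm y (hts hy)⟩

section Derivatives

variable {g : E → E →L[ℝ] E →L[ℝ] ℝ} {s : Set E} {y : E} (hg : IsMetricOn g s) (hy : y ∈ s)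
include hg hy

theorem mem_nhds : s ∈ 𝓝 y := hg.isOpen.mem_nhds hy

theorem contDiffAt : ContDiffAt ℝ ∞ g y := hg.contDiffOn.contDiffAt (hg.mem_nhds hy)

theorem contDiffAt_fderiv : ContDiffAt ℝ ∞ (fderiv ℝ g) y :=
  (hg.contDiffAt hy).fderiv_right (by simp)

theorem differentiableAt : DifferentiableAt ℝ g y := (hg.contDiffAt hy).differentiableAt (by simp)

theorem differentiableAt_fderiv : DifferentiableAt ℝ (fderiv ℝ g) y :=
  (hg.contDiffAt_fderiv hy).differentiableAt (by simp)

theorem fderiv_symm (u v w : E) : fderiv ℝ g y u v w = fderiv ℝ g y u w v := by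
  have h : (fun z ↦ g z v w) =ᶠ[𝓝 y] fun z ↦ g z w v :=
    mem_of_superset (hg.mem_nhds hy) fun z hz ↦ hg.symm z hz v w
  rw [← fderiv_apply_apply (hg.differentiableAt hy), h.fderiv_eq,
    fderiv_apply_apply (hg.differentiableAt hy)]

theorem hasFDerivAt_fderiv_apply (b v w : E) :
    HasFDerivAt (fun z ↦ fderiv ℝ g z b v w)
      ((ContinuousLinearMap.apply ℝ ℝ w ∘L ContinuousLinearMap.apply ℝ (E →L[ℝ] ℝ) v ∘L
        ContinuousLinearMap.apply ℝ (E →L[ℝ] E →L[ℝ] ℝ) b) ∘L fderiv ℝ (fderiv ℝ g) y) y :=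
  (ContinuousLinearMap.apply ℝ ℝ w ∘L ContinuousLinearMap.apply ℝ (E →L[ℝ] ℝ) v ∘L
    ContinuousLinearMap.apply ℝ (E →L[ℝ] E →L[ℝ] ℝ) b).hasFDerivAt.comp y
      (hg.differentiableAt_fderiv hy).hasFDerivAt

theorem fderiv_fderiv_symm (a b v w : E) :
    fderiv ℝ (fderiv ℝ g) y a b v w = fderiv ℝ (fderiv ℝ g) y a b w v := by
  have h : (fun z ↦ fderiv ℝ g z b v w) =ᶠ[𝓝 y] fun z ↦ fderiv ℝ g z b w v :=
    mem_of_superset (hg.mem_nhds hy) fun z hz ↦ hg.fderiv_symm hz b v w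
  exact congr($((hg.hasFDerivAt_fderiv_apply hy b v w).unique
    ((hg.hasFDerivAt_fderiv_apply hy b w v).congr_of_eventuallyEq h)) a)

theorem fderiv_fderiv_comm (a b : E) :
    fderiv ℝ (fderiv ℝ g) y a b = fderiv ℝ (fderiv ℝ g) y b a :=
  ((hg.contDiffAt hy).isSymmSndFDerivAt (by simp [ENat.LEInfty.out])).eq a b

theorem contDiffAt_christoffelLower : ContDiffAt ℝ ∞ (christoffelLower g) y := by
  have h := hg.contDiffAt_fderiv hy
  have h' : ContDiffAt ℝ ∞ (fun z ↦ (fderiv ℝ g z).flip) y :=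
    (ContinuousLinearMap.flipₗᵢ ℝ E E (E →L[ℝ] ℝ)).contDiff.contDiffAt.comp y h
  exact ((h.add h').sub (contDiffAt_const.clm_comp h')).const_smul (1 / 2 : ℝ)

theorem apply_christoffel (u v w : E) :
    g y (christoffel g y u v) w = christoffelLower g y u v w := by
  rw [christoffel_apply, (hg.isInvertible y hy).self_apply_inverse]

theorem christoffel_comm (u v : E) : christoffel g y u v = christoffel g y v u := by
  rw [christoffel_apply, christoffel_apply]
  congr 1
  ext w
  rw [christoffelLower_apply, christoffelLower_apply, hg.fderiv_symm hy w u v]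
  ring

theorem fderiv_eq_christoffel (u v w : E) :
    fderiv ℝ g y u v w = g y (christoffel g y u v) w + g y v (christoffel g y u w) := by
  rw [hg.symm y hy v, hg.apply_christoffel hy, hg.apply_christoffel hy, christoffelLower_apply,
    christoffelLower_apply, hg.fderiv_symm hy v u w, hg.fderiv_symm hy w u v,
    hg.fderiv_symm hy u w v]
  ring

end Derivatives

section Curvature

variable [FiniteDimensional ℝ E] {g : E → E →L[ℝ] E →L[ℝ] ℝ} {s : Set E} {y : E}
  (hg : IsMetricOn g s)
include hg

theorem contDiffAt_christoffel (hy : y ∈ s) : ContDiffAt ℝ ∞ (christoffel g) y := by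
  have : CompleteSpace E := FiniteDimensional.complete ℝ E
  have h : ContDiffAt ℝ ∞ (fun z ↦ (g z).inverse) y :=
    (hg.isInvertible y hy).contDiffAt_map_inverse.comp y (hg.contDiffAt hy)
  exact ((ContinuousLinearMap.compL ℝ E (E →L[ℝ] ℝ) E).contDiff.contDiffAt.comp y h).clm_comp
    (hg.contDiffAt_christoffelLower hy)

theorem differentiableAt_christoffel (hy : y ∈ s) : DifferentiableAt ℝ (christoffel g) y :=
  (hg.contDiffAt_christoffel hy).differentiableAt (by simp)

theorem contDiffWithinAt_coordCurvature {F : Type*} [NormedAddCommGroup F] [NormedSpace ℝ F]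
    {S : Set F} {x : F} {γ u v w : F → E} (hx : γ x ∈ s)
    (hγ : ContDiffWithinAt ℝ ∞ γ S x) (hu : ContDiffWithinAt ℝ ∞ u S x)
    (hv : ContDiffWithinAt ℝ ∞ v S x) (hw : ContDiffWithinAt ℝ ∞ w S x) :
    ContDiffWithinAt ℝ ∞ (fun t ↦ coordCurvature g (γ t) (u t) (v t) (w t)) S x := by
  have hΓ := (hg.contDiffAt_christoffel hx).comp_contDiffWithinAt x hγ
  have hdΓ : ContDiffWithinAt ℝ ∞ (fun t ↦ fderiv ℝ (christoffel g) (γ t)) S x :=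
    ((hg.contDiffAt_christoffel hx).fderiv_right (by simp)).comp_contDiffWithinAt x hγ
  have hΓ₂ {a b : F → E} (ha : ContDiffWithinAt ℝ ∞ a S x) (hb : ContDiffWithinAt ℝ ∞ b S x) :
      ContDiffWithinAt ℝ ∞ (fun t ↦ christoffel g (γ t) (a t) (b t)) S x :=
    (hΓ.clm_apply ha).clm_apply hb
  exact (((((hdΓ.clm_apply hu).clm_apply hv).clm_apply hw).sub
    (((hdΓ.clm_apply hv).clm_apply hu).clm_apply hw)).add (hΓ₂ hu (hΓ₂ hv hw))).sub
    (hΓ₂ hv (hΓ₂ hu hw))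

theorem apply_fderiv_christoffel (hy : y ∈ s) (u a b w : E) :
    g y (fderiv ℝ (christoffel g) y u a b) w =
      1 / 2 * (fderiv ℝ (fderiv ℝ g) y u a b w + fderiv ℝ (fderiv ℝ g) y u b a w
        - fderiv ℝ (fderiv ℝ g) y u w a b)
      - g y (christoffel g y u (christoffel g y a b)) w
      - g y (christoffel g y a b) (christoffel g y u w) := by
  have h₁ := ((hg.differentiableAt hy).hasFDerivAt.clm_apply
    (((hg.differentiableAt_christoffel hy).hasFDerivAt.clm_apply
      (hasFDerivAt_const a y)).clm_apply (hasFDerivAt_const b y))).clm_apply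
        (hasFDerivAt_const w y)
  have h₂ := (((hg.hasFDerivAt_fderiv_apply hy a b w).add
    (hg.hasFDerivAt_fderiv_apply hy b a w)).sub
      (hg.hasFDerivAt_fderiv_apply hy w a b)).const_mul (1 / 2 : ℝ)
  have h₃ := h₁.unique (h₂.congr_of_eventuallyEq (mem_of_superset (hg.mem_nhds hy) fun z hz ↦ by
    simp [hg.apply_christoffel hz, christoffelLower_apply]))
  have h₄ : fderiv ℝ g y u (christoffel g y a b) w + g y (fderiv ℝ (christoffel g) y u a b) w =
      1 / 2 * (fderiv ℝ (fderiv ℝ g) y u a b w + fderiv ℝ (fderiv ℝ g) y u b a w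
        - fderiv ℝ (fderiv ℝ g) y u w a b) := by
    simpa [add_comm] using congr($h₃ u)
  rw [hg.fderiv_eq_christoffel hy] at h₄
  linarith

theorem apply_coordCurvature_comm (hy : y ∈ s) (u v w : E) :
    g y (coordCurvature g y u v v) w = g y (coordCurvature g y w v v) u := by
  have hΓ := hg.christoffel_comm hy
  have hcomm := hg.fderiv_fderiv_comm hy
  have hsymm := hg.fderiv_fderiv_symm hy
  simp only [coordCurvature, map_add, map_sub, add_apply, sub_apply,
    hg.apply_fderiv_christoffel hy]
  rw [hΓ w u, hg.symm y hy (christoffel g y v v) (christoffel g y u w), hcomm v u, hcomm v w,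
    hcomm w u, hg.symm y hy (christoffel g y u v), hsymm v v u w, hsymm u v v w, hsymm w v v u,
    hsymm v v w u, hΓ w v, hΓ v u]
  ring

end Curvature

section Pullback

variable {g₀ g₁ : E → E →L[ℝ] E →L[ℝ] ℝ} {s₀ s₁ : Set E} {φ : E → E} {y : E}
  (hg₀ : IsMetricOn g₀ s₀) (hg₁ : IsMetricOn g₁ s₁) (hφ : ContDiffOn ℝ ∞ φ s₁)
  (hm : MapsTo φ s₁ s₀)
  (hpull : ∀ z ∈ s₁, g₁ z = (g₀ (φ z)).bilinearComp (fderiv ℝ φ z) (fderiv ℝ φ z))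
include hg₀ hg₁ hφ hm hpull

theorem fderiv_pullback (hy : y ∈ s₁) (a b c : E) :
    fderiv ℝ g₁ y a b c =
      fderiv ℝ g₀ (φ y) (fderiv ℝ φ y a) (fderiv ℝ φ y b) (fderiv ℝ φ y c)
        + g₀ (φ y) (fderiv ℝ (fderiv ℝ φ) y a b) (fderiv ℝ φ y c)
        + g₀ (φ y) (fderiv ℝ φ y b) (fderiv ℝ (fderiv ℝ φ) y a c) := by
  have hφy : ContDiffAt ℝ ∞ φ y := hφ.contDiffAt (hg₁.mem_nhds hy)
  have hdφ : DifferentiableAt ℝ (fderiv ℝ φ) y :=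
    (hφy.fderiv_right (m := ∞) (by simp)).differentiableAt (by simp)
  have hdφ' (v : E) : HasFDerivAt (fun z ↦ fderiv ℝ φ z v) _ y :=
    hdφ.hasFDerivAt.clm_apply (hasFDerivAt_const v y)
  have h₀ := (((hg₀.differentiableAt (hm hy)).hasFDerivAt.comp y
    (hφy.differentiableAt (by simp)).hasFDerivAt).clm_apply (hdφ' b)).clm_apply (hdφ' c)
  have h₁ : (fun z ↦ g₁ z b c) =ᶠ[𝓝 y] fun z ↦ g₀ (φ z) (fderiv ℝ φ z b) (fderiv ℝ φ z c) :=
    mem_of_superset (hg₁.mem_nhds hy) fun z hz ↦ by simp [hpull z hz]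
  rw [← fderiv_apply_apply (hg₁.differentiableAt hy), (h₀.congr_of_eventuallyEq h₁).fderiv]
  simp only [Function.comp_apply, ContinuousLinearMap.comp_zero, zero_add,
    ContinuousLinearMap.flip_add, add_apply, ContinuousLinearMap.comp_apply,
    ContinuousLinearMap.flip_apply]
  ring

variable [FiniteDimensional ℝ E]

theorem fderiv_christoffel_pullback (hy : y ∈ s₁) (u v : E) :
    fderiv ℝ φ y (christoffel g₁ y u v) =
      fderiv ℝ (fderiv ℝ φ) y u v
        + christoffel g₀ (φ y) (fderiv ℝ φ y u) (fderiv ℝ φ y v) := by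
  have hcomm := ((hφ.contDiffAt (hg₁.mem_nhds hy)).isSymmSndFDerivAt
    (by simp [ENat.LEInfty.out])).eq
  have hpull_apply (a b : E) : g₁ y a b = g₀ (φ y) (fderiv ℝ φ y a) (fderiv ℝ φ y b) := by
    simp [hpull y hy]
  have hsurj : Function.Surjective (fderiv ℝ φ y) := by
    refine LinearMap.injective_iff_surjective.1 fun a b hab ↦ ?_
    refine (hg₁.isInvertible y hy).injective ?_
    ext w
    rw [hpull_apply, hpull_apply]
    exact congr(g₀ (φ y) $hab (fderiv ℝ φ y w))
  refine (hg₀.isInvertible _ (hm hy)).injective (ContinuousLinearMap.ext fun w' ↦ ?_)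
  obtain ⟨w, rfl⟩ := hsurj w'
  have hd := hg₀.fderiv_pullback hg₁ hφ hm hpull hy
  rw [← hpull_apply, hg₁.apply_christoffel hy, map_add, add_apply,
    hg₀.apply_christoffel (hm hy), christoffelLower_apply, christoffelLower_apply, hd, hd, hd,
    hcomm v u, hcomm w u, hcomm w v, hg₀.symm _ (hm hy) (fderiv ℝ φ y u),
    hg₀.symm _ (hm hy) (fderiv ℝ φ y v)]
  ring

theorem fderiv_fderiv_christoffel_pullback (hy : y ∈ s₁) (u v w : E) :
    fderiv ℝ φ y (fderiv ℝ (christoffel g₁) y u v w)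
        + fderiv ℝ (fderiv ℝ φ) y u (christoffel g₁ y v w)
      = fderiv ℝ (fderiv ℝ (fderiv ℝ φ)) y u v w
        + (christoffel g₀ (φ y) (fderiv ℝ φ y v) (fderiv ℝ (fderiv ℝ φ) y u w)
          + (christoffel g₀ (φ y) (fderiv ℝ (fderiv ℝ φ) y u v) (fderiv ℝ φ y w)
            + fderiv ℝ (christoffel g₀) (φ y) (fderiv ℝ φ y u) (fderiv ℝ φ y v)
              (fderiv ℝ φ y w))) := by
  have hφy : ContDiffAt ℝ ∞ φ y := hφ.contDiffAt (hg₁.mem_nhds hy)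
  have hdφ : ContDiffAt ℝ ∞ (fderiv ℝ φ) y := hφy.fderiv_right (by simp)
  have hdφ₁ : HasFDerivAt (fderiv ℝ φ) _ y := (hdφ.differentiableAt (by simp)).hasFDerivAt
  have hdφ₂ : HasFDerivAt (fderiv ℝ (fderiv ℝ φ)) _ y :=
    ((hdφ.fderiv_right (m := ∞) (by simp)).differentiableAt (by simp)).hasFDerivAt
  have hdφ' (v : E) : HasFDerivAt (fun z ↦ fderiv ℝ φ z v) _ y :=
    hdφ₁.clm_apply (hasFDerivAt_const v y)
  have hl := hdφ₁.clm_apply (((hg₁.differentiableAt_christoffel hy).hasFDerivAt.clm_apply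
    (hasFDerivAt_const v y)).clm_apply (hasFDerivAt_const w y))
  have hr := ((hdφ₂.clm_apply (hasFDerivAt_const v y)).clm_apply (hasFDerivAt_const w y)).add
    ((((hg₀.differentiableAt_christoffel (hm hy)).hasFDerivAt.comp y
      (hφy.differentiableAt (by simp)).hasFDerivAt).clm_apply (hdφ' v)).clm_apply (hdφ' w))
  have h := hl.unique (hr.congr_of_eventuallyEq (mem_of_superset (hg₁.mem_nhds hy) fun z hz ↦
    hg₀.fderiv_christoffel_pullback hg₁ hφ hm hpull hz v w))
  simpa using congr($h u)

theorem fderiv_coordCurvature_pullback (hy : y ∈ s₁) (u v w : E) :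
    fderiv ℝ φ y (coordCurvature g₁ y u v w) =
      coordCurvature g₀ (φ y) (fderiv ℝ φ y u) (fderiv ℝ φ y v) (fderiv ℝ φ y w) := by
  have hφy : ContDiffAt ℝ ∞ φ y := hφ.contDiffAt (hg₁.mem_nhds hy)
  have hdφ : ContDiffAt ℝ ∞ (fderiv ℝ φ) y := hφy.fderiv_right (by simp)
  have hcomm := (hφy.isSymmSndFDerivAt (by simp [ENat.LEInfty.out])).eq
  have hcomm₂ := (hdφ.isSymmSndFDerivAt (by simp [ENat.LEInfty.out])).eq
  have hΓ := hg₀.fderiv_christoffel_pullback hg₁ hφ hm hpull hy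
  have huv := hg₀.fderiv_fderiv_christoffel_pullback hg₁ hφ hm hpull hy u v w
  have hvu := hg₀.fderiv_fderiv_christoffel_pullback hg₁ hφ hm hpull hy v u w
  rw [hcomm₂ v u, hcomm v u] at hvu
  simp only [coordCurvature, map_add, map_sub, hΓ, eq_sub_of_add_eq huv, eq_sub_of_add_eq hvu]
  abel

end Pullback

end IsMetricOn

end Coordinates

section Charts

variable {E : Type*} [NormedAddCommGroup E] [NormedSpace ℝ E]
  {M : Type*} [TopologicalSpace M] [ChartedSpace E M] {x₀ x₁ x : M} {y : E}

theorem extChartAt_symm_extChartAt (hx : x ∈ (chartAt E x₀).source) :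
    (extChartAt 𝓘(ℝ, E) x₀).symm (extChartAt 𝓘(ℝ, E) x₀ x) = x :=
  (extChartAt 𝓘(ℝ, E) x₀).left_inv (by simpa using hx)

theorem exists_extChartAt_eq (hy : y ∈ (extChartAt 𝓘(ℝ, E) x₀).target) :
    ∃ x ∈ (chartAt E x₀).source, extChartAt 𝓘(ℝ, E) x₀ x = y :=
  ⟨(extChartAt 𝓘(ℝ, E) x₀).symm y, by simpa using (extChartAt 𝓘(ℝ, E) x₀).map_target hy,
    (extChartAt 𝓘(ℝ, E) x₀).right_inv hy⟩

theorem extChartAt_mem_target (hx : x ∈ (chartAt E x₀).source) :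
    extChartAt 𝓘(ℝ, E) x₀ x ∈ (extChartAt 𝓘(ℝ, E) x₀).target :=
  (extChartAt 𝓘(ℝ, E) x₀).map_source (by simpa using hx)

/-- The change of coordinates from the preferred chart at `x₁` to the preferred chart at `x₀`, on
the set where both charts are defined. -/
noncomputable def transition (x₁ x₀ : M) : PartialEquiv E E :=
  (extChartAt 𝓘(ℝ, E) x₁).symm ≫ extChartAt 𝓘(ℝ, E) x₀

theorem transition_extChartAt (h₁ : x ∈ (chartAt E x₁).source) :
    transition x₁ x₀ (extChartAt 𝓘(ℝ, E) x₁ x) = extChartAt 𝓘(ℝ, E) x₀ x := by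
  simp [transition, h₁]

theorem extChartAt_mem_source_transition (h₀ : x ∈ (chartAt E x₀).source)
    (h₁ : x ∈ (chartAt E x₁).source) :
    extChartAt 𝓘(ℝ, E) x₁ x ∈ (transition (E := E) x₁ x₀).source := by
  simp [transition, h₀, h₁]

theorem exists_extChartAt_eq_of_mem_transition (hy : y ∈ (transition x₁ x₀).source) :
    ∃ x, x ∈ (chartAt E x₀).source ∧ x ∈ (chartAt E x₁).source ∧
      extChartAt 𝓘(ℝ, E) x₁ x = y := by
  obtain ⟨hy₁, hy₀⟩ := (extChartAt 𝓘(ℝ, E) x₁).symm.trans_source _ ▸ hy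
  obtain ⟨x, hx, rfl⟩ := exists_extChartAt_eq hy₁
  refine ⟨x, ?_, hx, rfl⟩
  simpa only [mem_preimage, extChartAt_symm_extChartAt hx, extChartAt_source] using hy₀

theorem isOpen_source_transition (x₁ x₀ : M) : IsOpen (transition (E := E) x₁ x₀).source :=
  (continuousOn_extChartAt_symm x₁).isOpen_inter_preimage (isOpen_extChartAt_target x₁)
    (isOpen_extChartAt_source x₀)

theorem mapsTo_transition (x₁ x₀ : M) :
    MapsTo (transition x₁ x₀) (transition x₁ x₀).source (extChartAt 𝓘(ℝ, E) x₀).target :=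
  fun _ hy ↦ ((transition x₁ x₀).map_source hy).1

variable [IsManifold 𝓘(ℝ, E) ∞ M]

theorem toCoord_ofCoord (hx : x ∈ (chartAt E x₀).source) (u : E) :
    toCoord x₀ x (ofCoord x₀ x u) = u :=
  (trivializationAt E (TangentSpace 𝓘(ℝ, E) : M → Type _) x₀).continuousLinearMapAt_symmL
    (by simpa using hx) u

theorem ofCoord_toCoord (hx : x ∈ (chartAt E x₀).source) (w : TangentSpace 𝓘(ℝ, E) x) :
    ofCoord x₀ x (toCoord x₀ x w) = w :=
  (trivializationAt E (TangentSpace 𝓘(ℝ, E) : M → Type _) x₀).symmL_continuousLinearMapAt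
    (by simpa using hx) w

theorem toCoord_surjective (hx : x ∈ (chartAt E x₀).source) :
    Function.Surjective (toCoord (E := E) x₀ x) :=
  fun u ↦ ⟨_, toCoord_ofCoord hx u⟩

theorem toCoord_injective (hx : x ∈ (chartAt E x₀).source) :
    Function.Injective (toCoord (E := E) x₀ x) :=
  Function.LeftInverse.injective (ofCoord_toCoord hx)

theorem toCoord_eq_tangentCoordChange (hx : x ∈ (chartAt E x₀).source)
    (w : TangentSpace 𝓘(ℝ, E) x) :
    toCoord x₀ x w = tangentCoordChange 𝓘(ℝ, E) x x₀ x w := by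
  rw [toCoord, TangentBundle.continuousLinearMapAt_trivializationAt_eq_core hx]
  rfl

theorem toCoord_eq_trivializationAt (hx : x ∈ (chartAt E x₀).source)
    (w : TangentSpace 𝓘(ℝ, E) x) : toCoord x₀ x w =
      (trivializationAt E (TangentSpace 𝓘(ℝ, E) : M → Type _) x₀ ⟨x, w⟩).2 := by
  rw [toCoord, Trivialization.continuousLinearMapAt_apply, Trivialization.linearMapAt_apply,
    if_pos (by simpa using hx)]

theorem contDiffOn_transition (x₁ x₀ : M) :
    ContDiffOn ℝ ∞ (transition x₁ x₀) (transition (E := E) x₁ x₀).source :=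
  contDiffOn_ext_coord_change x₀ x₁

theorem contDiffAt_transition (h₀ : x ∈ (chartAt E x₀).source) (h₁ : x ∈ (chartAt E x₁).source) :
    ContDiffAt ℝ ∞ (transition x₁ x₀) (extChartAt 𝓘(ℝ, E) x₁ x) :=
  (contDiffOn_transition x₁ x₀).contDiffAt
    ((isOpen_source_transition x₁ x₀).mem_nhds (extChartAt_mem_source_transition h₀ h₁))

theorem fderiv_transition_toCoord (h₀ : x ∈ (chartAt E x₀).source)
    (h₁ : x ∈ (chartAt E x₁).source) (w : TangentSpace 𝓘(ℝ, E) x) :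
    fderiv ℝ (transition x₁ x₀) (extChartAt 𝓘(ℝ, E) x₁ x) (toCoord x₁ x w) = toCoord x₀ x w := by
  rw [toCoord_eq_tangentCoordChange h₀, toCoord_eq_tangentCoordChange h₁,
    ← tangentCoordChange_comp (I := 𝓘(ℝ, E)) (w := x) (x := x₁) (y := x₀) (z := x) (v := w)
      (by simp [h₀, h₁]), tangentCoordChange_def (x := x₁)]
  simp [transition, fderivWithin_univ]

theorem contMDiffOn_ofCoord (x₀ : M) (u : E) :
    ContMDiffOn 𝓘(ℝ, E) 𝓘(ℝ, E).tangent ∞ (fun y : E ↦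
      (⟨(extChartAt 𝓘(ℝ, E) x₀).symm y, ofCoord x₀ ((extChartAt 𝓘(ℝ, E) x₀).symm y) u⟩ :
        TangentBundle 𝓘(ℝ, E) M)) (extChartAt 𝓘(ℝ, E) x₀).target := by
  have hm : ∀ y ∈ (extChartAt 𝓘(ℝ, E) x₀).target,
      (extChartAt 𝓘(ℝ, E) x₀).symm y ∈ (chartAt E x₀).source := fun y hy ↦ by
    simpa using (extChartAt 𝓘(ℝ, E) x₀).map_target hy
  refine ((trivializationAt E (TangentSpace 𝓘(ℝ, E) : M → Type _) x₀).contMDiffOn_iff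
    fun y hy ↦ ?_).2 ⟨contMDiffOn_extChartAt_symm x₀, contMDiffOn_const (c := u) |>.congr
      fun y hy ↦ ?_⟩
  · rw [Trivialization.mem_source]
    simpa using hm y hy
  · rw [← toCoord_eq_trivializationAt (hm y hy), toCoord_ofCoord (hm y hy)]

section Metric

variable [RiemannianBundle (fun x : M ↦ TangentSpace 𝓘(ℝ, E) x)]

theorem chartMetric_apply (x₀ : M) (y u v : E) :
    chartMetric x₀ y u v = ⟪ofCoord x₀ ((extChartAt 𝓘(ℝ, E) x₀).symm y) u,
      ofCoord x₀ ((extChartAt 𝓘(ℝ, E) x₀).symm y) v⟫_ℝ := rfl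

theorem chartMetric_symm (x₀ : M) (y u v : E) :
    chartMetric x₀ y u v = chartMetric x₀ y v u := by
  rw [chartMetric_apply, chartMetric_apply, real_inner_comm]

theorem chartMetric_toCoord (hx : x ∈ (chartAt E x₀).source) (u v : TangentSpace 𝓘(ℝ, E) x) :
    chartMetric x₀ (extChartAt 𝓘(ℝ, E) x₀ x) (toCoord x₀ x u) (toCoord x₀ x v) = ⟪u, v⟫_ℝ := by
  suffices h : ∀ z : M, z = x →
      ⟪ofCoord x₀ z (toCoord x₀ x u), ofCoord x₀ z (toCoord x₀ x v)⟫_ℝ = ⟪u, v⟫_ℝ from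
    h _ (extChartAt_symm_extChartAt hx)
  rintro z rfl
  rw [ofCoord_toCoord hx, ofCoord_toCoord hx]

theorem chartMetric_eq_bilinearComp_fderiv_transition (hy : y ∈ (transition x₁ x₀).source) :
    chartMetric x₁ y = (chartMetric x₀ (transition x₁ x₀ y)).bilinearComp
      (fderiv ℝ (transition x₁ x₀) y) (fderiv ℝ (transition x₁ x₀) y) := by
  obtain ⟨z, h₀, h₁, rfl⟩ := exists_extChartAt_eq_of_mem_transition hy
  ext u v
  obtain ⟨w, rfl⟩ := toCoord_surjective h₁ u
  obtain ⟨w', rfl⟩ := toCoord_surjective h₁ v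
  rw [ContinuousLinearMap.bilinearComp_apply, chartMetric_toCoord h₁,
    fderiv_transition_toCoord h₀ h₁, fderiv_transition_toCoord h₀ h₁, transition_extChartAt h₁,
    chartMetric_toCoord h₀]

variable [FiniteDimensional ℝ E]

theorem isInvertible_chartMetric (hx : x ∈ (chartAt E x₀).source) :
    (chartMetric x₀ (extChartAt 𝓘(ℝ, E) x₀ x)).IsInvertible := by
  have hinj : Function.Injective (chartMetric x₀ (extChartAt 𝓘(ℝ, E) x₀ x)) := by
    rw [injective_iff_map_eq_zero]
    intro u hu
    obtain ⟨w, rfl⟩ := toCoord_surjective hx u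
    have hw := chartMetric_toCoord hx w w
    rw [hu] at hw
    rw [inner_self_eq_zero.1 hw.symm, map_zero]
  let e : E ≃ₗ[ℝ] (E →L[ℝ] ℝ) := LinearMap.linearEquivOfInjective
    (chartMetric x₀ (extChartAt 𝓘(ℝ, E) x₀ x)).toLinearMap hinj (by
      rw [← (LinearMap.toContinuousLinearMap : (E →ₗ[ℝ] ℝ) ≃ₗ[ℝ] _).finrank_eq,
        Module.finrank_linearMap, Module.finrank_self, mul_one])
  exact ⟨e.toContinuousLinearEquiv, by ext; rfl⟩

variable [IsContMDiffRiemannianBundle 𝓘(ℝ, E) ∞ E (fun x : M ↦ TangentSpace 𝓘(ℝ, E) x)]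

theorem isMetricOn_chartMetric (x₀ : M) :
    IsMetricOn (chartMetric x₀) (extChartAt 𝓘(ℝ, E) x₀).target where
  isOpen := isOpen_extChartAt_target x₀
  contDiffOn := contDiffOn_clm_apply.2 fun u ↦ contDiffOn_clm_apply.2 fun v ↦
    contMDiffOn_iff_contDiffOn.1 <| ContMDiffOn.inner_bundle
      (E := (TangentSpace 𝓘(ℝ, E) : M → Type _)) (contMDiffOn_ofCoord x₀ u)
      (contMDiffOn_ofCoord x₀ v)
  isInvertible := fun y hy ↦ by
    obtain ⟨x, hx, rfl⟩ := exists_extChartAt_eq hy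
    exact isInvertible_chartMetric hx
  symm := fun y _ ↦ chartMetric_symm x₀ y

theorem isMetricOn_chartMetric_transition (x₁ x₀ : M) :
    IsMetricOn (chartMetric x₁) (transition (E := E) x₁ x₀).source :=
  (isMetricOn_chartMetric x₁).mono (isOpen_source_transition x₁ x₀) fun _ hy ↦ hy.1

theorem fderiv_transition_christoffel (h₀ : x ∈ (chartAt E x₀).source)
    (h₁ : x ∈ (chartAt E x₁).source) (u v : E) :
    fderiv ℝ (transition x₁ x₀) (extChartAt 𝓘(ℝ, E) x₁ x)
        (christoffel (chartMetric x₁) (extChartAt 𝓘(ℝ, E) x₁ x) u v) =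
      fderiv ℝ (fderiv ℝ (transition x₁ x₀)) (extChartAt 𝓘(ℝ, E) x₁ x) u v
        + christoffel (chartMetric x₀) (extChartAt 𝓘(ℝ, E) x₀ x)
          (fderiv ℝ (transition x₁ x₀) (extChartAt 𝓘(ℝ, E) x₁ x) u)
          (fderiv ℝ (transition x₁ x₀) (extChartAt 𝓘(ℝ, E) x₁ x) v) := by
  rw [← transition_extChartAt (x₀ := x₀) h₁]
  exact (isMetricOn_chartMetric x₀).fderiv_christoffel_pullback
    (isMetricOn_chartMetric_transition x₁ x₀) (contDiffOn_transition x₁ x₀)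
    (mapsTo_transition x₁ x₀) (fun _ ↦ chartMetric_eq_bilinearComp_fderiv_transition)
    (extChartAt_mem_source_transition h₀ h₁) u v

theorem toCoord_curvature (h₀ : x ∈ (chartAt E x₀).source) (u v w : TangentSpace 𝓘(ℝ, E) x) :
    toCoord x₀ x (curvature x u v w) = coordCurvature (chartMetric x₀) (extChartAt 𝓘(ℝ, E) x₀ x)
      (toCoord x₀ x u) (toCoord x₀ x v) (toCoord x₀ x w) := by
  have hx : x ∈ (chartAt E x).source := mem_chart_source E x
  rw [← fderiv_transition_toCoord h₀ hx, curvature, toCoord_ofCoord hx,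
    ← fderiv_transition_toCoord h₀ hx u, ← fderiv_transition_toCoord h₀ hx v,
    ← fderiv_transition_toCoord h₀ hx w, ← transition_extChartAt (x₀ := x₀) hx]
  exact (isMetricOn_chartMetric x₀).fderiv_coordCurvature_pullback
    (isMetricOn_chartMetric_transition x x₀) (contDiffOn_transition x x₀)
    (mapsTo_transition x x₀) (fun _ ↦ chartMetric_eq_bilinearComp_fderiv_transition)
    (extChartAt_mem_source_transition h₀ hx) _ _ _

theorem inner_curvature_comm (x : M) (u v w : TangentSpace 𝓘(ℝ, E) x) :
    ⟪curvature x u v v, w⟫_ℝ = ⟪curvature x w v v, u⟫_ℝ := by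
  have hx : x ∈ (chartAt E x).source := mem_chart_source E x
  rw [← chartMetric_toCoord hx, ← chartMetric_toCoord hx, toCoord_curvature hx,
    toCoord_curvature hx]
  exact (isMetricOn_chartMetric x).apply_coordCurvature_comm (extChartAt_mem_target hx) _ _ _

end Metric

theorem curvature_self [RiemannianBundle (fun x : M ↦ TangentSpace 𝓘(ℝ, E) x)]
    (x : M) (u w : TangentSpace 𝓘(ℝ, E) x) : curvature x u u w = 0 := by
  rw [curvature, coordCurvature_self, map_zero]

end Charts

section AlongCurve

variable {E : Type*} [NormedAddCommGroup E] [NormedSpace ℝ E]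
  {M : Type*} [TopologicalSpace M] [ChartedSpace E M]
  {x₀ : M} {c : ℝ → M} {J : Set ℝ} {t : ℝ} {X Y : ∀ t, TangentSpace 𝓘(ℝ, E) (c t)}

theorem hasDerivWithinAt_fderiv_apply {F : Type*} [NormedAddCommGroup F] [NormedSpace ℝ F]
    {φ : E → F} {γ a : ℝ → E} {γ' a' : E} (hφ : ContDiffAt ℝ ∞ φ (γ t))
    (hγ : HasDerivWithinAt γ γ' J t) (ha : HasDerivWithinAt a a' J t) :
    HasDerivWithinAt (fun s ↦ fderiv ℝ φ (γ s) (a s))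
      (fderiv ℝ (fderiv ℝ φ) (γ t) γ' (a t) + fderiv ℝ φ (γ t) a') J t :=
  (((hφ.fderiv_right (m := ∞) (by simp)).differentiableAt
    (by simp)).hasFDerivAt.comp_hasDerivWithinAt t hγ).clm_apply ha

theorem eventually_mem_source (hc : ContMDiffWithinAt 𝓘(ℝ, ℝ) 𝓘(ℝ, E) ∞ c J t)
    (h₀ : c t ∈ (chartAt E x₀).source) : ∀ᶠ s in 𝓝[J] t, c s ∈ (chartAt E x₀).source :=
  hc.continuousWithinAt.eventually ((chartAt E x₀).open_source.mem_nhds h₀)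

variable [IsManifold 𝓘(ℝ, E) ∞ M]

/-- Smoothness at `t`, within `J`, of a vector field along `c`. -/
def SmoothAlongAt (c : ℝ → M) (J : Set ℝ) (X : ∀ t, TangentSpace 𝓘(ℝ, E) (c t)) (t : ℝ) : Prop :=
  ContMDiffWithinAt 𝓘(ℝ, ℝ) 𝓘(ℝ, E).tangent ∞
    (fun t ↦ (⟨c t, X t⟩ : TangentBundle 𝓘(ℝ, E) M)) J t

theorem smoothAlongAt_iff (hc : ContMDiffWithinAt 𝓘(ℝ, ℝ) 𝓘(ℝ, E) ∞ c J t)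
    (h₀ : c t ∈ (chartAt E x₀).source) :
    SmoothAlongAt c J X t ↔ ContDiffWithinAt ℝ ∞ (fun s ↦ toCoord x₀ (c s) (X s)) J t := by
  have hmem : (⟨c t, X t⟩ : TangentBundle 𝓘(ℝ, E) M) ∈
      (trivializationAt E (TangentSpace 𝓘(ℝ, E) : M → Type _) x₀).source := by
    rw [Trivialization.mem_source]
    simpa using h₀
  have hiff := (trivializationAt E (TangentSpace 𝓘(ℝ, E) : M → Type _) x₀).contMDiffWithinAt_iff
    (IM := 𝓘(ℝ, ℝ)) (IB := 𝓘(ℝ, E)) (n := ∞) (s := J)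
    (f := fun s ↦ (⟨c s, X s⟩ : TangentBundle 𝓘(ℝ, E) M)) hmem
  rw [contMDiffWithinAt_iff_contDiffWithinAt] at hiff
  refine (hiff.trans (and_iff_right hc)).trans
    (Filter.EventuallyEq.congr_contDiffWithinAt ?_ (toCoord_eq_trivializationAt h₀ (X t)).symm)
  filter_upwards [eventually_mem_source hc h₀] with s hs
  exact (toCoord_eq_trivializationAt hs (X s)).symm

theorem hasDerivWithinAt_extChartAt (hc : ContMDiffWithinAt 𝓘(ℝ, ℝ) 𝓘(ℝ, E) ∞ c J t)
    (h₀ : c t ∈ (chartAt E x₀).source) :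
    HasDerivWithinAt (fun s ↦ extChartAt 𝓘(ℝ, E) x₀ (c s)) (toCoord x₀ (c t) (velocity c J t))
      J t := by
  have hφ : MDifferentiableAt 𝓘(ℝ, E) 𝓘(ℝ, E) (extChartAt 𝓘(ℝ, E) x₀) (c t) :=
    mdifferentiableAt_extChartAt h₀
  have hcomp := hφ.hasMFDerivAt.comp_hasMFDerivWithinAt t
    (hc.mdifferentiableWithinAt (by simp)).hasMFDerivWithinAt
  obtain ⟨L, hL, hL₁⟩ : ∃ L : ℝ →L[ℝ] E,
      HasFDerivWithinAt (fun s ↦ extChartAt 𝓘(ℝ, E) x₀ (c s)) L J t ∧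
      L 1 = mfderiv 𝓘(ℝ, E) 𝓘(ℝ, E) (extChartAt 𝓘(ℝ, E) x₀) (c t) (velocity c J t) :=
    ⟨_, hcomp.hasFDerivWithinAt, rfl⟩
  have hL₁' : toCoord x₀ (c t) (velocity c J t) = L 1 := by
    rw [hL₁, toCoord, TangentBundle.continuousLinearMapAt_trivializationAt h₀]
    rfl
  rw [hL₁']
  exact hL.hasDerivWithinAt

theorem contDiffWithinAt_extChartAt_comp (hc : ContMDiffWithinAt 𝓘(ℝ, ℝ) 𝓘(ℝ, E) ∞ c J t)
    (h₀ : c t ∈ (chartAt E x₀).source) :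
    ContDiffWithinAt ℝ ∞ (fun s ↦ extChartAt 𝓘(ℝ, E) x₀ (c s)) J t := by
  rw [← contMDiffWithinAt_iff_contDiffWithinAt]
  exact (contMDiffAt_extChartAt' (I := 𝓘(ℝ, E)) (n := ∞) h₀).comp_contMDiffWithinAt t hc

theorem SmoothAlongAt.differentiableWithinAt (hX : SmoothAlongAt c J X t)
    (hc : ContMDiffWithinAt 𝓘(ℝ, ℝ) 𝓘(ℝ, E) ∞ c J t) (h₀ : c t ∈ (chartAt E x₀).source) :
    DifferentiableWithinAt ℝ (fun s ↦ toCoord x₀ (c s) (X s)) J t :=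
  ((smoothAlongAt_iff hc h₀).1 hX).differentiableWithinAt (by simp)

theorem smoothAlongAt_velocity (hc : ContMDiffOn 𝓘(ℝ, ℝ) 𝓘(ℝ, E) ∞ c J) (hJ : UniqueDiffOn ℝ J)
    (ht : t ∈ J) : SmoothAlongAt (E := E) c J (velocity c J) t := by
  have h₀ := mem_chart_source E (c t)
  rw [smoothAlongAt_iff (hc t ht) h₀]
  refine ((contDiffWithinAt_extChartAt_comp (hc t ht) h₀).derivWithin hJ (m := ∞) (by simp)
    ht).congr_of_eventuallyEq ?_ ?_
  · filter_upwards [eventually_mem_source (hc t ht) h₀, self_mem_nhdsWithin] with s hs hsJ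
    exact ((hasDerivWithinAt_extChartAt (hc s hsJ) hs).derivWithin (hJ s hsJ)).symm
  · exact ((hasDerivWithinAt_extChartAt (hc t ht) h₀).derivWithin (hJ t ht)).symm

theorem hasDerivWithinAt_toCoord {x₁ : M} (hc : ContMDiffWithinAt 𝓘(ℝ, ℝ) 𝓘(ℝ, E) ∞ c J t)
    (h₀ : c t ∈ (chartAt E x₀).source) (h₁ : c t ∈ (chartAt E x₁).source)
    (hX : DifferentiableWithinAt ℝ (fun s ↦ toCoord x₁ (c s) (X s)) J t) :
    HasDerivWithinAt (fun s ↦ toCoord x₀ (c s) (X s))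
      (fderiv ℝ (fderiv ℝ (transition x₁ x₀)) (extChartAt 𝓘(ℝ, E) x₁ (c t))
          (toCoord x₁ (c t) (velocity c J t)) (toCoord x₁ (c t) (X t))
        + fderiv ℝ (transition x₁ x₀) (extChartAt 𝓘(ℝ, E) x₁ (c t))
          (derivWithin (fun s ↦ toCoord x₁ (c s) (X s)) J t)) J t := by
  have hφ := hasDerivWithinAt_fderiv_apply (φ := transition x₁ x₀)
    (γ := fun s ↦ extChartAt 𝓘(ℝ, E) x₁ (c s)) (contDiffAt_transition h₀ h₁)
    (hasDerivWithinAt_extChartAt hc h₁) hX.hasDerivWithinAt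
  refine hφ.congr_of_eventuallyEq ?_ (fderiv_transition_toCoord h₀ h₁ (X t)).symm
  filter_upwards [eventually_mem_source hc h₀, eventually_mem_source hc h₁] with s hs₀ hs₁
  exact (fderiv_transition_toCoord hs₀ hs₁ (X s)).symm

theorem SmoothAlongAt.eventually_differentiableWithinAt (hX : SmoothAlongAt c J X t)
    (hc : ContMDiffOn 𝓘(ℝ, ℝ) 𝓘(ℝ, E) ∞ c J) (ht : t ∈ J) :
    ∀ᶠ s in 𝓝[J] t, DifferentiableWithinAt ℝ (fun r ↦ toCoord (c s) (c r) (X r)) J s := by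
  have h₀ := mem_chart_source E (c t)
  have hX₁ := (((smoothAlongAt_iff (hc t ht) h₀).1 hX).of_le (m := 1) (by simp)).eventually
    (by simp)
  rw [insert_eq_of_mem ht] at hX₁
  filter_upwards [hX₁, eventually_mem_source (hc t ht) h₀, self_mem_nhdsWithin] with s hs hs₀ hsJ
  exact (hasDerivWithinAt_toCoord (hc s hsJ) (mem_chart_source E (c s)) hs₀
    (hs.differentiableWithinAt (by simp))).differentiableWithinAt

variable [RiemannianBundle (fun x : M ↦ TangentSpace 𝓘(ℝ, E) x)]
  [IsContMDiffRiemannianBundle 𝓘(ℝ, E) ∞ E (fun x : M ↦ TangentSpace 𝓘(ℝ, E) x)]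

theorem SmoothAlongAt.inner (hX : SmoothAlongAt c J X t) (hY : SmoothAlongAt c J Y t) :
    ContDiffWithinAt ℝ ∞ (fun s ↦ ⟪X s, Y s⟫_ℝ) J t := by
  rw [← contMDiffWithinAt_iff_contDiffWithinAt]
  exact ContMDiffWithinAt.inner_bundle (E := (TangentSpace 𝓘(ℝ, E) : M → Type _)) hX hY

variable [FiniteDimensional ℝ E]

theorem toCoord_covDeriv_of_differentiableWithinAt
    (hX : DifferentiableWithinAt ℝ (fun s ↦ toCoord (c t) (c s) (X s)) J t)
    (hc : ContMDiffWithinAt 𝓘(ℝ, ℝ) 𝓘(ℝ, E) ∞ c J t)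
    (hJ : UniqueDiffWithinAt ℝ J t) (h₀ : c t ∈ (chartAt E x₀).source) :
    toCoord x₀ (c t) (covDeriv c J X t) = derivWithin (fun s ↦ toCoord x₀ (c s) (X s)) J t
      + christoffel (chartMetric x₀) (extChartAt 𝓘(ℝ, E) x₀ (c t))
          (toCoord x₀ (c t) (velocity c J t)) (toCoord x₀ (c t) (X t)) := by
  have h₁ := mem_chart_source E (c t)
  rw [(hasDerivWithinAt_toCoord hc h₀ h₁ hX).derivWithin hJ,
    ← fderiv_transition_toCoord h₀ h₁ (covDeriv c J X t), covDeriv,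
    toCoord_ofCoord h₁, map_add, fderiv_transition_christoffel h₀ h₁,
    fderiv_transition_toCoord h₀ h₁, fderiv_transition_toCoord h₀ h₁]
  abel

theorem toCoord_covDeriv (hX : SmoothAlongAt c J X t)
    (hc : ContMDiffWithinAt 𝓘(ℝ, ℝ) 𝓘(ℝ, E) ∞ c J t)
    (hJ : UniqueDiffWithinAt ℝ J t) (h₀ : c t ∈ (chartAt E x₀).source) :
    toCoord x₀ (c t) (covDeriv c J X t) = derivWithin (fun s ↦ toCoord x₀ (c s) (X s)) J t
      + christoffel (chartMetric x₀) (extChartAt 𝓘(ℝ, E) x₀ (c t))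
          (toCoord x₀ (c t) (velocity c J t)) (toCoord x₀ (c t) (X t)) :=
  toCoord_covDeriv_of_differentiableWithinAt
    (hX.differentiableWithinAt hc (mem_chart_source E (c t))) hc hJ h₀

theorem hasDerivWithinAt_inner (hX : SmoothAlongAt c J X t) (hY : SmoothAlongAt c J Y t)
    (hc : ContMDiffWithinAt 𝓘(ℝ, ℝ) 𝓘(ℝ, E) ∞ c J t) (hJ : UniqueDiffWithinAt ℝ J t) :
    HasDerivWithinAt (fun s ↦ ⟪X s, Y s⟫_ℝ)
      (⟪covDeriv c J X t, Y t⟫_ℝ + ⟪X t, covDeriv c J Y t⟫_ℝ) J t := by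
  have h₀ := mem_chart_source E (c t)
  have hg := isMetricOn_chartMetric (E := E) (c t)
  have ht := extChartAt_mem_target (E := E) h₀
  have hx := (hX.differentiableWithinAt hc h₀).hasDerivWithinAt
  have hy := (hY.differentiableWithinAt hc h₀).hasDerivWithinAt
  have hgc := (hg.differentiableAt ht).hasFDerivAt.comp_hasDerivWithinAt t
    (hasDerivWithinAt_extChartAt hc h₀)
  have hgXY : HasDerivWithinAt (fun s ↦ ⟪X s, Y s⟫_ℝ) _ J t :=
    ((hgc.clm_apply hx).clm_apply hy).congr_of_eventuallyEq (by
      filter_upwards [eventually_mem_source hc h₀] with s hs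
      exact (chartMetric_toCoord hs (X s) (Y s)).symm) (chartMetric_toCoord h₀ (X t) (Y t)).symm
  convert hgXY using 1
  rw [← chartMetric_toCoord h₀, ← chartMetric_toCoord h₀, toCoord_covDeriv hX hc hJ h₀,
    toCoord_covDeriv hY hc hJ h₀]
  simp only [map_add, add_apply, Function.comp]
  rw [hg.fderiv_eq_christoffel ht]
  ring

theorem SmoothAlongAt.covDeriv (hX : SmoothAlongAt c J X t)
    (hc : ContMDiffOn 𝓘(ℝ, ℝ) 𝓘(ℝ, E) ∞ c J) (hJ : UniqueDiffOn ℝ J) (ht : t ∈ J) :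
    SmoothAlongAt c J (covDeriv c J X) t := by
  have h₀ := mem_chart_source E (c t)
  rw [smoothAlongAt_iff (hc t ht) h₀]
  have hx := (smoothAlongAt_iff (hc t ht) h₀).1 hX
  have hv := (smoothAlongAt_iff (hc t ht) h₀).1 (smoothAlongAt_velocity hc hJ ht)
  have hΓ := ((isMetricOn_chartMetric (c t)).contDiffAt_christoffel
    (extChartAt_mem_target h₀)).comp_contDiffWithinAt t
      (contDiffWithinAt_extChartAt_comp (hc t ht) h₀)
  refine ((hx.derivWithin hJ (m := ∞) (by simp) ht).add
    ((hΓ.clm_apply hv).clm_apply hx)).congr_of_eventuallyEq ?_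
      (toCoord_covDeriv hX (hc t ht) (hJ t ht) h₀)
  filter_upwards [eventually_mem_source (hc t ht) h₀, self_mem_nhdsWithin,
    hX.eventually_differentiableWithinAt hc ht] with s hs hsJ hsd
  exact toCoord_covDeriv_of_differentiableWithinAt hsd (hc s hsJ) (hJ s hsJ) hs

theorem SmoothAlongAt.curvature (hX : SmoothAlongAt c J X t)
    (hc : ContMDiffOn 𝓘(ℝ, ℝ) 𝓘(ℝ, E) ∞ c J) (hJ : UniqueDiffOn ℝ J) (ht : t ∈ J) :
    SmoothAlongAt c J (fun s ↦ curvature (c s) (X s) (velocity c J s) (velocity c J s)) t := by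
  have h₀ := mem_chart_source E (c t)
  rw [smoothAlongAt_iff (hc t ht) h₀]
  have hx := (smoothAlongAt_iff (hc t ht) h₀).1 hX
  have hv := (smoothAlongAt_iff (hc t ht) h₀).1 (smoothAlongAt_velocity hc hJ ht)
  refine ((isMetricOn_chartMetric (c t)).contDiffWithinAt_coordCurvature
    (γ := fun s ↦ extChartAt 𝓘(ℝ, E) (c t) (c s)) (extChartAt_mem_target h₀)
    (contDiffWithinAt_extChartAt_comp (hc t ht) h₀) hx hv hv).congr_of_eventuallyEq ?_
    (toCoord_curvature h₀ _ _ _)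
  filter_upwards [eventually_mem_source (hc t ht) h₀] with s hs
  exact toCoord_curvature hs _ _ _

end AlongCurve

section Division

variable {E : Type*} [NormedAddCommGroup E] [NormedSpace ℝ E] {I : Set ℝ} {t : ℝ} {k : ℕ}

theorem norm_le_of_norm_deriv_le_pow {G G' : ℝ → E} (hI : Convex ℝ I) (ht : t ∈ I)
    (hG : ∀ s ∈ I, HasDerivWithinAt G (G' s) I s) (hGt : G t = 0) {ε : ℝ} (hε : 0 ≤ ε) (m : ℕ)
    {s : ℝ} (hs : s ∈ I) (hG' : ∀ r ∈ segment ℝ t s, ‖G' r‖ ≤ ε * |r - t| ^ m) :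
    ‖G s‖ ≤ ε * |s - t| ^ (m + 1) := by
  have hsub : segment ℝ t s ⊆ I := hI.segment_subset ht hs
  have hbound : ∀ r ∈ segment ℝ t s, ‖G' r‖ ≤ ε * |s - t| ^ m := fun r hr ↦ by
    refine (hG' r hr).trans ?_
    rw [segment_eq_uIcc] at hr
    have := abs_sub_left_of_mem_uIcc hr
    gcongr
  simpa [hGt, pow_succ, mul_assoc] using
    (convex_segment t s).norm_image_sub_le_of_norm_hasDerivWithin_le
      (fun r hr ↦ (hG r (hsub hr)).mono hsub) hbound (left_mem_segment ℝ t s)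
      (right_mem_segment ℝ t s)

/-- `h` is the weighted average `h s = ∫₀¹ uᵏ F (t + u (s - t)) du`, encoded without integrals by
the derivative of `(s - t) ^ (k + 1) • h s` and the value at `t`. -/
structure IsAverageOn (I : Set ℝ) (t : ℝ) (k : ℕ) (F h : ℝ → E) : Prop where
  hasDerivWithinAt_pow_smul : ∀ s ∈ I,
    HasDerivWithinAt (fun s ↦ (s - t) ^ (k + 1) • h s) ((s - t) ^ k • F s) I s
  smul_self : (k + 1 : ℝ) • h t = F t

namespace IsAverageOn

theorem sub {F₁ F₂ h₁ h₂ : ℝ → E} (h₁' : IsAverageOn I t k F₁ h₁)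
    (h₂' : IsAverageOn I t k F₂ h₂) :
    IsAverageOn I t k (fun s ↦ F₁ s - F₂ s) fun s ↦ h₁ s - h₂ s where
  hasDerivWithinAt_pow_smul s hs := by
    simpa only [smul_sub] using
      (h₁'.hasDerivWithinAt_pow_smul s hs).fun_sub (h₂'.hasDerivWithinAt_pow_smul s hs)
  smul_self := by rw [smul_sub, h₁'.smul_self, h₂'.smul_self]

theorem pow_smul (I : Set ℝ) (t : ℝ) (k j : ℕ) (v : E) :
    IsAverageOn I t k (fun s ↦ (k + j + 1 : ℝ) • (s - t) ^ j • v) fun s ↦ (s - t) ^ j • v where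
  hasDerivWithinAt_pow_smul s _ := by
    have h := ((((hasDerivWithinAt_id s I).sub_const t).pow (k + 1 + j)).smul_const v)
    simp only [pow_add, smul_smul] at h ⊢
    refine h.congr_deriv ?_
    congr 1
    have hexp : k + 1 + j - 1 = k + j := by omega
    simp only [hexp, pow_add, id]
    push_cast
    ring
  smul_self := by
    rcases j with _ | j <;> simp

variable {F h : ℝ → E}

theorem isLittleO (hh : IsAverageOn I t k F h) (hI : Convex ℝ I) (ht : t ∈ I) {m : ℕ}
    (hF : F =o[𝓝[I] t] fun s ↦ (s - t) ^ m) : h =o[𝓝[I \ {t}] t] fun s ↦ (s - t) ^ m := by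
  rw [Asymptotics.isLittleO_iff] at hF ⊢
  intro ε hε
  obtain ⟨δ, hδ, hFδ⟩ := Metric.mem_nhdsWithin_iff.1 (hF hε)
  refine Metric.mem_nhdsWithin_iff.2 ⟨δ, hδ, fun s ⟨hs, hsI, hst⟩ ↦ ?_⟩
  have hpow : ‖(s - t) ^ (k + 1) • h s‖ ≤ ε * |s - t| ^ (k + m + 1) := by
    refine norm_le_of_norm_deriv_le_pow hI ht hh.hasDerivWithinAt_pow_smul (by simp) hε.le (k + m)
      hsI fun r hr ↦ ?_
    have hFr : ‖F r‖ ≤ ε * ‖(r - t) ^ m‖ := hFδ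
      ⟨(convex_ball t δ).segment_subset (Metric.mem_ball_self hδ) hs hr,
        hI.segment_subset ht hsI hr⟩
    rw [norm_smul, norm_pow, Real.norm_eq_abs, pow_add, mul_left_comm]
    gcongr
    simpa using hFr
  have hpos : 0 < |s - t| ^ (k + 1) := pow_pos (abs_pos.2 (sub_ne_zero.2 hst)) _
  rw [norm_smul, norm_pow, Real.norm_eq_abs] at hpow
  rw [mem_ofPred_eq, norm_pow, Real.norm_eq_abs]
  exact le_of_mul_le_mul_left (hpow.trans_eq (by ring)) hpos

theorem hasDerivWithinAt_of_ne (hh : IsAverageOn I t k F h) {s : ℝ} (hs : s ∈ I) (hst : s ≠ t) :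
    HasDerivWithinAt h ((s - t)⁻¹ • (F s - (k + 1 : ℝ) • h s)) I s := by
  have hst' : s - t ≠ 0 := sub_ne_zero.2 hst
  have hcancel : ∀ r, r ≠ t → h r = ((r - t) ^ (k + 1))⁻¹ • (r - t) ^ (k + 1) • h r :=
    fun r hr ↦ (inv_smul_smul₀ (pow_ne_zero _ (sub_ne_zero.2 hr)) _).symm
  have hinv := (((hasDerivWithinAt_id s I).sub_const t).pow (k + 1)).inv (pow_ne_zero _ hst')
  have hprod := (hinv.smul (hh.hasDerivWithinAt_pow_smul s hs)).congr_of_eventuallyEq (f₁ := h)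
    (by
      filter_upwards [(eventually_ne_nhds hst).filter_mono nhdsWithin_le_nhds] with r hr
      exact hcancel r hr) (hcancel s hst)
  refine hprod.congr_deriv ?_
  rw [smul_sub, sub_eq_add_neg (_ • F s), ← smul_neg, ← neg_smul]
  simp only [Pi.inv_apply, Pi.pow_apply, id, Nat.add_sub_cancel, smul_smul]
  congr 2
  · field_simp
    ring
  · push_cast
    field_simp
    ring

theorem continuousWithinAt_self (hh : IsAverageOn I t k F h) (hI : Convex ℝ I) (ht : t ∈ I)
    (hF : ContinuousWithinAt F I t) : ContinuousWithinAt h I t := by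
  have hFo : (fun s ↦ F s - (k + (0 : ℕ) + 1 : ℝ) • (s - t) ^ 0 • h t) =o[𝓝[I] t]
      fun s ↦ (s - t) ^ 0 := by
    simpa [hh.smul_self, Asymptotics.isLittleO_one_iff, tendsto_sub_nhds_zero_iff] using hF.tendsto
  have hho := (hh.sub (pow_smul I t k 0 (h t))).isLittleO hI ht hFo
  rw [← continuousWithinAt_sdiff_self, ContinuousWithinAt]
  simpa [Asymptotics.isLittleO_one_iff, tendsto_sub_nhds_zero_iff] using hho

theorem hasDerivWithinAt_self (hh : IsAverageOn I t k F h) (hI : Convex ℝ I) (ht : t ∈ I)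
    {F' : E} (hF : HasDerivWithinAt F F' I t) :
    HasDerivWithinAt h ((k + 2 : ℝ)⁻¹ • F') I t := by
  have hk : (k + (1 : ℕ) + 1 : ℝ) = k + 2 := by push_cast; ring
  have hFo : (fun s ↦ F s - (k + (0 : ℕ) + 1 : ℝ) • (s - t) ^ 0 • h t
      - (k + (1 : ℕ) + 1 : ℝ) • (s - t) ^ 1 • (k + 2 : ℝ)⁻¹ • F') =o[𝓝[I] t]
      fun s ↦ (s - t) ^ 1 := by
    have hk₀ : (k + 2 : ℝ) ≠ 0 := by positivity
    simpa only [hh.smul_self, hk, Nat.cast_zero, add_zero, pow_zero, one_smul, pow_one,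
      smul_comm (k + 2 : ℝ) (_ : ℝ) (_ : E), inv_smul_smul₀ hk₀] using
      hasDerivWithinAt_iff_isLittleO.1 hF
  have hho := ((hh.sub (pow_smul I t k 0 (h t))).sub
    (pow_smul I t k 1 ((k + 2 : ℝ)⁻¹ • F'))).isLittleO hI ht hFo
  rw [← hasDerivWithinAt_sdiff_singleton, hasDerivWithinAt_iff_isLittleO]
  simpa using hho

theorem differentiableOn (hh : IsAverageOn I t k F h) (hI : Convex ℝ I) (ht : t ∈ I)
    (hF : DifferentiableOn ℝ F I) : DifferentiableOn ℝ h I := fun s hs ↦ by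
  rcases eq_or_ne s t with rfl | hst
  · exact (hh.hasDerivWithinAt_self hI ht (hF s hs).hasDerivWithinAt).differentiableWithinAt
  · exact (hh.hasDerivWithinAt_of_ne hs hst).differentiableWithinAt

theorem derivWithin (hh : IsAverageOn I t k F h) (hI : Convex ℝ I) (hu : UniqueDiffOn ℝ I)
    (ht : t ∈ I) (hF : DifferentiableOn ℝ F I) :
    IsAverageOn I t (k + 1) (derivWithin F I) (derivWithin h I) where
  hasDerivWithinAt_pow_smul s hs := by
    have heq : ∀ r ∈ I, (r - t) ^ (k + 1 + 1) • _root_.derivWithin h I r =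
        (r - t) ^ (k + 1) • F r - (k + 1 : ℝ) • (r - t) ^ (k + 1) • h r := fun r hr ↦ by
      rcases eq_or_ne r t with rfl | hrt
      · simp
      · rw [(hh.hasDerivWithinAt_of_ne hr hrt).derivWithin (hu r hr), pow_succ, mul_smul,
          smul_inv_smul₀ (sub_ne_zero.2 hrt), smul_sub, smul_comm (k + 1 : ℝ)]
    have hderiv := ((((hasDerivWithinAt_id s I).sub_const t).pow (k + 1)).smul
      (hF s hs).hasDerivWithinAt).sub
        ((hh.hasDerivWithinAt_pow_smul s hs).const_smul (k + 1 : ℝ))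
    refine (hderiv.congr heq (heq s hs)).congr_deriv ?_
    simp [smul_smul]
  smul_self := by
    have hk : (((k + 1 : ℕ) : ℝ) + 1) = k + 2 := by push_cast; ring
    rw [(hh.hasDerivWithinAt_self hI ht (hF t ht).hasDerivWithinAt).derivWithin (hu t ht), hk,
      smul_inv_smul₀ (by positivity)]

theorem contDiffOn (hI : Convex ℝ I) (hu : UniqueDiffOn ℝ I) (ht : t ∈ I) (n : ℕ) {k : ℕ}
    {F h : ℝ → E} (hh : IsAverageOn I t k F h) (hF : ContDiffOn ℝ n F I) :
    ContDiffOn ℝ n h I := by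
  induction n generalizing k F h with
  | zero =>
    rw [Nat.cast_zero, contDiffOn_zero] at hF ⊢
    intro s hs
    rcases eq_or_ne s t with rfl | hst
    · exact hh.continuousWithinAt_self hI ht (hF s hs)
    · exact (hh.hasDerivWithinAt_of_ne hs hst).continuousWithinAt
  | succ n ih =>
    rw [Nat.cast_add_one, contDiffOn_succ_iff_derivWithin hu] at hF ⊢
    exact ⟨hh.differentiableOn hI ht hF.1, by simp, ih (hh.derivWithin hI hu ht hF.1) hF.2.2⟩

end IsAverageOn

theorem isAverageOn_update_inv_smul {f : ℝ → E} (hf : DifferentiableOn ℝ f I) (hft : f t = 0) :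
    IsAverageOn I t 0 (derivWithin f I)
      (Function.update (fun s ↦ (s - t)⁻¹ • f s) t (derivWithin f I t)) where
  hasDerivWithinAt_pow_smul s hs := by
    have hprod : (fun s ↦ (s - t) ^ (0 + 1) • Function.update (fun s ↦ (s - t)⁻¹ • f s) t
        (derivWithin f I t) s) = f := by
      ext s
      rcases eq_or_ne s t with rfl | hst
      · simp [hft]
      · simp [Function.update_of_ne hst, smul_inv_smul₀ (sub_ne_zero.2 hst)]
    rw [hprod, pow_zero, one_smul]
    exact (hf s hs).hasDerivWithinAt
  smul_self := by simp

theorem uniqueDiffOn_of_ordConnected {J : Set ℝ} (hJ : J.OrdConnected) (hJ' : J.Nontrivial) :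
    UniqueDiffOn ℝ J :=
  uniqueDiffOn_convex hJ.convex (hJ.convex.nontrivial_iff_nonempty_interior.1 hJ')

theorem contDiffWithinAt_update_inv_smul {f : ℝ → E} {J : Set ℝ} (hJ : J.OrdConnected)
    (hJ' : J.Nontrivial) (ht : t ∈ J) (hf : ContDiffWithinAt ℝ ∞ f J t) (hft : f t = 0) :
    ContDiffWithinAt ℝ ∞
      (Function.update (fun s ↦ (s - t)⁻¹ • f s) t (derivWithin f J t)) J t := by
  rw [contDiffWithinAt_infty]
  intro n
  obtain ⟨u, huo, htu, hfu⟩ := (hf.of_le (m := ((n + 1 : ℕ) : WithTop ℕ∞))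
    (by exact_mod_cast le_top)).contDiffOn' le_rfl (by simp)
  rw [insert_eq_of_mem ht] at hfu
  obtain ⟨r, hr, hru⟩ := Metric.isOpen_iff.1 huo t htu
  have hconv : Convex ℝ (J ∩ Metric.ball t r) := hJ.convex.inter (convex_ball t r)
  have hu := (uniqueDiffOn_of_ordConnected hJ hJ').inter (Metric.isOpen_ball (x := t) (ε := r))
  have hfr := hfu.mono (inter_subset_inter_right J hru)
  rw [Nat.cast_add_one, contDiffOn_succ_iff_derivWithin hu] at hfr
  have htr : t ∈ J ∩ Metric.ball t r := ⟨ht, Metric.mem_ball_self hr⟩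
  have hquot := (isAverageOn_update_inv_smul hfr.1 hft).contDiffOn hconv hu htr n hfr.2.2
  rw [derivWithin_inter (Metric.ball_mem_nhds t hr)] at hquot
  exact (hquot t htr).mono_of_mem_nhdsWithin
    (inter_mem_nhdsWithin J (Metric.ball_mem_nhds t hr))

end Division

theorem eq_zero_of_hasDerivWithinAt_clm_apply {F : Type*} [NormedAddCommGroup F] [NormedSpace ℝ F]
    {I : Set ℝ} (hI : I.OrdConnected) {B : ℝ → F →L[ℝ] F} (hB : ContinuousOn B I) {z : ℝ → F}
    (hz : ∀ s ∈ I, HasDerivWithinAt z (B s (z s)) I s) {t s : ℝ} (ht : t ∈ I) (hs : s ∈ I)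
    (hzt : z t = 0) : z s = 0 := by
  have hsub : uIcc t s ⊆ I := hI.uIcc_subset ht hs
  obtain ⟨K, hK⟩ := isCompact_uIcc.exists_bound_of_continuousOn (hB.mono hsub)
  have hlip : ∀ r ∈ uIcc t s, LipschitzOnWith K.toNNReal (B r) univ := fun r hr ↦
    ((B r).lipschitzWith_of_opNorm_le
      ((hK r hr).trans (Real.le_coe_toNNReal K))).lipschitzOnWith
  have hzc : ContinuousOn z (uIcc t s) := fun r hr ↦ (hz r (hsub hr)).continuousWithinAt.mono hsub
  have hzero : ∀ (S : Set ℝ) (r : ℝ), HasDerivWithinAt (fun _ ↦ 0) (B r 0) S r := fun S r ↦ by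
    simpa using hasDerivWithinAt_const r S (0 : F)
  rcases le_total t s with hts | hst
  · rw [uIcc_of_le hts] at hsub hlip hzc
    exact ODE_solution_unique_of_mem_Icc_right (g := fun _ ↦ 0)
      (fun r hr ↦ hlip r (Ico_subset_Icc_self hr)) hzc
      (fun r hr ↦ ((hz r (hsub (Ico_subset_Icc_self hr))).mono hsub).mono_of_mem_nhdsWithin
        (Icc_mem_nhdsGE_of_mem hr))
      (fun _ _ ↦ mem_univ _) continuousOn_const (fun r _ ↦ hzero _ r) (fun _ _ ↦ mem_univ _) hzt
      (right_mem_Icc.2 hts)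
  · rw [uIcc_of_ge hst] at hsub hlip hzc
    exact ODE_solution_unique_of_mem_Icc_left (g := fun _ ↦ 0)
      (fun r hr ↦ hlip r (Ioc_subset_Icc_self hr)) hzc
      (fun r hr ↦ ((hz r (hsub (Ioc_subset_Icc_self hr))).mono hsub).mono_of_mem_nhdsWithin
        (Icc_mem_nhdsLE_of_mem hr))
      (fun _ _ ↦ mem_univ _) continuousOn_const (fun r _ ↦ hzero _ r) (fun _ _ ↦ mem_univ _) hzt
      (left_mem_Icc.2 hst)

section Uniqueness

variable {E : Type*} [NormedAddCommGroup E] [NormedSpace ℝ E] [FiniteDimensional ℝ E]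

/-- The coefficients of the Jacobi equation in coordinates, as a linear first-order system for the
field and its covariant derivative, along a curve passing through `y` with velocity `v`. -/
noncomputable def jacobiSystem (g : E → E →L[ℝ] E →L[ℝ] ℝ) (y v : E) : E × E →L[ℝ] E × E :=
  LinearMap.toContinuousLinearMap
    { toFun z := (z.2 - christoffel g y v z.1, -coordCurvature g y z.1 v v - christoffel g y v z.2)
      map_add' z z' := by
        simp only [Prod.fst_add, Prod.snd_add, map_add, coordCurvature_add_left, Prod.mk_add_mk]
        congr 1 <;> abel
      map_smul' a z := by
        simp only [Prod.smul_fst, Prod.smul_snd, map_smul, coordCurvature_smul_left,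
          RingHom.id_apply, Prod.smul_mk, smul_sub, smul_neg] }

theorem jacobiSystem_apply (g : E → E →L[ℝ] E →L[ℝ] ℝ) (y v a b : E) :
    jacobiSystem g y v (a, b) =
      (b - christoffel g y v a, -coordCurvature g y a v v - christoffel g y v b) := rfl

theorem IsMetricOn.continuousWithinAt_jacobiSystem {g : E → E →L[ℝ] E →L[ℝ] ℝ} {U : Set E}
    (hg : IsMetricOn g U) {γ v : ℝ → E} {J : Set ℝ} {t : ℝ} (ht : γ t ∈ U)
    (hγ : ContDiffWithinAt ℝ ∞ γ J t) (hv : ContDiffWithinAt ℝ ∞ v J t) :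
    ContinuousWithinAt (fun s ↦ jacobiSystem g (γ s) (v s)) J t := by
  refine continuousWithinAt_clm_apply.2 fun ⟨a, b⟩ ↦ ?_
  have hΓ : ContDiffWithinAt ℝ ∞ (fun s ↦ christoffel g (γ s) (v s)) J t :=
    ((hg.contDiffAt_christoffel ht).comp_contDiffWithinAt t hγ).clm_apply hv
  have hR := hg.contDiffWithinAt_coordCurvature ht hγ (contDiffWithinAt_const (c := a)) hv hv
  exact ((contDiffWithinAt_const.sub (hΓ.clm_apply contDiffWithinAt_const)).prodMk
    (hR.neg.sub (hΓ.clm_apply contDiffWithinAt_const))).continuousWithinAt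

variable {M : Type*} [TopologicalSpace M] [ChartedSpace E M] [IsManifold 𝓘(ℝ, E) ∞ M]
  [RiemannianBundle (fun x : M ↦ TangentSpace 𝓘(ℝ, E) x)]
  [IsContMDiffRiemannianBundle 𝓘(ℝ, E) ∞ E (fun x : M ↦ TangentSpace 𝓘(ℝ, E) x)]
  {x₀ : M} {c : ℝ → M} {J : Set ℝ} {t : ℝ} {X : ∀ t, TangentSpace 𝓘(ℝ, E) (c t)}

theorem continuousWithinAt_jacobiSystem_chartMetric (hc : ContMDiffOn 𝓘(ℝ, ℝ) 𝓘(ℝ, E) ∞ c J)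
    (hu : UniqueDiffOn ℝ J) (ht : t ∈ J) (h₀ : c t ∈ (chartAt E x₀).source) :
    ContinuousWithinAt (fun s ↦ jacobiSystem (chartMetric x₀) (extChartAt 𝓘(ℝ, E) x₀ (c s))
      (toCoord x₀ (c s) (velocity c J s))) J t :=
  (isMetricOn_chartMetric x₀).continuousWithinAt_jacobiSystem
    (γ := fun s ↦ extChartAt 𝓘(ℝ, E) x₀ (c s)) (extChartAt_mem_target h₀)
    (contDiffWithinAt_extChartAt_comp (hc t ht) h₀)
    ((smoothAlongAt_iff (hc t ht) h₀).1 (smoothAlongAt_velocity hc hu ht))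

theorem hasDerivWithinAt_toCoord_covDeriv (hX : SmoothAlongAt c J X t)
    (hc : ContMDiffWithinAt 𝓘(ℝ, ℝ) 𝓘(ℝ, E) ∞ c J t) (hJ : UniqueDiffWithinAt ℝ J t)
    (h₀ : c t ∈ (chartAt E x₀).source) :
    HasDerivWithinAt (fun s ↦ toCoord x₀ (c s) (X s))
      (toCoord x₀ (c t) (covDeriv c J X t)
        - christoffel (chartMetric x₀) (extChartAt 𝓘(ℝ, E) x₀ (c t))
          (toCoord x₀ (c t) (velocity c J t)) (toCoord x₀ (c t) (X t))) J t :=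
  (hX.differentiableWithinAt hc h₀).hasDerivWithinAt.congr_deriv
    (eq_sub_of_add_eq (toCoord_covDeriv hX hc hJ h₀).symm)

theorem IsJacobiFieldOn.hasDerivWithinAt_toCoord (hX : IsJacobiFieldOn c J X)
    (hc : ContMDiffOn 𝓘(ℝ, ℝ) 𝓘(ℝ, E) ∞ c J) (hu : UniqueDiffOn ℝ J) (ht : t ∈ J)
    (h₀ : c t ∈ (chartAt E x₀).source) :
    HasDerivWithinAt
      (fun s ↦ (toCoord x₀ (c s) (X s), toCoord x₀ (c s) (covDeriv c J X s)))
      (jacobiSystem (chartMetric x₀) (extChartAt 𝓘(ℝ, E) x₀ (c t))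
        (toCoord x₀ (c t) (velocity c J t))
        (toCoord x₀ (c t) (X t), toCoord x₀ (c t) (covDeriv c J X t))) J t := by
  have hXt : SmoothAlongAt c J X t := hX.1 t ht
  rw [jacobiSystem_apply, ← toCoord_curvature h₀, ← map_neg,
    ← eq_neg_of_add_eq_zero_left (hX.2 t ht)]
  exact (hasDerivWithinAt_toCoord_covDeriv hXt (hc t ht) (hu t ht) h₀).prodMk
    (hasDerivWithinAt_toCoord_covDeriv (hXt.covDeriv hc hu ht) (hc t ht) (hu t ht) h₀)

theorem IsJacobiFieldOn.eventually_eq_zero_iff (hX : IsJacobiFieldOn c J X) (hJ : J.OrdConnected)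
    (hu : UniqueDiffOn ℝ J) (hc : ContMDiffOn 𝓘(ℝ, ℝ) 𝓘(ℝ, E) ∞ c J) (ht : t ∈ J) :
    ∀ᶠ s in 𝓝[J] t, ((X t = 0 ∧ covDeriv c J X t = 0) ↔ (X s = 0 ∧ covDeriv c J X s = 0)) := by
  obtain ⟨r, hr, hsource⟩ := Metric.mem_nhdsWithin_iff.1
    (eventually_mem_source (hc t ht) (mem_chart_source E (c t)))
  let I := J ∩ Metric.ball t r
  have hI : I.OrdConnected := (hJ.convex.inter (convex_ball t r)).ordConnected
  have hIJ : I ⊆ J := inter_subset_left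
  have hIs : ∀ s ∈ I, c s ∈ (chartAt E (c t)).source := fun s hs ↦ hsource ⟨hs.2, hs.1⟩
  have htI : t ∈ I := ⟨ht, Metric.mem_ball_self hr⟩
  have hB : ContinuousOn (fun s ↦ jacobiSystem (chartMetric (c t)) (extChartAt 𝓘(ℝ, E) (c t) (c s))
      (toCoord (c t) (c s) (velocity c J s))) I := fun s hs ↦
    (continuousWithinAt_jacobiSystem_chartMetric hc hu hs.1 (hIs s hs)).mono hIJ
  have hzero : ∀ s ∈ I, (X s = 0 ∧ covDeriv c J X s = 0) ↔
      (toCoord (c t) (c s) (X s), toCoord (c t) (c s) (covDeriv c J X s)) = 0 := fun s hs ↦ by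
    have hinj := toCoord_injective (E := E) (hIs s hs)
    rw [Prod.mk_eq_zero, map_eq_zero_iff _ hinj, map_eq_zero_iff _ hinj]
  have hODE := fun s hs ↦ (hX.hasDerivWithinAt_toCoord hc hu (hIJ hs) (hIs s hs)).mono hIJ
  filter_upwards [inter_mem_nhdsWithin J (Metric.ball_mem_nhds t hr)] with s hs
  rw [hzero t htI, hzero s hs]
  exact ⟨eq_zero_of_hasDerivWithinAt_clm_apply hI hB hODE htI hs,
    eq_zero_of_hasDerivWithinAt_clm_apply hI hB hODE hs htI⟩

theorem IsJacobiFieldOn.eq_zero (hX : IsJacobiFieldOn c J X) (hJ : J.OrdConnected)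
    (hu : UniqueDiffOn ℝ J) (hc : ContMDiffOn 𝓘(ℝ, ℝ) 𝓘(ℝ, E) ∞ c J) (ht : t ∈ J)
    (hXt : X t = 0) (hX't : covDeriv c J X t = 0) {s : ℝ} (hs : s ∈ J) : X s = 0 :=
  ((hJ.isPreconnected.induction₂ (fun r r' ↦
    ((X r = 0 ∧ covDeriv c J X r = 0) ↔ (X r' = 0 ∧ covDeriv c J X r' = 0)))
    (fun _ hr ↦ hX.eventually_eq_zero_iff hJ hu hc hr) (fun _ _ _ _ _ _ h h' ↦ h.trans h')
    (fun _ _ _ _ h ↦ h.symm) ht hs).1 ⟨hXt, hX't⟩).1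

end Uniqueness

section KyFan

theorem sum_le_sum_mul_of_monotone {n p : ℕ} (hp : 1 ≤ p) (hpn : p ≤ n) {μ a : Fin n → ℝ}
    (hμ : Monotone μ) (ha : ∀ k, 0 ≤ a k) (ha' : ∀ k, a k ≤ 1) (hs : ∑ k, a k = p) :
    ∑ k with k.val < p, μ k ≤ ∑ k, μ k * a k := by
  -- The threshold `m` is the `p`-th value of `μ`; `(μ k - m) * a k` is minimal for `a` equal to
  -- the indicator function of the first `p` indices.
  let m := μ ⟨p - 1, by omega⟩
  have hshift : ∑ k with k.val < p, (μ k - m) ≤ ∑ k, (μ k - m) * a k := by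
    rw [Finset.sum_filter]
    refine Finset.sum_le_sum fun k _ ↦ ?_
    split_ifs with hk
    · have hkm : μ k ≤ m := hμ (Fin.mk_le_mk.2 (by omega))
      nlinarith [ha' k]
    · have hmk : m ≤ μ k := hμ (Fin.mk_le_mk.2 (by omega))
      exact mul_nonneg (sub_nonneg.2 hmk) (ha k)
  have hcard : ∑ k : Fin n with k.val < p, m = p * m := by
    rw [Finset.sum_const, Fin.card_filter_val_lt, min_eq_right hpn, nsmul_eq_mul]
  simp only [sub_mul, Finset.sum_sub_distrib, ← Finset.mul_sum, hs, hcard] at hshift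
  linarith

variable {V : Type*} [NormedAddCommGroup V] [InnerProductSpace ℝ V] {T : V →ₗ[ℝ] V}

theorem inner_apply_self_eq_sum {ι : Type*} [Fintype ι] (hT : T.IsSymmetric)
    (b : OrthonormalBasis ι ℝ V) {μ : ι → ℝ} (hb : ∀ k, T (b k) = μ k • b k) (x : V) :
    ⟪T x, x⟫_ℝ = ∑ k, μ k * ⟪b k, x⟫_ℝ ^ 2 := by
  rw [← b.sum_inner_mul_inner]
  refine Finset.sum_congr rfl fun k _ ↦ ?_
  rw [hT x (b k), hb, inner_smul_right, real_inner_comm]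
  ring

variable [FiniteDimensional ℝ V]

theorem sort_roots_charpoly {n : ℕ} (hT : T.IsSymmetric) (hn : Module.finrank ℝ V = n) :
    T.charpoly.roots.sort (· ≤ ·) = List.ofFn (hT.eigenvalues hn ∘ Fin.rev) := by
  have hroots : T.charpoly.roots = (List.ofFn (hT.eigenvalues hn ∘ Fin.rev) : Multiset ℝ) := by
    rw [hT.roots_charpoly_eq_eigenvalues hn, ← Fin.univ_val_map]
    conv_lhs => rw [← Finset.map_univ_equiv (Fin.revPerm (n := n)), Finset.map_val]
    exact Multiset.map_map _ _ _
  have hmono : Monotone (hT.eigenvalues hn ∘ Fin.rev) :=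
    (hT.eigenvalues_antitone hn).comp Fin.rev_anti
  rw [hroots, Multiset.coe_sort]
  refine List.mergeSort_of_pairwise ?_
  simpa only [decide_eq_true_eq] using hmono.sortedLE_ofFn.pairwise

/-- Ky Fan's inequality. -/
theorem sumSmallestEigenvalues_le {p : ℕ} (hT : T.IsSymmetric) {f : Fin p → V}
    (hf : Orthonormal ℝ f) : sumSmallestEigenvalues p T ≤ ∑ i, ⟪T (f i), f i⟫_ℝ := by
  rcases Nat.eq_zero_or_pos p with rfl | hp
  · simp [sumSmallestEigenvalues]
  have hpn : p ≤ Module.finrank ℝ V := by simpa using hf.linearIndependent.fintype_card_le_finrank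
  let b := (hT.eigenvectorBasis rfl).reindex Fin.revPerm
  have hb : ∀ k, T (b k) = (hT.eigenvalues rfl ∘ Fin.rev) k • b k := fun k ↦ by
    simp [b, hT.apply_eigenvectorBasis]
  rw [sumSmallestEigenvalues, sort_roots_charpoly hT rfl, List.sum_take_ofFn]
  simp only [inner_apply_self_eq_sum hT b hb]
  rw [Finset.sum_comm]
  simp only [← Finset.mul_sum]
  refine sum_le_sum_mul_of_monotone hp hpn ((hT.eigenvalues_antitone rfl).comp Fin.rev_anti)
    (fun k ↦ Finset.sum_nonneg fun i _ ↦ sq_nonneg _) (fun k ↦ ?_) ?_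
  · simpa [real_inner_comm] using hf.sum_inner_products_le (s := Finset.univ) (b k)
  · have hunit : ∀ i, ∑ k, ⟪b k, f i⟫_ℝ ^ 2 = 1 := fun i ↦ by
      simpa [hf.1 i] using b.sum_sq_norm_inner_right (f i)
    rw [Finset.sum_comm]
    simp [hunit]

end KyFan

section Determinant

variable {n : Type*} [Fintype n] [DecidableEq n]

theorem contDiff_det : ContDiff ℝ ∞ (fun M : n → n → ℝ ↦ (Matrix.of M).det) := by
  simp only [Matrix.det_apply, Matrix.of_apply]
  refine ContDiff.sum fun σ _ ↦ ContDiff.const_smul _ (contDiff_prod fun i _ ↦ ?_)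
  exact contDiff_apply_apply ℝ ℝ (σ i) i

section Smoothness

variable {F : Type*} [NormedAddCommGroup F] [NormedSpace ℝ F] {M : F → Matrix n n ℝ} {s : Set F}
  {t : F}

theorem contDiffWithinAt_det (hM : ∀ i j, ContDiffWithinAt ℝ ∞ (fun r ↦ M r i j) s t) :
    ContDiffWithinAt ℝ ∞ (fun r ↦ (M r).det) s t :=
  contDiff_det.contDiffAt.comp_contDiffWithinAt t (f := fun r i j ↦ M r i j)
    (contDiffWithinAt_pi.2 fun i ↦ contDiffWithinAt_pi.2 fun j ↦ hM i j)

theorem contDiffWithinAt_inv_apply (hM : ∀ i j, ContDiffWithinAt ℝ ∞ (fun r ↦ M r i j) s t)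
    (hdet : (M t).det ≠ 0) (i j : n) :
    ContDiffWithinAt ℝ ∞ (fun r ↦ (M r)⁻¹ i j) s t := by
  have hinv : ∀ r, (M r)⁻¹ i j = (M r).det⁻¹ * ((M r).updateRow j (Pi.single i 1)).det :=
    fun r ↦ by
      rw [Matrix.inv_def, Ring.inverse_eq_inv', Matrix.smul_apply, Matrix.adjugate_apply,
        smul_eq_mul]
  simp only [hinv]
  refine ((contDiffWithinAt_det hM).inv hdet).mul (contDiffWithinAt_det fun k l ↦ ?_)
  by_cases hk : k = j
  · simpa only [hk, Matrix.updateRow_self] using contDiffWithinAt_const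
  · simpa only [Matrix.updateRow_ne hk] using hM k l

end Smoothness

theorem hasDerivAt_det_one_add_smul (K : Matrix n n ℝ) :
    HasDerivAt (fun r : ℝ ↦ (1 + r • K).det) K.trace 0 := by
  let q := (Matrix.det (1 + (Polynomial.X : Polynomial ℝ) • K.map Polynomial.C)).divX.divX
  have hlin := ((hasDerivAt_id (0 : ℝ)).const_mul K.trace).const_add 1
  have hquad := (q.hasDerivAt (0 : ℝ)).mul ((hasDerivAt_id (0 : ℝ)).pow 2)
  exact ((hlin.add hquad).congr_deriv (by simp)).congr_of_eventuallyEq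
    (.of_forall fun r ↦ Matrix.det_one_add_smul r K)

theorem hasDerivAt_det_add_smul {N K : Matrix n n ℝ} (hN : N.det ≠ 0) :
    HasDerivAt (fun r : ℝ ↦ (N + r • K).det) (N.det * (N⁻¹ * K).trace) 0 := by
  refine ((hasDerivAt_det_one_add_smul (N⁻¹ * K)).const_mul N.det).congr_of_eventuallyEq
    (.of_forall fun r ↦ ?_)
  simp only [← Matrix.det_mul, mul_add, mul_one, Matrix.mul_smul,
    Matrix.mul_nonsing_inv_cancel_left _ _ hN.isUnit]

variable {M N : ℝ → Matrix n n ℝ} {M' N' : Matrix n n ℝ} {s : Set ℝ} {t : ℝ}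

/-- Jacobi's formula. -/
theorem hasDerivWithinAt_det (hM : ∀ i j, HasDerivWithinAt (fun r ↦ M r i j) (M' i j) s t)
    (hdet : (M t).det ≠ 0) :
    HasDerivWithinAt (fun r ↦ (M r).det) ((M t).det * ((M t)⁻¹ * M').trace) s t := by
  have hfd := (contDiff_det.differentiable (by simp) (fun i j ↦ M t i j)).hasFDerivAt
  have hcurve := hfd.comp_hasDerivWithinAt t (f := fun r i j ↦ M r i j) (f' := fun i j ↦ M' i j)
    (hasDerivWithinAt_pi.2 fun i ↦ hasDerivWithinAt_pi.2 fun j ↦ hM i j)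
  have hline : HasDerivAt (fun (r : ℝ) i j ↦ M t i j + r * M' i j) (fun i j ↦ M' i j) 0 := by
    refine hasDerivAt_pi.2 fun i ↦ hasDerivAt_pi.2 fun j ↦ ?_
    simpa using ((hasDerivAt_id (0 : ℝ)).mul_const (M' i j)).const_add (M t i j)
  have hdir := HasFDerivAt.comp_hasDerivAt (0 : ℝ) (by simpa using hfd) hline
  exact hcurve.congr_deriv (hdir.unique (hasDerivAt_det_add_smul hdet))

theorem derivWithin_inv_apply (hM : ∀ i j, HasDerivWithinAt (fun r ↦ M r i j) (M' i j) s t)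
    (hMi : ∀ i j, DifferentiableWithinAt ℝ (fun r ↦ (M r)⁻¹ i j) s t)
    (hs : UniqueDiffWithinAt ℝ s t) (hdet : ∀ᶠ r in 𝓝[s] t, (M r).det ≠ 0)
    (hdet' : (M t).det ≠ 0) (i j : n) :
    derivWithin (fun r ↦ (M r)⁻¹ i j) s t = (-((M t)⁻¹ * M' * (M t)⁻¹)) i j := by
  let K' : Matrix n n ℝ := Matrix.of fun i j ↦ derivWithin (fun r ↦ (M r)⁻¹ i j) s t
  have hprod : M' * (M t)⁻¹ + M t * K' = 0 := by
    ext i j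
    have hmul : HasDerivWithinAt (fun r ↦ (M r * (M r)⁻¹) i j) ((M' * (M t)⁻¹ + M t * K') i j)
        s t := by
      simp only [Matrix.mul_apply, Matrix.add_apply, ← Finset.sum_add_distrib]
      exact HasDerivWithinAt.fun_sum fun k _ ↦ (hM i k).mul (hMi k j).hasDerivWithinAt
    have hone : HasDerivWithinAt (fun r ↦ (M r * (M r)⁻¹) i j) 0 s t := by
      refine (hasDerivWithinAt_const t s ((1 : Matrix n n ℝ) i j)).congr_of_eventuallyEq ?_ ?_
      · filter_upwards [hdet] with r hr
        rw [Matrix.mul_nonsing_inv _ hr.isUnit]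
      · rw [Matrix.mul_nonsing_inv _ hdet'.isUnit]
    exact hs.eq_deriv _ hmul hone
  have hcancel := congrArg (fun X ↦ (M t)⁻¹ * X) hprod
  simp only [mul_add, mul_zero, ← mul_assoc, Matrix.nonsing_inv_mul _ hdet'.isUnit, one_mul]
    at hcancel
  exact congrFun₂ (eq_neg_of_add_eq_zero_right hcancel) i j

theorem hasDerivWithinAt_trace_inv_mul
    (hM : ∀ i j, HasDerivWithinAt (fun r ↦ M r i j) (M' i j) s t)
    (hMi : ∀ i j, DifferentiableWithinAt ℝ (fun r ↦ (M r)⁻¹ i j) s t)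
    (hN : ∀ i j, HasDerivWithinAt (fun r ↦ N r i j) (N' i j) s t) (hs : UniqueDiffWithinAt ℝ s t)
    (hdet : ∀ᶠ r in 𝓝[s] t, (M r).det ≠ 0) (hdet' : (M t).det ≠ 0) :
    HasDerivWithinAt (fun r ↦ ((M r)⁻¹ * N r).trace)
      (((M t)⁻¹ * N').trace - ((M t)⁻¹ * M' * (M t)⁻¹ * N t).trace) s t := by
  have hinv : ∀ i j, HasDerivWithinAt (fun r ↦ (M r)⁻¹ i j) ((-((M t)⁻¹ * M' * (M t)⁻¹)) i j)
      s t := fun i j ↦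
    (hMi i j).hasDerivWithinAt.congr_deriv (derivWithin_inv_apply hM hMi hs hdet hdet' i j)
  have hderiv : HasDerivWithinAt (fun r ↦ ((M r)⁻¹ * N r).trace)
      (-((M t)⁻¹ * M' * (M t)⁻¹) * N t + (M t)⁻¹ * N').trace s t := by
    simp only [Matrix.trace, Matrix.diag, Matrix.mul_apply (M := (M _)⁻¹),
      Matrix.mul_apply (M := -_), Matrix.add_apply, ← Finset.sum_add_distrib]
    exact HasDerivWithinAt.fun_sum fun i _ ↦ HasDerivWithinAt.fun_sum fun k _ ↦
      (hinv i k).mul (hN k i)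
  refine hderiv.congr_deriv ?_
  rw [Matrix.trace_add, neg_mul, Matrix.trace_neg]
  ring

theorem trace_le_card_mul_det {P : Matrix n n ℝ} (hP : P.IsHermitian) {δ : ℝ} (hδ : 0 < δ)
    (h : ∀ x : n → ℝ, δ * (x ⬝ᵥ x) ≤ x ⬝ᵥ P.mulVec x) :
    δ ^ (Fintype.card n - 1) * P.trace ≤ Fintype.card n * P.det := by
  have hev : ∀ i, δ ≤ hP.eigenvalues i := by
    intro i
    have hunit : (hP.eigenvectorBasis i : n → ℝ) ⬝ᵥ (hP.eigenvectorBasis i) = 1 := by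
      have hnorm := real_inner_self_eq_norm_sq (hP.eigenvectorBasis i)
      rwa [hP.eigenvectorBasis.orthonormal.1 i, EuclideanSpace.inner_eq_star_dotProduct,
        star_trivial, one_pow] at hnorm
    simpa [hP.mulVec_eigenvectorBasis, hunit] using h (hP.eigenvectorBasis i)
  have htr : P.trace = ∑ i, hP.eigenvalues i := by simpa using hP.trace_eq_sum_eigenvalues
  have hdet : P.det = ∏ i, hP.eigenvalues i := by simpa using hP.det_eq_prod_eigenvalues
  rw [htr, hdet, Finset.mul_sum, ← nsmul_eq_mul, ← Finset.card_univ, ← Finset.sum_const]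
  refine Finset.sum_le_sum fun i _ ↦ ?_
  rw [← Finset.mul_prod_erase _ _ (Finset.mem_univ i), mul_comm,
    ← Finset.card_erase_of_mem (Finset.mem_univ i), ← Finset.prod_const]
  exact mul_le_mul_of_nonneg_left (Finset.prod_le_prod (fun _ _ ↦ hδ.le) fun j _ ↦ hev j)
    (hδ.le.trans (hev i))

end Determinant

section TraceInequality

variable {V : Type*} [NormedAddCommGroup V] [InnerProductSpace ℝ V] {p : ℕ}

theorem transpose_mul_mul_apply_eq_inner (C : Matrix (Fin p) (Fin p) ℝ) {a b : Fin p → V}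
    {X : Matrix (Fin p) (Fin p) ℝ} (hX : ∀ i j, X i j = ⟪a i, b j⟫_ℝ) (i j : Fin p) :
    (C.transpose * X * C) i j = ⟪∑ k, C k i • a k, ∑ k, C k j • b k⟫_ℝ := by
  simp only [sum_inner, inner_sum, real_inner_smul_left, real_inner_smul_right,
    Matrix.mul_apply, Matrix.transpose_apply, Finset.sum_mul, hX]
  refine Finset.sum_congr rfl fun k _ ↦ Finset.sum_congr rfl fun l _ ↦ ?_
  ring

theorem exists_orthonormal_combination {z : Fin p → V} (hz : LinearIndependent ℝ z) :
    ∃ C : Matrix (Fin p) (Fin p) ℝ, IsUnit C.det ∧ (Matrix.gram ℝ z)⁻¹ = C * C.transpose ∧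
      Orthonormal ℝ fun i ↦ ∑ k, C k i • z k := by
  let U := Submodule.span ℝ (range z)
  have : FiniteDimensional ℝ U := FiniteDimensional.span_of_finite ℝ (finite_range z)
  have hfin : Module.finrank ℝ U = p := by simpa using finrank_span_eq_card hz
  let b : OrthonormalBasis (Fin p) ℝ U := (stdOrthonormalBasis ℝ U).reindex (finCongr hfin)
  let z' : Fin p → U := fun i ↦ ⟨z i, Submodule.subset_span (mem_range_self i)⟩
  let B := Matrix.of fun i j ↦ b.repr (z' j) i
  have hB : Matrix.gram ℝ z = B.transpose * B :=
    (Matrix.gram_eq_conjTranspose_mul b z').trans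
      (by rw [Matrix.conjTranspose_eq_transpose_of_trivial])
  have hBu : IsUnit B.det := by
    have hdet := Matrix.det_gram_ne_zero_iff_linearIndependent.2 hz
    rw [hB, Matrix.det_mul] at hdet
    exact (right_ne_zero_of_mul hdet).isUnit
  refine ⟨B⁻¹, B.isUnit_nonsing_inv_det hBu, ?_, ?_⟩
  · rw [hB, Matrix.mul_inv_rev, Matrix.transpose_nonsing_inv]
  · have hone : (B⁻¹).transpose * Matrix.gram ℝ z * B⁻¹ = 1 := by
      rw [hB, ← mul_assoc, ← Matrix.transpose_mul, Matrix.mul_nonsing_inv _ hBu,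
        Matrix.transpose_one, one_mul, Matrix.mul_nonsing_inv _ hBu]
    rw [← Matrix.gram_eq_one_iff_orthonormal, ← hone]
    ext i j
    exact (transpose_mul_mul_apply_eq_inner B⁻¹ (fun _ _ ↦ rfl) i j).symm

theorem eq_zero_of_forall_sum_smul_eq_zero {E : Type*} [AddCommGroup E] [Module ℝ E]
    {C : Matrix (Fin p) (Fin p) ℝ} (hC : IsUnit C.det) {y : Fin p → E}
    (h : ∀ i, ∑ k, C k i • y k = 0) (j : Fin p) : y j = 0 := by
  calc y j = ∑ k, (1 : Matrix (Fin p) (Fin p) ℝ) k j • y k := by simp [Matrix.one_apply]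
    _ = ∑ k, ∑ i, (C k i * C⁻¹ i j) • y k := by
        simp only [← Matrix.mul_nonsing_inv _ hC, Matrix.mul_apply, Finset.sum_smul]
    _ = ∑ i, C⁻¹ i j • ∑ k, C k i • y k := by
        rw [Finset.sum_comm]
        simp only [Finset.smul_sum, smul_smul, mul_comm]
    _ = 0 := by simp only [h, smul_zero, Finset.sum_const_zero]

section Orthonormal

variable {f w : Fin p → V}

theorem sum_sum_sq_inner_le (hf : Orthonormal ℝ f) :
    ∑ i, ∑ j, ⟪w i, f j⟫_ℝ ^ 2 ≤ ∑ i, ‖w i‖ ^ 2 :=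
  Finset.sum_le_sum fun i _ ↦ by
    simpa [real_inner_comm] using hf.sum_inner_products_le (s := Finset.univ) (w i)

theorem sq_sum_inner_div_le (f w : Fin p → V) :
    (∑ i, ⟪w i, f i⟫_ℝ) ^ 2 / p ≤ ∑ i, ∑ j, ⟪w i, f j⟫_ℝ ^ 2 := by
  have hcs := sq_sum_le_card_mul_sum_sq (s := Finset.univ) (f := fun i ↦ ⟪w i, f i⟫_ℝ)
  rw [Finset.card_univ, Fintype.card_fin] at hcs
  refine (div_le_of_le_mul₀ p.cast_nonneg (Finset.sum_nonneg fun i _ ↦ sq_nonneg _)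
    (hcs.trans_eq (mul_comm _ _))).trans (Finset.sum_le_sum fun i _ ↦ ?_)
  exact Finset.single_le_sum (f := fun j ↦ ⟪w i, f j⟫_ℝ ^ 2) (fun j _ ↦ sq_nonneg _)
    (Finset.mem_univ i)

theorem orthonormal_trace_inequality (hf : Orthonormal ℝ f) {κ ρ : ℝ} (hκ : κ ≤ ρ) :
    2 * ∑ i, ∑ j, ⟪w i, f j⟫_ℝ ^ 2 - (3 * ∑ i, ‖w i‖ ^ 2 + ρ)
        + (∑ i, ⟪w i, f i⟫_ℝ) ^ 2 / p ≤ -κ := by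
  linarith [sum_sum_sq_inner_le (w := w) hf, sq_sum_inner_div_le f w]

theorem eq_zero_of_nonneg_orthonormal_trace (hf : Orthonormal ℝ f) {ρ : ℝ} (hρ : 0 ≤ ρ)
    (h : 0 ≤ 2 * ∑ i, ∑ j, ⟪w i, f j⟫_ℝ ^ 2 - (3 * ∑ i, ‖w i‖ ^ 2 + ρ)) (i : Fin p) :
    w i = 0 := by
  have hle : ∑ i, ‖w i‖ ^ 2 ≤ 0 := by linarith [sum_sum_sq_inner_le (w := w) hf]
  have hsum := hle.antisymm (Finset.sum_nonneg fun i _ ↦ sq_nonneg ‖w i‖)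
  simpa using (Finset.sum_eq_zero_iff_of_nonneg fun i _ ↦ sq_nonneg _).1 hsum i (Finset.mem_univ i)

end Orthonormal

section Combination

variable {z : Fin p → V} {C N : Matrix (Fin p) (Fin p) ℝ}

theorem trace_mul_transpose_mul (C X : Matrix (Fin p) (Fin p) ℝ) :
    (C * C.transpose * X).trace = (C.transpose * X * C).trace := by
  rw [mul_assoc, Matrix.trace_mul_comm]

theorem trace_inv_gram_mul (hC : (Matrix.gram ℝ z)⁻¹ = C * C.transpose) {a b : Fin p → V}
    (hN : ∀ i j, N i j = ⟪a i, b j⟫_ℝ) :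
    ((Matrix.gram ℝ z)⁻¹ * N).trace = ∑ i, ⟪∑ k, C k i • a k, ∑ k, C k i • b k⟫_ℝ := by
  rw [hC, trace_mul_transpose_mul]
  exact Finset.sum_congr rfl fun i _ ↦ transpose_mul_mul_apply_eq_inner C hN i i

theorem trace_sq_inv_gram_mul (hC : (Matrix.gram ℝ z)⁻¹ = C * C.transpose) {a b : Fin p → V}
    (hN : ∀ i j, N i j = ⟪a i, b j⟫_ℝ) (hsym : N.transpose = N) :
    ((Matrix.gram ℝ z)⁻¹ * N * (Matrix.gram ℝ z)⁻¹ * N).trace =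
      ∑ i, ∑ j, ⟪∑ k, C k i • a k, ∑ k, C k j • b k⟫_ℝ ^ 2 := by
  have hsq : C.transpose * (N * (C * C.transpose) * N) * C =
      (C.transpose * N * C) * (C.transpose * N * C) := by
    simp only [mul_assoc]
  have hsymC : (C.transpose * N * C).transpose = C.transpose * N * C := by
    rw [Matrix.transpose_mul, Matrix.transpose_mul, hsym, Matrix.transpose_transpose, mul_assoc]
  rw [hC, mul_assoc _ N, mul_assoc _ (N * _), trace_mul_transpose_mul, hsq]
  refine Finset.sum_congr rfl fun i _ ↦ (Matrix.mul_apply).trans (Finset.sum_congr rfl fun j _ ↦ ?_)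
  rw [← transpose_mul_mul_apply_eq_inner C hN, sq]
  exact congrArg _ (congrFun₂ hsymC.symm j i)

end Combination

/-- If `z` is a basis of virtual Jacobi fields and `y` consists of their covariant derivatives, then
the left hand side is `p g'' / g` for the function `g = (det (gram z)) ^ (-1 / 2p)`. -/
theorem trace_inequality {z y : Fin p → V} (hz : LinearIndependent ℝ z)
    (hsym : ∀ i j, ⟪y i, z j⟫_ℝ = ⟪z i, y j⟫_ℝ) (R : V →ₗ[ℝ] V) {κ : ℝ}
    (hκ : ∀ f : Fin p → V, Orthonormal ℝ f → κ ≤ ∑ i, ⟪R (f i), f i⟫_ℝ)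
    {N Q : Matrix (Fin p) (Fin p) ℝ} (hN : ∀ i j, N i j = ⟪y i, z j⟫_ℝ)
    (hQ : ∀ i j, Q i j = 3 * ⟪y i, y j⟫_ℝ + ⟪R (z i), z j⟫_ℝ) :
    2 * ((Matrix.gram ℝ z)⁻¹ * N * (Matrix.gram ℝ z)⁻¹ * N).trace
        - ((Matrix.gram ℝ z)⁻¹ * Q).trace + ((Matrix.gram ℝ z)⁻¹ * N).trace ^ 2 / p ≤ -κ ∧
      (0 ≤ κ → 0 ≤ 2 * ((Matrix.gram ℝ z)⁻¹ * N * (Matrix.gram ℝ z)⁻¹ * N).trace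
          - ((Matrix.gram ℝ z)⁻¹ * Q).trace → ∀ i, y i = 0) := by
  obtain ⟨C, hCu, hC, hf⟩ := exists_orthonormal_combination hz
  let f : Fin p → V := fun i ↦ ∑ k, C k i • z k
  let w : Fin p → V := fun i ↦ ∑ k, C k i • y k
  have hNsymm : N.transpose = N := by
    ext i j
    rw [Matrix.transpose_apply, hN, hN, hsym j i, real_inner_comm]
  have hQsplit : Q = (3 : ℝ) • Matrix.of (fun i j ↦ ⟪y i, y j⟫_ℝ)
      + Matrix.of (fun i j ↦ ⟪R (z i), z j⟫_ℝ) := by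
    ext i j
    simp [hQ]
  have hRf : ∀ i, ∑ k, C k i • R (z k) = R (f i) := fun i ↦ by simp only [f, map_sum, map_smul]
  have htrQ : ((Matrix.gram ℝ z)⁻¹ * Q).trace = 3 * ∑ i, ‖w i‖ ^ 2 + ∑ i, ⟪R (f i), f i⟫_ℝ := by
    have hyy := trace_inv_gram_mul hC (N := .of fun i j ↦ ⟪y i, y j⟫_ℝ) (a := y) (b := y)
      fun _ _ ↦ rfl
    have hRz := trace_inv_gram_mul hC (N := .of fun i j ↦ ⟪R (z i), z j⟫_ℝ)
      (a := fun i ↦ R (z i)) (b := z) fun _ _ ↦ rfl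
    rw [hQsplit, mul_add, Matrix.mul_smul, Matrix.trace_add, Matrix.trace_smul, smul_eq_mul, hyy,
      hRz]
    simp only [hRf, real_inner_self_eq_norm_sq, w, f]
  rw [trace_inv_gram_mul hC hN, trace_sq_inv_gram_mul hC hN hNsymm, htrQ]
  exact ⟨orthonormal_trace_inequality hf (hκ f hf), fun hκ₀ hge ↦
    eq_zero_of_forall_sum_smul_eq_zero hCu
      (eq_zero_of_nonneg_orthonormal_trace hf (hκ₀.trans (hκ f hf)) hge)⟩

end TraceInequality

/-- A family of Euclidean spaces over an interval with a metric connection and a symmetric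
curvature endomorphism. `Smooth X t` is smoothness of the section `X` at `t` within `J`. -/
structure MetricConnection (J : Set ℝ) (T : ℝ → Type*) [∀ t, NormedAddCommGroup (T t)]
    [∀ t, InnerProductSpace ℝ (T t)] where
  /-- Smoothness of a section at a point. -/
  Smooth : (∀ t, T t) → ℝ → Prop
  /-- The covariant derivative. -/
  D : (∀ t, T t) → ∀ t, T t
  /-- The curvature endomorphism. -/
  R : ∀ t, T t →ₗ[ℝ] T t
  smooth_congr : ∀ {X Y : ∀ t, T t} {t : ℝ}, t ∈ J → Smooth X t →
    (∀ᶠ s in 𝓝[J] t, Y s = X s) → Smooth Y t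
  smooth_add : ∀ {X Y : ∀ t, T t} {t : ℝ}, t ∈ J → Smooth X t → Smooth Y t →
    Smooth (fun s ↦ X s + Y s) t
  smooth_smul : ∀ {f : ℝ → ℝ} {X : ∀ t, T t} {t : ℝ}, t ∈ J → ContDiffWithinAt ℝ ∞ f J t →
    Smooth X t → Smooth (fun s ↦ f s • X s) t
  smooth_D : ∀ {X : ∀ t, T t} {t : ℝ}, t ∈ J → Smooth X t → Smooth (D X) t
  smooth_R : ∀ {X : ∀ t, T t} {t : ℝ}, t ∈ J → Smooth X t → Smooth (fun s ↦ R s (X s)) t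
  smooth_inner : ∀ {X Y : ∀ t, T t} {t : ℝ}, t ∈ J → Smooth X t → Smooth Y t →
    ContDiffWithinAt ℝ ∞ (fun s ↦ ⟪X s, Y s⟫_ℝ) J t
  hasDerivWithinAt_inner : ∀ {X Y : ∀ t, T t} {t : ℝ}, t ∈ J → Smooth X t → Smooth Y t →
    HasDerivWithinAt (fun s ↦ ⟪X s, Y s⟫_ℝ) (⟪D X t, Y t⟫_ℝ + ⟪X t, D Y t⟫_ℝ) J t
  smooth_div : ∀ {X : ∀ t, T t} {t : ℝ}, t ∈ J → Smooth X t → X t = 0 →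
    Smooth (Function.update (fun s ↦ (s - t)⁻¹ • X s) t (D X t)) t
  D_add : ∀ {X Y : ∀ t, T t} {t : ℝ}, t ∈ J → Smooth X t → Smooth Y t →
    D (fun s ↦ X s + Y s) t = D X t + D Y t
  D_smul : ∀ (a : ℝ) {X : ∀ t, T t} {t : ℝ}, t ∈ J → Smooth X t →
    D (fun s ↦ a • X s) t = a • D X t
  R_symm : ∀ t, (R t).IsSymmetric

section Lagrange

variable {J : Set ℝ} {T : ℝ → Type*} [∀ t, NormedAddCommGroup (T t)]
  [∀ t, InnerProductSpace ℝ (T t)]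
  {V : Type*} [NormedAddCommGroup V] [InnerProductSpace ℝ V]

/-- A Lagrange tensor for a metric connection. Its values are maps out of a fixed space `V`, and
non-degeneracy is expressed by the initial values at each single point. -/
structure MetricConnection.IsLagrange (𝒞 : MetricConnection J T) (A : ∀ t, V →L[ℝ] T t) :
    Prop where
  smooth : ∀ u, ∀ t ∈ J, 𝒞.Smooth (fun s ↦ A s u) t
  jacobi : ∀ u, ∀ t ∈ J, 𝒞.D (𝒞.D fun s ↦ A s u) t + 𝒞.R t (A t u) = 0
  symm : ∀ u w, ∀ t ∈ J, ⟪𝒞.D (fun s ↦ A s u) t, A t w⟫_ℝ = ⟪A t u, 𝒞.D (fun s ↦ A s w) t⟫_ℝ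
  nondegenerate : ∀ u, ∀ t ∈ J, A t u = 0 → 𝒞.D (fun s ↦ A s u) t = 0 → u = 0
  finrank_eq : ∀ t ∈ J, Module.finrank ℝ (T t) = Module.finrank ℝ V

variable {𝒞 : MetricConnection J T} {A : ∀ t, V →L[ℝ] T t} {t : ℝ}

/-- The Wronskian of two Jacobi fields is constant, because the curvature endomorphism is
symmetric. -/
theorem wronskian_eq_zero (hJ : J.OrdConnected)
    (hs : ∀ u, ∀ t ∈ J, 𝒞.Smooth (fun s ↦ A s u) t)
    (hj : ∀ u, ∀ t ∈ J, 𝒞.D (𝒞.D fun s ↦ A s u) t + 𝒞.R t (A t u) = 0) {r : ℝ} (hr : r ∈ J)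
    (h : ∀ u w, ⟪𝒞.D (fun s ↦ A s u) r, A r w⟫_ℝ = ⟪A r u, 𝒞.D (fun s ↦ A s w) r⟫_ℝ)
    (u w : V) (ht : t ∈ J) :
    ⟪𝒞.D (fun s ↦ A s u) t, A t w⟫_ℝ = ⟪A t u, 𝒞.D (fun s ↦ A s w) t⟫_ℝ := by
  let W : ℝ → ℝ := fun s ↦ ⟪𝒞.D (fun s ↦ A s u) s, A s w⟫_ℝ - ⟪A s u, 𝒞.D (fun s ↦ A s w) s⟫_ℝ
  have hW : ∀ s ∈ J, HasDerivWithinAt W 0 J s := by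
    intro s hsJ
    refine ((𝒞.hasDerivWithinAt_inner hsJ (𝒞.smooth_D hsJ (hs u s hsJ)) (hs w s hsJ)).sub
      (𝒞.hasDerivWithinAt_inner hsJ (hs u s hsJ) (𝒞.smooth_D hsJ (hs w s hsJ)))).congr_deriv ?_
    rw [eq_neg_of_add_eq_zero_left (hj u s hsJ), eq_neg_of_add_eq_zero_left (hj w s hsJ),
      inner_neg_left, inner_neg_right, 𝒞.R_symm s]
    ring
  have hWr : W r = 0 := sub_eq_zero.2 (h u w)
  have hconst := hJ.convex.norm_image_sub_le_of_norm_hasDerivWithin_le (C := 0) hW (by simp) hr ht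
  rw [hWr, sub_zero, zero_mul, norm_le_zero_iff] at hconst
  exact sub_eq_zero.1 hconst

namespace MetricConnection.IsLagrange

theorem D_add (hA : 𝒞.IsLagrange A) (ht : t ∈ J) (u w : V) :
    𝒞.D (fun s ↦ A s (u + w)) t = 𝒞.D (fun s ↦ A s u) t + 𝒞.D (fun s ↦ A s w) t := by
  simp only [map_add]
  exact 𝒞.D_add ht (hA.smooth u t ht) (hA.smooth w t ht)

theorem D_smul (hA : 𝒞.IsLagrange A) (ht : t ∈ J) (a : ℝ) (u : V) :
    𝒞.D (fun s ↦ A s (a • u)) t = a • 𝒞.D (fun s ↦ A s u) t := by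
  simp only [map_smul]
  exact 𝒞.D_smul a ht (hA.smooth u t ht)

theorem smooth_zero (hA : 𝒞.IsLagrange A) (ht : t ∈ J) : 𝒞.Smooth (fun _ ↦ 0) t := by
  simpa using hA.smooth 0 t ht

theorem smooth_sum (hA : 𝒞.IsLagrange A) {ι : Type*} (S : Finset ι) {X : ι → ∀ t, T t}
    (ht : t ∈ J) (hX : ∀ i ∈ S, 𝒞.Smooth (X i) t) : 𝒞.Smooth (fun s ↦ ∑ i ∈ S, X i s) t := by
  classical
  induction S using Finset.induction_on with
  | empty => simpa using hA.smooth_zero ht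
  | insert i S hi ih =>
    simp only [Finset.sum_insert hi]
    exact 𝒞.smooth_add ht (hX i (Finset.mem_insert_self i S))
      (ih fun j hj ↦ hX j (Finset.mem_insert_of_mem hj))

theorem D_zero (hA : 𝒞.IsLagrange A) (ht : t ∈ J) : 𝒞.D (fun s ↦ A s 0) t = 0 := by
  simpa using hA.D_smul ht 0 0

theorem D_sum_smul (hA : 𝒞.IsLagrange A) {ι : Type*} (S : Finset ι) (a : ι → ℝ)
    {X : ι → ∀ t, T t} (ht : t ∈ J) (hX : ∀ i ∈ S, 𝒞.Smooth (X i) t) :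
    𝒞.D (fun s ↦ ∑ i ∈ S, a i • X i s) t = ∑ i ∈ S, a i • 𝒞.D (X i) t := by
  classical
  induction S using Finset.induction_on with
  | empty => simpa using hA.D_zero ht
  | insert i S hi ih =>
    have hXS : ∀ j ∈ S, 𝒞.Smooth (X j) t := fun j hj ↦ hX j (Finset.mem_insert_of_mem hj)
    have hXi : 𝒞.Smooth (X i) t := hX i (Finset.mem_insert_self i S)
    simp only [Finset.sum_insert hi]
    rw [𝒞.D_add ht (𝒞.smooth_smul ht contDiffWithinAt_const hXi) (hA.smooth_sum S ht fun j hj ↦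
      𝒞.smooth_smul ht contDiffWithinAt_const (hXS j hj)), 𝒞.D_smul _ ht hXi, ih hXS]

theorem inner_D_of_mem_ker (hA : 𝒞.IsLagrange A) (ht : t ∈ J) {k : V} (hk : k ∈ (A t).ker)
    (u : V) : ⟪A t u, 𝒞.D (fun s ↦ A s k) t⟫_ℝ = 0 := by
  rw [← hA.symm u k t ht, show A t k = 0 from hk, inner_zero_right]

end MetricConnection.IsLagrange

variable [FiniteDimensional ℝ V]

variable (𝒞 A) in
/-- The desingularised tensor: `A` on the complement of the kernel of `A t`, `A / (s - t)` on
the kernel, the derivative of `A` replacing the quotient at `t`. -/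
noncomputable def desing (t : ℝ) (u : V) (s : ℝ) : T s :=
  A s (u - (A t).ker.starProjection u) + Function.update
    (fun s ↦ (s - t)⁻¹ • A s ((A t).ker.starProjection u)) t
    (𝒞.D (fun s ↦ A s ((A t).ker.starProjection u)) t) s

theorem desing_self (t : ℝ) (u : V) : desing 𝒞 A t u t =
    A t (u - (A t).ker.starProjection u) + 𝒞.D (fun s ↦ A s ((A t).ker.starProjection u)) t := by
  simp [desing]

theorem desing_of_ne {s : ℝ} (hst : s ≠ t) (u : V) : desing 𝒞 A t u s =
    A s (u - (A t).ker.starProjection u + (s - t)⁻¹ • (A t).ker.starProjection u) := by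
  simp [desing, Function.update_of_ne hst]

theorem starProjection_ker_idem (t : ℝ) (u : V) :
    (A t).ker.starProjection ((A t).ker.starProjection u) = (A t).ker.starProjection u :=
  Submodule.starProjection_eq_self_iff.2 (Submodule.starProjection_apply_mem _ u)

theorem apply_eq_desing {s : ℝ} (hst : s ≠ t) (u : V) : A s u =
    desing 𝒞 A t (u - (A t).ker.starProjection u + (s - t) • (A t).ker.starProjection u) s := by
  rw [desing_of_ne hst]
  congr 1
  simp only [map_add, map_sub, map_smul, starProjection_ker_idem, smul_add, smul_sub, smul_smul,
    inv_mul_cancel₀ (sub_ne_zero.2 hst), one_smul]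
  abel

theorem apply_starProjection_ker (t : ℝ) (u : V) : A t ((A t).ker.starProjection u) = 0 :=
  Submodule.starProjection_apply_mem (A t).ker u

namespace MetricConnection.IsLagrange

variable (hA : 𝒞.IsLagrange A)
include hA

theorem smooth_desing (ht : t ∈ J) (u : V) : 𝒞.Smooth (desing 𝒞 A t u) t :=
  𝒞.smooth_add ht (hA.smooth _ t ht)
    (𝒞.smooth_div ht (hA.smooth _ t ht) (apply_starProjection_ker t u))

theorem desing_add (ht : t ∈ J) (u w : V) (s : ℝ) :
    desing 𝒞 A t (u + w) s = desing 𝒞 A t u s + desing 𝒞 A t w s := by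
  by_cases hst : s = t
  · subst hst
    rw [desing_self, desing_self, desing_self, map_add (A s).ker.starProjection, hA.D_add ht]
    simp only [map_add, map_sub]
    abel
  · simp only [desing_of_ne hst, map_add, map_sub, smul_add]
    abel

theorem desing_smul (ht : t ∈ J) (a : ℝ) (u : V) (s : ℝ) :
    desing 𝒞 A t (a • u) s = a • desing 𝒞 A t u s := by
  by_cases hst : s = t
  · subst hst
    rw [desing_self, desing_self, map_smul (A s).ker.starProjection, hA.D_smul ht]
    simp only [map_smul, map_sub, smul_add, smul_sub]
  · simp only [desing_of_ne hst, map_add, map_smul, map_sub, smul_add, smul_sub, smul_comm a]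

/-- The desingularised tensor as a linear map. -/
noncomputable def desingₗ (ht : t ∈ J) (s : ℝ) : V →ₗ[ℝ] T s where
  toFun u := desing 𝒞 A t u s
  map_add' u w := hA.desing_add ht u w s
  map_smul' a u := hA.desing_smul ht a u s

@[simp]
theorem desingₗ_apply (ht : t ∈ J) (s : ℝ) (u : V) :
    hA.desingₗ ht s u = desing 𝒞 A t u s := rfl

/-- `A t` is injective on the complement of its kernel, `A' t` is injective on the kernel, and by
`inner_D_of_mem_ker` the images are orthogonal. -/
theorem desing_self_injective (ht : t ∈ J) : Function.Injective (hA.desingₗ ht t) := by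
  rw [injective_iff_map_eq_zero]
  intro u hu
  set k := (A t).ker.starProjection u with hk
  have hmem : k ∈ (A t).ker := Submodule.starProjection_apply_mem (A t).ker u
  rw [desingₗ_apply, desing_self, ← hk] at hu
  have hA₀ : A t (u - k) = 0 := by
    rw [← inner_self_eq_zero (𝕜 := ℝ)]
    have hinner := congrArg (fun x ↦ ⟪A t (u - k), x⟫_ℝ) hu
    simpa only [inner_add_right, hA.inner_D_of_mem_ker ht hmem, add_zero, inner_zero_right]
      using hinner
  rw [hA₀, zero_add] at hu
  have hk₀ : k = 0 := hA.nondegenerate k t ht hmem hu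
  rw [hk₀, sub_zero] at hA₀
  rw [← hk₀, hk, Submodule.starProjection_eq_self_iff.2 hA₀]

variable [∀ t, FiniteDimensional ℝ (T t)]

theorem isInvertible_of_injective (ht : t ∈ J) (h : Function.Injective (A t)) :
    (A t).IsInvertible := by
  let e : V ≃ₗ[ℝ] T t := LinearMap.linearEquivOfInjective (A t).toLinearMap h
    (hA.finrank_eq t ht).symm
  exact ⟨e.toContinuousLinearEquiv, by ext; rfl⟩

theorem desing_self_surjective (ht : t ∈ J) : Function.Surjective (hA.desingₗ ht t) :=
  (LinearMap.injective_iff_surjective_of_finrank_eq_finrank (hA.finrank_eq t ht).symm).1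
    (hA.desing_self_injective ht)

theorem exists_mem_ker_D_eq (ht : t ∈ J) {y : T t} (hy : ∀ u, ⟪y, A t u⟫_ℝ = 0) :
    ∃ k ∈ (A t).ker, 𝒞.D (fun s ↦ A s k) t = y := by
  obtain ⟨u, rfl⟩ := hA.desing_self_surjective ht y
  have hmem := Submodule.starProjection_apply_mem (A t).ker u
  refine ⟨_, hmem, ?_⟩
  have horth := hy (u - (A t).ker.starProjection u)
  rw [desingₗ_apply, desing_self, inner_add_left, real_inner_comm _ (𝒞.D _ t),
    hA.inner_D_of_mem_ker ht hmem, add_zero, inner_self_eq_zero] at horth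
  rw [desingₗ_apply, desing_self, horth, zero_add]

end MetricConnection.IsLagrange

end Lagrange

section Virtual

open scoped Matrix

variable {J : Set ℝ} {T : ℝ → Type*} [∀ t, NormedAddCommGroup (T t)]
  [∀ t, InnerProductSpace ℝ (T t)]
  {V : Type*} [NormedAddCommGroup V] [InnerProductSpace ℝ V]
  {𝒞 : MetricConnection J T} {A : ∀ t, V →L[ℝ] T t} {t s : ℝ} {v w : V}

theorem mem_orthogonal_ker_of_isInvertible (h : (A t).IsInvertible) (v : V) :
    v ∈ (A t).kerᗮ := by
  obtain ⟨e, he⟩ := h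
  have hker : (A t).ker = ⊥ := by
    rw [← he]
    exact LinearMap.ker_eq_bot.2 e.injective
  rw [hker, Submodule.bot_orthogonal_eq_top]
  trivial

theorem surjective_of_isInvertible (h : (A t).IsInvertible) : Function.Surjective (A t) := by
  obtain ⟨e, he⟩ := h
  rw [← he]
  exact e.surjective

variable [FiniteDimensional ℝ V]

variable (𝒞 A) in
/-- The Gram matrix of the desingularised tensor on an orthonormal basis of `V`. -/
noncomputable def desingGram (t s : ℝ) :
    Matrix (Fin (Module.finrank ℝ V)) (Fin (Module.finrank ℝ V)) ℝ :=
  Matrix.gram ℝ fun i ↦ desing 𝒞 A t (stdOrthonormalBasis ℝ V i) s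

variable (𝒞 A) in
/-- The inverse of the adjoint of the desingularised tensor, written through the Gram matrix so
that it depends smoothly on `s`. -/
noncomputable def desingDual (t s : ℝ) : V →ₗ[ℝ] T s :=
  Fintype.linearCombination ℝ (fun i ↦ desing 𝒞 A t (stdOrthonormalBasis ℝ V i) s) ∘ₗ
    (desingGram 𝒞 A t s)⁻¹.mulVecLin ∘ₗ
      (stdOrthonormalBasis ℝ V).toBasis.equivFun.toLinearMap

variable (𝒞 A) in
/-- The virtual Jacobi field of `v`: the field `(A^*)⁻¹ v`, extended to the singular points. -/
noncomputable def virt (v : V) (t : ℝ) : T t :=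
  desingDual 𝒞 A t t v

theorem desingDual_apply (v : V) : desingDual 𝒞 A t s v =
    ∑ i, ((desingGram 𝒞 A t s)⁻¹ *ᵥ (stdOrthonormalBasis ℝ V).toBasis.equivFun v) i •
      desing 𝒞 A t (stdOrthonormalBasis ℝ V i) s := rfl

theorem virt_sum_smul {ι : Type*} [Fintype ι] (a : ι → ℝ) (e : ι → V) (t : ℝ) :
    virt 𝒞 A (∑ i, a i • e i) t = ∑ i, a i • virt 𝒞 A (e i) t := by
  simp only [virt, map_sum, map_smul]

theorem inner_desingDual_basis (hdet : (desingGram 𝒞 A t s).det ≠ 0) (v : V)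
    (k : Fin (Module.finrank ℝ V)) :
    ⟪desingDual 𝒞 A t s v, desing 𝒞 A t (stdOrthonormalBasis ℝ V k) s⟫_ℝ =
      ⟪v, stdOrthonormalBasis ℝ V k⟫_ℝ := by
  set G := desingGram 𝒞 A t s with hG
  set c := (stdOrthonormalBasis ℝ V).toBasis.equivFun v with hc
  calc ⟪desingDual 𝒞 A t s v, desing 𝒞 A t (stdOrthonormalBasis ℝ V k) s⟫_ℝ
      = ∑ i, ⟪desing 𝒞 A t (stdOrthonormalBasis ℝ V i) s,
          desing 𝒞 A t (stdOrthonormalBasis ℝ V k) s⟫_ℝ * (G⁻¹ *ᵥ c) i := by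
        simp only [desingDual_apply, sum_inner, real_inner_smul_left, ← hG, ← hc, mul_comm]
    _ = (G *ᵥ (G⁻¹ *ᵥ c)) k :=
        Finset.sum_congr rfl fun i _ ↦ by rw [real_inner_comm]; rfl
    _ = c k := by
        rw [Matrix.mulVec_mulVec, Matrix.mul_nonsing_inv _ (isUnit_iff_ne_zero.2 hdet),
          Matrix.one_mulVec]
    _ = ⟪v, stdOrthonormalBasis ℝ V k⟫_ℝ := by
        rw [hc, real_inner_comm, Module.Basis.equivFun_apply,
          OrthonormalBasis.coe_toBasis_repr_apply, OrthonormalBasis.repr_apply_apply]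

theorem D_eq_desing_self {k : V} (hk : k ∈ (A t).ker) :
    𝒞.D (fun s ↦ A s k) t = desing 𝒞 A t k t := by
  rw [desing_self, Submodule.starProjection_eq_self_iff.2 hk, sub_self, map_zero, zero_add]

namespace MetricConnection.IsLagrange

variable (hA : 𝒞.IsLagrange A)
include hA

theorem inner_desingDual (ht : t ∈ J) (hdet : (desingGram 𝒞 A t s).det ≠ 0) (v u : V) :
    ⟪desingDual 𝒞 A t s v, desing 𝒞 A t u s⟫_ℝ = ⟪v, u⟫_ℝ := by
  have hext : (innerₛₗ ℝ (desingDual 𝒞 A t s v)) ∘ₗ hA.desingₗ ht s = innerₛₗ ℝ v :=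
    (stdOrthonormalBasis ℝ V).toBasis.ext fun k ↦ by
      simpa using inner_desingDual_basis hdet v k
  exact LinearMap.congr_fun hext u

theorem contDiffWithinAt_desingGram (ht : t ∈ J) (i j : Fin (Module.finrank ℝ V)) :
    ContDiffWithinAt ℝ ∞ (fun s ↦ desingGram 𝒞 A t s i j) J t :=
  𝒞.smooth_inner ht (hA.smooth_desing ht _) (hA.smooth_desing ht _)

theorem det_desingGram_ne_zero (ht : t ∈ J) : (desingGram 𝒞 A t t).det ≠ 0 :=
  Matrix.det_gram_ne_zero_iff_linearIndependent.2 <|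
    (stdOrthonormalBasis ℝ V).orthonormal.linearIndependent.map_injOn (hA.desingₗ ht t)
      (hA.desing_self_injective ht).injOn

theorem eventually_det_desingGram_ne_zero (ht : t ∈ J) :
    ∀ᶠ s in 𝓝[J] t, (desingGram 𝒞 A t s).det ≠ 0 :=
  (contDiffWithinAt_det (hA.contDiffWithinAt_desingGram ht)).continuousWithinAt.eventually_ne
    (hA.det_desingGram_ne_zero ht)

theorem injective_of_det_ne_zero (ht : t ∈ J) (hst : s ≠ t)
    (hdet : (desingGram 𝒞 A t s).det ≠ 0) : Function.Injective (A s) := by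
  rw [injective_iff_map_eq_zero]
  intro u hu
  rw [apply_eq_desing (𝒞 := 𝒞) hst] at hu
  set u' := u - (A t).ker.starProjection u + (s - t) • (A t).ker.starProjection u with hu'
  have hu'₀ : u' = 0 := by
    rw [← inner_self_eq_zero (𝕜 := ℝ), ← hA.inner_desingDual ht hdet, hu, inner_zero_right]
  have hproj : (A t).ker.starProjection u = 0 := by
    have hproj' := congrArg (A t).ker.starProjection hu'₀
    simpa only [hu', map_add, map_sub, map_smul, starProjection_ker_idem, sub_self, zero_add,
      map_zero, smul_eq_zero, sub_ne_zero.2 hst, false_or] using hproj'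
  simpa only [hu', hproj, sub_zero, smul_zero, add_zero] using hu'₀

theorem inner_virt (ht : t ∈ J) (v u : V) : ⟪virt 𝒞 A v t, desing 𝒞 A t u t⟫_ℝ = ⟪v, u⟫_ℝ :=
  hA.inner_desingDual ht (hA.det_desingGram_ne_zero ht) v u

theorem apply_eq_desing_self (ht : t ∈ J) (u : V) :
    A t u = desing 𝒞 A t (u - (A t).ker.starProjection u) t := by
  rw [desing_self, map_sub (A t).ker.starProjection, starProjection_ker_idem, sub_self, sub_zero,
    hA.D_zero ht, add_zero, map_sub, apply_starProjection_ker, sub_zero]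

theorem inner_virt_apply (ht : t ∈ J) (hv : v ∈ (A t).kerᗮ) (u : V) :
    ⟪virt 𝒞 A v t, A t u⟫_ℝ = ⟪v, u⟫_ℝ := by
  rw [hA.apply_eq_desing_self ht, hA.inner_virt ht, inner_sub_right,
    Submodule.inner_left_of_mem_orthogonal (Submodule.starProjection_apply_mem _ u) hv, sub_zero]

theorem inner_virt_D (ht : t ∈ J) (hv : v ∈ (A t).kerᗮ) {k : V} (hk : k ∈ (A t).ker) :
    ⟪virt 𝒞 A v t, 𝒞.D (fun s ↦ A s k) t⟫_ℝ = 0 := by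
  rw [D_eq_desing_self hk, hA.inner_virt ht, Submodule.inner_left_of_mem_orthogonal hk hv]

theorem eq_virt_of_isInvertible (ht : t ∈ J) (h : (A t).IsInvertible) {z : T t}
    (hz : ∀ u, ⟪z, A t u⟫_ℝ = ⟪v, u⟫_ℝ) : z = virt 𝒞 A v t := by
  refine ext_inner_right ℝ fun y ↦ ?_
  obtain ⟨u, rfl⟩ := surjective_of_isInvertible h y
  rw [hz, hA.inner_virt_apply ht (mem_orthogonal_ker_of_isInvertible h v)]

theorem virt_ne_zero (ht : t ∈ J) (hv : v ≠ 0) : virt 𝒞 A v t ≠ 0 := by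
  intro h
  have hvv := hA.inner_virt ht v v
  rw [h, inner_zero_left] at hvv
  exact hv (inner_self_eq_zero.1 hvv.symm)

theorem linearIndependent_virt {ι : Type*} {e : ι → V} (he : LinearIndependent ℝ e)
    (ht : t ∈ J) : LinearIndependent ℝ fun i ↦ virt 𝒞 A (e i) t :=
  he.map_injOn (desingDual 𝒞 A t t) ((injective_iff_map_eq_zero _).2 fun _ hv ↦
    by_contra fun hv₀ ↦ hA.virt_ne_zero ht hv₀ hv).injOn

theorem smooth_desingDual (ht : t ∈ J) (v : V) :
    𝒞.Smooth (fun s ↦ desingDual 𝒞 A t s v) t := by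
  simp only [desingDual_apply, Matrix.mulVec, dotProduct]
  exact hA.smooth_sum _ ht fun i _ ↦ 𝒞.smooth_smul ht
    (ContDiffWithinAt.sum fun j _ ↦ (contDiffWithinAt_inv_apply
      (hA.contDiffWithinAt_desingGram ht) (hA.det_desingGram_ne_zero ht) i j).mul
        contDiffWithinAt_const) (hA.smooth_desing ht _)

variable [∀ t, FiniteDimensional ℝ (T t)]

theorem eventually_isInvertible (ht : t ∈ J) :
    ∀ᶠ s in 𝓝[J] t, s ≠ t → (A s).IsInvertible := by
  filter_upwards [hA.eventually_det_desingGram_ne_zero ht, self_mem_nhdsWithin] with s hs hsJ hst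
  exact hA.isInvertible_of_injective hsJ (hA.injective_of_det_ne_zero ht hst hs)

theorem eventually_mem_orthogonal_ker (ht : t ∈ J) (hv : v ∈ (A t).kerᗮ) :
    ∀ᶠ s in 𝓝[J] t, v ∈ (A s).kerᗮ := by
  filter_upwards [hA.eventually_isInvertible ht] with s hs
  by_cases hst : s = t
  · rwa [hst]
  · exact mem_orthogonal_ker_of_isInvertible (hs hst) v

theorem isInvertible_adjoint (ht : t ∈ J) (h : (A t).IsInvertible) :
    (ContinuousLinearMap.adjoint (A t)).IsInvertible := by
  have hinj : Function.Injective (ContinuousLinearMap.adjoint (A t)) := by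
    rw [injective_iff_map_eq_zero]
    intro y hy
    obtain ⟨u, rfl⟩ := surjective_of_isInvertible h y
    rw [← inner_self_eq_zero (𝕜 := ℝ), ← ContinuousLinearMap.adjoint_inner_left, hy,
      inner_zero_left]
  let e : T t ≃ₗ[ℝ] V := LinearMap.linearEquivOfInjective
    (ContinuousLinearMap.adjoint (A t)).toLinearMap hinj (hA.finrank_eq t ht)
  exact ⟨e.toContinuousLinearEquiv, by ext; rfl⟩

theorem adjoint_inverse_eq_virt (ht : t ∈ J) (h : (A t).IsInvertible) (v : V) :
    (ContinuousLinearMap.adjoint (A t)).inverse v = virt 𝒞 A v t :=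
  hA.eq_virt_of_isInvertible ht h fun u ↦ by
    rw [← ContinuousLinearMap.adjoint_inner_left, (hA.isInvertible_adjoint ht h).self_apply_inverse]

theorem smooth_virt (ht : t ∈ J) (hv : v ∈ (A t).kerᗮ) : 𝒞.Smooth (virt 𝒞 A v) t := by
  refine 𝒞.smooth_congr ht (hA.smooth_desingDual ht v) ?_
  filter_upwards [hA.eventually_det_desingGram_ne_zero ht, self_mem_nhdsWithin] with s hs hsJ
  by_cases hst : s = t
  · subst hst
    rfl
  · refine (hA.eq_virt_of_isInvertible hsJ (hA.isInvertible_of_injective hsJ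
      (hA.injective_of_det_ne_zero ht hst hs)) fun u ↦ ?_).symm
    rw [apply_eq_desing (𝒞 := 𝒞) hst, hA.inner_desingDual ht hs, inner_add_right,
      inner_sub_right, real_inner_smul_right,
      Submodule.inner_left_of_mem_orthogonal (Submodule.starProjection_apply_mem _ u) hv,
      mul_zero, sub_zero, add_zero]

/-- The derivative of `⟪(A^*)⁻¹ v, A u⟫ = ⟪v, u⟫`. -/
theorem inner_D_virt_apply (hJ : UniqueDiffOn ℝ J) (ht : t ∈ J) (hv : v ∈ (A t).kerᗮ) (u : V) :
    ⟪𝒞.D (virt 𝒞 A v) t, A t u⟫_ℝ = -⟪virt 𝒞 A v t, 𝒞.D (fun s ↦ A s u) t⟫_ℝ := by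
  have hprod := 𝒞.hasDerivWithinAt_inner ht (hA.smooth_virt ht hv) (hA.smooth u t ht)
  have hconst : HasDerivWithinAt (fun s ↦ ⟪virt 𝒞 A v s, A s u⟫_ℝ) 0 J t := by
    refine (hasDerivWithinAt_const t J ⟪v, u⟫_ℝ).congr_of_eventuallyEq ?_
      (hA.inner_virt_apply ht hv u)
    filter_upwards [hA.eventually_mem_orthogonal_ker ht hv, self_mem_nhdsWithin] with s hs hsJ
    exact hA.inner_virt_apply hsJ hs u
  exact eq_neg_of_add_eq_zero_left ((hJ t ht).eq_deriv _ hprod hconst)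

theorem exists_apply_eq_virt (ht : t ∈ J) (hv : v ∈ (A t).kerᗮ) :
    ∃ u, A t u = virt 𝒞 A v t := by
  obtain ⟨x, hx⟩ := hA.desing_self_surjective ht (virt 𝒞 A v t)
  have hmem := Submodule.starProjection_apply_mem (A t).ker x
  rw [desingₗ_apply, desing_self] at hx
  have hD : 𝒞.D (fun s ↦ A s ((A t).ker.starProjection x)) t = 0 := by
    rw [← inner_self_eq_zero (𝕜 := ℝ), ← hA.inner_virt_D ht hv hmem, ← hx, inner_add_left,
      hA.inner_D_of_mem_ker ht hmem, zero_add]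
  exact ⟨_, by rw [← hx, hD, add_zero]⟩

theorem exists_eq_virt (hJ : UniqueDiffOn ℝ J) (ht : t ∈ J) (hv : v ∈ (A t).kerᗮ) :
    ∃ u, A t u = virt 𝒞 A v t ∧ 𝒞.D (fun s ↦ A s u) t = -𝒞.D (virt 𝒞 A v) t := by
  obtain ⟨x, hx⟩ := hA.exists_apply_eq_virt ht hv
  obtain ⟨k, hk, hDk⟩ := hA.exists_mem_ker_D_eq ht
    (y := 𝒞.D (virt 𝒞 A v) t + 𝒞.D (fun s ↦ A s x) t) fun u ↦ by
      rw [inner_add_left, hA.inner_D_virt_apply hJ ht hv, hA.symm x u t ht, hx, neg_add_cancel]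
  refine ⟨x + (-1 : ℝ) • k, ?_, ?_⟩
  · rw [map_add, map_smul, show A t k = 0 from hk, smul_zero, add_zero, hx]
  · rw [hA.D_add ht, hA.D_smul ht, hDk]
    module

theorem inner_D_virt_symm (hJ : UniqueDiffOn ℝ J) (ht : t ∈ J) (hv : v ∈ (A t).kerᗮ)
    (hw : w ∈ (A t).kerᗮ) :
    ⟪𝒞.D (virt 𝒞 A v) t, virt 𝒞 A w t⟫_ℝ = ⟪virt 𝒞 A v t, 𝒞.D (virt 𝒞 A w) t⟫_ℝ := by
  obtain ⟨u, hu, hDu⟩ := hA.exists_eq_virt hJ ht hw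
  rw [← hu, hA.inner_D_virt_apply hJ ht hv, hDu, inner_neg_right, neg_neg]

/-- Differentiate `inner_D_virt_apply` for a Jacobi field `A u` which agrees with `virt w` at `t`
and has the opposite derivative there. -/
theorem inner_D_D_virt (hJ : UniqueDiffOn ℝ J) (ht : t ∈ J) (hv : v ∈ (A t).kerᗮ)
    (hw : w ∈ (A t).kerᗮ) :
    ⟪𝒞.D (𝒞.D (virt 𝒞 A v)) t, virt 𝒞 A w t⟫_ℝ =
      2 * ⟪𝒞.D (virt 𝒞 A v) t, 𝒞.D (virt 𝒞 A w) t⟫_ℝ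
        + ⟪𝒞.R t (virt 𝒞 A v t), virt 𝒞 A w t⟫_ℝ := by
  obtain ⟨u, hu, hDu⟩ := hA.exists_eq_virt hJ ht hw
  have hvirt := hA.smooth_virt ht hv
  have hAu := hA.smooth u t ht
  have hleft := 𝒞.hasDerivWithinAt_inner ht (𝒞.smooth_D ht hvirt) hAu
  have hright := (𝒞.hasDerivWithinAt_inner ht hvirt (𝒞.smooth_D ht hAu)).neg
  have hderiv := (hJ t ht).eq_deriv _ hleft (hright.congr_of_eventuallyEq (by
    filter_upwards [hA.eventually_mem_orthogonal_ker ht hv, self_mem_nhdsWithin] with s hs hsJ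
    exact hA.inner_D_virt_apply hJ hsJ hs u) (hA.inner_D_virt_apply hJ ht hv u))
  rw [eq_neg_of_add_eq_zero_left (hA.jacobi u t ht), hDu, hu] at hderiv
  simp only [inner_neg_right] at hderiv
  rw [𝒞.R_symm t]
  linarith

end MetricConnection.IsLagrange

end Virtual

section Root

variable {J : Set ℝ} {T : ℝ → Type*} [∀ t, NormedAddCommGroup (T t)]
  [∀ t, InnerProductSpace ℝ (T t)]
  {V : Type*} [NormedAddCommGroup V] [InnerProductSpace ℝ V] [FiniteDimensional ℝ V]
  {𝒞 : MetricConnection J T} {A : ∀ t, V →L[ℝ] T t} {t : ℝ} {p : ℕ} {e : Fin p → V}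

variable (A e) in
/-- The function `(det M)^(-1/2p)`, meaningful at the regular points of `A`. -/
noncomputable def regularRoot [∀ t, FiniteDimensional ℝ (T t)] (t : ℝ) : ℝ :=
  (Matrix.of fun i j ↦ ⟪(ContinuousLinearMap.adjoint (A t)).inverse (e i),
    (ContinuousLinearMap.adjoint (A t)).inverse (e j)⟫_ℝ).det ^ (-(1 / (2 * (p : ℝ))))

open scoped Classical in
variable (J A e) in
/-- The function `(det M)^(-1/2p)`, extended by its limits to the singular points. -/
noncomputable def gramRoot [∀ t, FiniteDimensional ℝ (T t)] (t : ℝ) : ℝ :=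
  if (A t).IsInvertible then regularRoot A e t else limUnder (𝓝[J \ {t}] t) (regularRoot A e)

variable (𝒞 A e) in
/-- The Gram matrix of the virtual Jacobi fields of `e`. -/
noncomputable def virtGram (t : ℝ) : Matrix (Fin p) (Fin p) ℝ :=
  Matrix.gram ℝ fun i ↦ virt 𝒞 A (e i) t

variable (𝒞 A e) in
/-- Half the derivative of `virtGram`. -/
noncomputable def virtGramDeriv (t : ℝ) : Matrix (Fin p) (Fin p) ℝ :=
  Matrix.of fun i j ↦ ⟪𝒞.D (virt 𝒞 A (e i)) t, virt 𝒞 A (e j) t⟫_ℝ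

variable (𝒞 A e) in
/-- The derivative of `virtGramDeriv`. -/
noncomputable def virtGramDeriv₂ (t : ℝ) : Matrix (Fin p) (Fin p) ℝ :=
  Matrix.of fun i j ↦ 3 * ⟪𝒞.D (virt 𝒞 A (e i)) t, 𝒞.D (virt 𝒞 A (e j)) t⟫_ℝ
    + ⟪𝒞.R t (virt 𝒞 A (e i) t), virt 𝒞 A (e j) t⟫_ℝ

variable (𝒞 A e) in
/-- The logarithmic derivative of `gramRoot`. -/
noncomputable def logDerivRoot (t : ℝ) : ℝ :=
  -(1 / (p : ℝ)) * ((virtGram 𝒞 A e t)⁻¹ * virtGramDeriv 𝒞 A e t).trace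

variable (𝒞 A e) in
/-- The derivative of `logDerivRoot`. -/
noncomputable def logDerivRoot₂ (t : ℝ) : ℝ :=
  1 / (p : ℝ) * (2 * ((virtGram 𝒞 A e t)⁻¹ * virtGramDeriv 𝒞 A e t *
      (virtGram 𝒞 A e t)⁻¹ * virtGramDeriv 𝒞 A e t).trace
    - ((virtGram 𝒞 A e t)⁻¹ * virtGramDeriv₂ 𝒞 A e t).trace)

theorem neBot_nhdsWithin_diff_singleton (hJ : UniqueDiffOn ℝ J) (ht : t ∈ J) :
    (𝓝[J \ {t}] t).NeBot :=
  accPt_principal_iff_nhdsWithin.1 (uniqueDiffWithinAt_iff_accPt.1 (hJ t ht))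

theorem nhdsWithin_diff_singleton_le (J : Set ℝ) (t : ℝ) : 𝓝[J \ {t}] t ≤ 𝓝[J] t :=
  nhdsWithin_mono t sdiff_subset

namespace MetricConnection.IsLagrange

variable (hA : 𝒞.IsLagrange A)
include hA

theorem det_virtGram_pos (he : LinearIndependent ℝ e) (ht : t ∈ J) :
    0 < (virtGram 𝒞 A e t).det :=
  (Matrix.posDef_gram_iff_linearIndependent.2 (hA.linearIndependent_virt he ht)).det_pos

variable [∀ t, FiniteDimensional ℝ (T t)]

theorem regularRoot_eq (ht : t ∈ J) (h : (A t).IsInvertible) :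
    regularRoot A e t = (virtGram 𝒞 A e t).det ^ (-(1 / (2 * (p : ℝ)))) := by
  simp only [regularRoot, hA.adjoint_inverse_eq_virt ht h]
  rfl

theorem eventually_regularRoot_eq (ht : t ∈ J) : ∀ᶠ s in 𝓝[J \ {t}] t,
    regularRoot A e s = (virtGram 𝒞 A e s).det ^ (-(1 / (2 * (p : ℝ)))) := by
  filter_upwards [nhdsWithin_diff_singleton_le J t (hA.eventually_isInvertible ht),
    self_mem_nhdsWithin] with s hs hsJ
  exact hA.regularRoot_eq hsJ.1 (hs hsJ.2)

theorem contDiffWithinAt_virtGram (ht : t ∈ J) (hv : ∀ i, e i ∈ (A t).kerᗮ) (i j : Fin p) :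
    ContDiffWithinAt ℝ ∞ (fun s ↦ virtGram 𝒞 A e s i j) J t :=
  𝒞.smooth_inner ht (hA.smooth_virt ht (hv i)) (hA.smooth_virt ht (hv j))

theorem contDiffWithinAt_det_virtGram_rpow (he : LinearIndependent ℝ e) (ht : t ∈ J)
    (hv : ∀ i, e i ∈ (A t).kerᗮ) (q : ℝ) :
    ContDiffWithinAt ℝ ∞ (fun s ↦ (virtGram 𝒞 A e s).det ^ q) J t :=
  (contDiffWithinAt_det (hA.contDiffWithinAt_virtGram ht hv)).rpow_const_of_ne
    (hA.det_virtGram_pos he ht).ne'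

theorem gramRoot_eq (hJ : UniqueDiffOn ℝ J) (he : LinearIndependent ℝ e) (ht : t ∈ J)
    (hv : ∀ i, e i ∈ (A t).kerᗮ) :
    gramRoot J A e t = (virtGram 𝒞 A e t).det ^ (-(1 / (2 * (p : ℝ)))) := by
  rw [gramRoot]
  split_ifs with h
  · exact hA.regularRoot_eq ht h
  · have : (𝓝[J \ {t}] t).NeBot := neBot_nhdsWithin_diff_singleton hJ ht
    exact (((hA.contDiffWithinAt_det_virtGram_rpow he ht hv _).continuousWithinAt.mono_left
      (nhdsWithin_diff_singleton_le J t)).congr' ((hA.eventually_regularRoot_eq ht).mono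
        fun s hs ↦ hs.symm)).limUnder_eq

theorem gramRoot_pos (hJ : UniqueDiffOn ℝ J) (he : LinearIndependent ℝ e) (ht : t ∈ J)
    (hv : ∀ i, e i ∈ (A t).kerᗮ) : 0 < gramRoot J A e t := by
  rw [hA.gramRoot_eq hJ he ht hv]
  exact Real.rpow_pos_of_pos (hA.det_virtGram_pos he ht) _

theorem eventually_gramRoot_eq (hJ : UniqueDiffOn ℝ J) (he : LinearIndependent ℝ e) (ht : t ∈ J)
    (hv : ∀ i, e i ∈ (A t).kerᗮ) : ∀ᶠ s in 𝓝[J] t,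
    gramRoot J A e s = (virtGram 𝒞 A e s).det ^ (-(1 / (2 * (p : ℝ)))) := by
  filter_upwards [eventually_all.2 fun i ↦ hA.eventually_mem_orthogonal_ker ht (hv i),
    self_mem_nhdsWithin] with s hs hsJ
  exact hA.gramRoot_eq hJ he hsJ hs

theorem contDiffWithinAt_gramRoot (hJ : UniqueDiffOn ℝ J) (he : LinearIndependent ℝ e)
    (ht : t ∈ J) (hv : ∀ i, e i ∈ (A t).kerᗮ) :
    ContDiffWithinAt ℝ ∞ (gramRoot J A e) J t :=
  (hA.contDiffWithinAt_det_virtGram_rpow he ht hv _).congr_of_eventuallyEq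
    (hA.eventually_gramRoot_eq hJ he ht hv) (hA.gramRoot_eq hJ he ht hv)

theorem hasDerivWithinAt_virtGram (hJ : UniqueDiffOn ℝ J) (ht : t ∈ J)
    (hv : ∀ i, e i ∈ (A t).kerᗮ) (i j : Fin p) :
    HasDerivWithinAt (fun s ↦ virtGram 𝒞 A e s i j)
      (((2 : ℝ) • virtGramDeriv 𝒞 A e t) i j) J t := by
  refine (𝒞.hasDerivWithinAt_inner ht (hA.smooth_virt ht (hv i))
    (hA.smooth_virt ht (hv j))).congr_deriv ?_
  rw [← hA.inner_D_virt_symm hJ ht (hv i) (hv j)]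
  exact (two_mul _).symm

theorem hasDerivWithinAt_virtGramDeriv (hJ : UniqueDiffOn ℝ J) (ht : t ∈ J)
    (hv : ∀ i, e i ∈ (A t).kerᗮ) (i j : Fin p) :
    HasDerivWithinAt (fun s ↦ virtGramDeriv 𝒞 A e s i j) (virtGramDeriv₂ 𝒞 A e t i j) J t := by
  refine (𝒞.hasDerivWithinAt_inner ht (𝒞.smooth_D ht (hA.smooth_virt ht (hv i)))
    (hA.smooth_virt ht (hv j))).congr_deriv ?_
  rw [hA.inner_D_D_virt hJ ht (hv i) (hv j), virtGramDeriv₂, Matrix.of_apply]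
  ring

theorem hasDerivWithinAt_gramRoot (hJ : UniqueDiffOn ℝ J) (he : LinearIndependent ℝ e)
    (hp : 1 ≤ p) (ht : t ∈ J) (hv : ∀ i, e i ∈ (A t).kerᗮ) :
    HasDerivWithinAt (gramRoot J A e) (gramRoot J A e t * logDerivRoot 𝒞 A e t) J t := by
  have hpos := hA.det_virtGram_pos he ht
  have hrpow := (hasDerivWithinAt_det (hA.hasDerivWithinAt_virtGram hJ ht hv)
    hpos.ne').rpow_const (p := -(1 / (2 * (p : ℝ)))) (Or.inl hpos.ne')
  refine (hrpow.congr_of_eventuallyEq (hA.eventually_gramRoot_eq hJ he ht hv)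
    (hA.gramRoot_eq hJ he ht hv)).congr_deriv ?_
  rw [hA.gramRoot_eq hJ he ht hv, Real.rpow_sub_one hpos.ne', Matrix.mul_smul, Matrix.trace_smul,
    logDerivRoot, smul_eq_mul]
  field_simp

theorem hasDerivWithinAt_logDerivRoot (hJ : UniqueDiffOn ℝ J) (he : LinearIndependent ℝ e)
    (ht : t ∈ J) (hv : ∀ i, e i ∈ (A t).kerᗮ) :
    HasDerivWithinAt (logDerivRoot 𝒞 A e) (logDerivRoot₂ 𝒞 A e t) J t := by
  have hpos := hA.det_virtGram_pos he ht
  have hM := hA.contDiffWithinAt_virtGram ht hv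
  have htrace := hasDerivWithinAt_trace_inv_mul (hA.hasDerivWithinAt_virtGram hJ ht hv)
    (fun i j ↦ (contDiffWithinAt_inv_apply hM hpos.ne' i j).differentiableWithinAt (by simp))
    (hA.hasDerivWithinAt_virtGramDeriv hJ ht hv) (hJ t ht)
    ((contDiffWithinAt_det hM).continuousWithinAt.eventually_ne hpos.ne') hpos.ne'
  refine (htrace.const_mul (-(1 / (p : ℝ)))).congr_deriv ?_
  simp only [logDerivRoot₂, Matrix.mul_smul, Matrix.smul_mul, Matrix.trace_smul, smul_eq_mul]
  ring

theorem riccati_inequality (hJ : UniqueDiffOn ℝ J) (he : LinearIndependent ℝ e)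
    (hp : 1 ≤ p) (ht : t ∈ J) (hv : ∀ i, e i ∈ (A t).kerᗮ) :
    p * (logDerivRoot₂ 𝒞 A e t + logDerivRoot 𝒞 A e t ^ 2) ≤
      -sumSmallestEigenvalues p (𝒞.R t) := by
  refine le_trans (le_of_eq ?_) (trace_inequality (hA.linearIndependent_virt he ht)
    (fun i j ↦ hA.inner_D_virt_symm hJ ht (hv i) (hv j)) (𝒞.R t)
    (fun _ hf ↦ sumSmallestEigenvalues_le (𝒞.R_symm t) hf)
    (N := virtGramDeriv 𝒞 A e t) (Q := virtGramDeriv₂ 𝒞 A e t) (fun _ _ ↦ rfl)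
    fun _ _ ↦ rfl).1
  rw [logDerivRoot₂, logDerivRoot, virtGram]
  field_simp

theorem D_virt_eq_zero_of_nonneg (hJ : UniqueDiffOn ℝ J) (he : LinearIndependent ℝ e)
    (hp : 1 ≤ p) (ht : t ∈ J) (hv : ∀ i, e i ∈ (A t).kerᗮ)
    (hR : 0 ≤ sumSmallestEigenvalues p (𝒞.R t)) (hder : 0 ≤ logDerivRoot₂ 𝒞 A e t)
    (i : Fin p) : 𝒞.D (virt 𝒞 A (e i)) t = 0 :=
  (trace_inequality (hA.linearIndependent_virt he ht)
    (fun i j ↦ hA.inner_D_virt_symm hJ ht (hv i) (hv j)) (𝒞.R t)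
    (fun _ hf ↦ sumSmallestEigenvalues_le (𝒞.R_symm t) hf) (fun _ _ ↦ rfl)
    fun _ _ ↦ rfl).2 hR (nonneg_of_mul_nonneg_right hder (by positivity)) i

end MetricConnection.IsLagrange

end Root

section Singular

variable {J : Set ℝ} {T : ℝ → Type*} [∀ t, NormedAddCommGroup (T t)]
  [∀ t, InnerProductSpace ℝ (T t)]
  {V : Type*} [NormedAddCommGroup V] [InnerProductSpace ℝ V] [FiniteDimensional ℝ V]
  {𝒞 : MetricConnection J T} {A : ∀ t, V →L[ℝ] T t} {t s : ℝ} {p : ℕ} {e : Fin p → V}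

variable (𝒞 A) in
/-- The smooth extension of `(s - t) • virt v s` to `s = t`. -/
noncomputable def scaledVirt (t : ℝ) (v : V) (s : ℝ) : T s :=
  (s - t) • desingDual 𝒞 A t s (v - (A t).ker.starProjection v)
    + desingDual 𝒞 A t s ((A t).ker.starProjection v)

theorem scaledVirt_self (t : ℝ) (v : V) :
    scaledVirt 𝒞 A t v t = virt 𝒞 A ((A t).ker.starProjection v) t := by
  rw [scaledVirt, sub_self, zero_smul, zero_add, virt]

theorem tendsto_inv_sq_sub_atTop (J : Set ℝ) (t : ℝ) :
    Tendsto (fun s ↦ ((s - t) ^ 2)⁻¹) (𝓝[J \ {t}] t) atTop := by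
  refine tendsto_inv_nhdsGT_zero.comp (tendsto_nhdsWithin_iff.2 ⟨?_, ?_⟩)
  · have hcont : ContinuousAt (fun s : ℝ ↦ (s - t) ^ 2) t := by fun_prop
    simpa using hcont.tendsto.mono_left (nhdsWithin_le_nhds (s := J \ {t}))
  · filter_upwards [self_mem_nhdsWithin] with s hs
    exact sq_pos_of_ne_zero (sub_ne_zero.2 hs.2)

theorem not_differentiableAt_of_mul_abs_le {f : ℝ → ℝ} {c : ℝ} (hc : 0 < c) (hft : f t = 0)
    (hf : ∀ᶠ s in 𝓝[≠] t, c * |s - t| ≤ f s) : ¬ DifferentiableAt ℝ f t := by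
  intro hd
  have hmin : IsLocalMin f t := by
    rw [eventually_nhdsWithin_iff] at hf
    filter_upwards [hf] with s hs
    by_cases hst : s = t
    · rw [hst]
    · rw [hft]
      exact le_trans (by positivity) (hs hst)
  have hder := hd.hasDerivAt
  rw [hmin.hasDerivAt_eq_zero hder] at hder
  have hlittle := (hasDerivAt_iff_isLittleO.1 hder).def (half_pos hc)
  simp only [hft, smul_zero, sub_zero, Real.norm_eq_abs] at hlittle
  obtain ⟨s, ⟨hlow, hupp⟩, hst⟩ :=
    ((hf.and (nhdsWithin_le_nhds hlittle)).and self_mem_nhdsWithin).exists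
  have habs : 0 < |s - t| := abs_pos.2 (sub_ne_zero.2 hst)
  nlinarith [le_abs_self (f s)]

theorem mul_inv_pow_rpow_neg {B d : ℝ} (hB : 0 ≤ B) (hd : 0 ≤ d) (hp : p ≠ 0) :
    (B * (d ^ (2 * p))⁻¹) ^ (-(1 / (2 * (p : ℝ)))) = B ^ (-(1 / (2 * (p : ℝ)))) * d := by
  rw [Real.mul_rpow hB (by positivity), Real.inv_rpow (by positivity),
    Real.rpow_neg (by positivity) (1 / (2 * (p : ℝ))), Real.rpow_neg (by positivity), inv_inv,
    ← Real.rpow_natCast, ← Real.rpow_mul hd]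
  push_cast
  rw [mul_one_div_cancel (by positivity), Real.rpow_one]

namespace MetricConnection.IsLagrange

variable (hA : 𝒞.IsLagrange A)
include hA

theorem smooth_scaledVirt (ht : t ∈ J) (v : V) : 𝒞.Smooth (scaledVirt 𝒞 A t v) t :=
  𝒞.smooth_add ht (𝒞.smooth_smul ht (contDiffWithinAt_id.sub contDiffWithinAt_const)
    (hA.smooth_desingDual ht _)) (hA.smooth_desingDual ht _)

theorem scaledVirt_self_ne_zero (ht : t ∈ J) {v : V} (hv : v ∉ (A t).kerᗮ) :
    scaledVirt 𝒞 A t v t ≠ 0 := by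
  rw [scaledVirt_self]
  exact hA.virt_ne_zero ht fun h ↦ hv ((Submodule.starProjection_apply_eq_zero_iff _).1 h)

theorem inner_scaledVirt_apply (ht : t ∈ J) (hst : s ≠ t) (hdet : (desingGram 𝒞 A t s).det ≠ 0)
    (v u : V) : ⟪scaledVirt 𝒞 A t v s, A s u⟫_ℝ = (s - t) * ⟪v, u⟫_ℝ := by
  have horth : ∀ x y : V,
      ⟪x - (A t).ker.starProjection x, (A t).ker.starProjection y⟫_ℝ = 0 := fun x y ↦
    Submodule.inner_left_of_mem_orthogonal (Submodule.starProjection_apply_mem _ y)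
      (Submodule.sub_starProjection_mem_orthogonal x)
  have hvu := horth v u
  have huv := horth u v
  rw [real_inner_comm] at huv
  rw [apply_eq_desing (𝒞 := 𝒞) hst, scaledVirt, inner_add_left, real_inner_smul_left,
    hA.inner_desingDual ht hdet, hA.inner_desingDual ht hdet]
  simp only [inner_add_right, inner_sub_right, inner_sub_left, real_inner_smul_right]
    at hvu huv ⊢
  linear_combination (s - t - 1) * (s - t) * hvu + (1 - (s - t)) * huv

theorem eventually_norm_apply_le (ht : t ∈ J) :
    ∃ C : ℝ, 0 < C ∧ ∀ᶠ s in 𝓝[J] t, ∀ v, ‖A s v‖ ≤ C * ‖v‖ := by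
  let b := stdOrthonormalBasis ℝ V
  let C : ℝ := ∑ i, (‖A t (b i)‖ + 1) + 1
  refine ⟨C, by positivity, ?_⟩
  have hbasis : ∀ i, ∀ᶠ s in 𝓝[J] t, ‖A s (b i)‖ < ‖A t (b i)‖ + 1 := fun i ↦ by
    have hsq := (𝒞.smooth_inner ht (hA.smooth (b i) t ht) (hA.smooth (b i) t ht)).continuousWithinAt
    have hnorm : ContinuousWithinAt (fun s ↦ ‖A s (b i)‖) J t := by
      simpa [real_inner_self_eq_norm_sq, Real.sqrt_sq] using hsq.sqrt
    exact hnorm.eventually_lt_const (lt_add_one _)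
  filter_upwards [eventually_all.2 hbasis] with s hs v
  calc ‖A s v‖ = ‖∑ i, ⟪b i, v⟫_ℝ • A s (b i)‖ := by
        conv_lhs => rw [← b.sum_repr' v]
        simp only [map_sum, map_smul]
    _ ≤ ∑ i, ‖v‖ * (‖A t (b i)‖ + 1) := by
        refine (norm_sum_le _ _).trans (Finset.sum_le_sum fun i _ ↦ ?_)
        rw [norm_smul]
        refine mul_le_mul ?_ (hs i).le (norm_nonneg _) (norm_nonneg _)
        simpa [b.orthonormal.1 i] using norm_inner_le_norm (𝕜 := ℝ) (b i) v
    _ ≤ C * ‖v‖ := by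
        rw [← Finset.mul_sum, mul_comm]
        exact mul_le_mul_of_nonneg_right (by simp [C]) (norm_nonneg _)

theorem norm_le_mul_norm_virt {C : ℝ} {u : V} (ht : t ∈ J) (hC : 0 ≤ C) (hu : u ∈ (A t).kerᗮ)
    (hbound : ‖A t u‖ ≤ C * ‖u‖) : ‖u‖ ≤ C * ‖virt 𝒞 A u t‖ := by
  have hsq : ‖u‖ ^ 2 ≤ ‖virt 𝒞 A u t‖ * (C * ‖u‖) := by
    rw [← real_inner_self_eq_norm_sq, ← hA.inner_virt_apply ht hu u]
    exact (real_inner_le_norm _ _).trans (mul_le_mul_of_nonneg_left hbound (norm_nonneg _))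
  rcases (norm_nonneg u).eq_or_lt with hu₀ | hu₀
  · rw [← hu₀]
    positivity
  · nlinarith

theorem mul_dotProduct_le_dotProduct_virtGram {C : ℝ} (he : Orthonormal ℝ e) (ht : t ∈ J)
    (hinv : (A t).IsInvertible) (hC : 0 < C) (hbound : ∀ u, ‖A t u‖ ≤ C * ‖u‖) (x : Fin p → ℝ) :
    (C ^ 2)⁻¹ * (x ⬝ᵥ x) ≤ x ⬝ᵥ (virtGram 𝒞 A e t).mulVec x := by
  set u := ∑ i, x i • e i with hu
  have hgram : x ⬝ᵥ (virtGram 𝒞 A e t).mulVec x = ‖virt 𝒞 A u t‖ ^ 2 := by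
    rw [hu, virt_sum_smul, ← real_inner_self_eq_norm_sq, virtGram]
    simpa only [star_trivial] using
      Matrix.star_dotProduct_gram_mulVec (𝕜 := ℝ) (fun i ↦ virt 𝒞 A (e i) t) x x
  have hnorm : x ⬝ᵥ x = ‖u‖ ^ 2 := by
    rw [hu, ← real_inner_self_eq_norm_sq, he.inner_sum]
    simp only [dotProduct, conj_trivial]
  rw [hgram, hnorm, inv_mul_le_iff₀ (by positivity), ← mul_pow]
  exact pow_le_pow_left₀ (norm_nonneg _) (hA.norm_le_mul_norm_virt ht hC.le
    (mem_orthogonal_ker_of_isInvertible hinv u) (hbound u)) 2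

variable [∀ t, FiniteDimensional ℝ (T t)]

theorem eventually_scaledVirt_eq (ht : t ∈ J) (v : V) :
    ∀ᶠ s in 𝓝[J \ {t}] t, scaledVirt 𝒞 A t v s = (s - t) • virt 𝒞 A v s := by
  filter_upwards [nhdsWithin_diff_singleton_le J t (hA.eventually_det_desingGram_ne_zero ht),
    self_mem_nhdsWithin] with s hs hsJ
  have hst : s - t ≠ 0 := sub_ne_zero.2 hsJ.2
  rw [← inv_smul_eq_iff₀ hst]
  refine hA.eq_virt_of_isInvertible hsJ.1 (hA.isInvertible_of_injective hsJ.1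
    (hA.injective_of_det_ne_zero ht hsJ.2 hs)) fun u ↦ ?_
  rw [real_inner_smul_left, hA.inner_scaledVirt_apply ht hsJ.2 hs, inv_mul_cancel_left₀ hst]

/-- The trace of the Gram matrix grows like `(s - t)⁻²`, and its smallest eigenvalue stays away
from `0` because `A` is bounded near `t`. -/
theorem tendsto_det_virtGram_atTop (he : Orthonormal ℝ e) (ht : t ∈ J) {i : Fin p}
    (hi : e i ∉ (A t).kerᗮ) :
    Tendsto (fun s ↦ (virtGram 𝒞 A e s).det) (𝓝[J \ {t}] t) atTop := by
  have hp : 0 < p := i.pos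
  obtain ⟨C, hC, hbound⟩ := hA.eventually_norm_apply_le ht
  have hcont := (𝒞.smooth_inner ht (hA.smooth_scaledVirt ht (e i))
    (hA.smooth_scaledVirt ht (e i))).continuousWithinAt.mono_left
      (nhdsWithin_diff_singleton_le J t)
  have htop := ((tendsto_inv_sq_sub_atTop J t).atTop_mul_pos
    (real_inner_self_pos.2 (hA.scaledVirt_self_ne_zero ht hi)) hcont).const_mul_atTop
    (show 0 < ((C ^ 2)⁻¹) ^ (p - 1) / p by positivity)
  refine tendsto_atTop_mono' _ ?_ htop
  filter_upwards [hA.eventually_scaledVirt_eq ht (e i),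
    nhdsWithin_diff_singleton_le J t hbound,
    nhdsWithin_diff_singleton_le J t (hA.eventually_isInvertible ht), self_mem_nhdsWithin]
    with s hscaled hs hinv hsJ
  have hst : s - t ≠ 0 := sub_ne_zero.2 hsJ.2
  have hdiag : ((s - t) ^ 2)⁻¹ * ⟪scaledVirt 𝒞 A t (e i) s, scaledVirt 𝒞 A t (e i) s⟫_ℝ =
      virtGram 𝒞 A e s i i := by
    rw [hscaled, real_inner_smul_left, real_inner_smul_right, virtGram, Matrix.gram_apply]
    field_simp
  have hdiag_le : virtGram 𝒞 A e s i i ≤ (virtGram 𝒞 A e s).trace :=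
    Finset.single_le_sum (f := fun j ↦ virtGram 𝒞 A e s j j)
      (fun j _ ↦ real_inner_self_nonneg) (Finset.mem_univ i)
  rw [hdiag, div_mul_eq_mul_div, div_le_iff₀ (by positivity)]
  calc ((C ^ 2)⁻¹) ^ (p - 1) * virtGram 𝒞 A e s i i
      ≤ ((C ^ 2)⁻¹) ^ (p - 1) * (virtGram 𝒞 A e s).trace := by gcongr
    _ ≤ p * (virtGram 𝒞 A e s).det := by
        simpa only [Fintype.card_fin] using trace_le_card_mul_det
          (P := virtGram 𝒞 A e s) (Matrix.isHermitian_gram _ _)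
          (by positivity) (hA.mul_dotProduct_le_dotProduct_virtGram he hsJ.1 (hinv hsJ.2) hC hs)
    _ = (virtGram 𝒞 A e s).det * p := mul_comm _ _

theorem gramRoot_eq_zero (hJ : UniqueDiffOn ℝ J) (he : Orthonormal ℝ e) (ht : t ∈ J)
    {i : Fin p} (hi : e i ∉ (A t).kerᗮ) : gramRoot J A e t = 0 := by
  have hp : 0 < p := i.pos
  have : (𝓝[J \ {t}] t).NeBot := neBot_nhdsWithin_diff_singleton hJ ht
  rw [gramRoot, if_neg fun h ↦ hi (mem_orthogonal_ker_of_isInvertible h _)]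
  exact (((tendsto_rpow_neg_atTop (show 0 < 1 / (2 * (p : ℝ)) by positivity)).comp
    (hA.tendsto_det_virtGram_atTop he ht hi)).congr' ((hA.eventually_regularRoot_eq ht).mono
      fun s hs ↦ hs.symm)).limUnder_eq

theorem gramRoot_pos_iff (hJ : UniqueDiffOn ℝ J) (he : Orthonormal ℝ e) (ht : t ∈ J) :
    0 < gramRoot J A e t ↔ ∀ i, e i ∈ (A t).kerᗮ := by
  refine ⟨fun h ↦ ?_, hA.gramRoot_pos hJ he.linearIndependent ht⟩
  by_contra! ⟨i, hi⟩
  exact h.ne' (hA.gramRoot_eq_zero hJ he ht hi)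

theorem eventually_det_gram_scaledVirt (ht : t ∈ J) : ∀ᶠ s in 𝓝[J \ {t}] t,
    (Matrix.gram ℝ fun i ↦ scaledVirt 𝒞 A t (e i) s).det =
      |s - t| ^ (2 * p) * (virtGram 𝒞 A e s).det := by
  filter_upwards [eventually_all.2 fun i ↦ hA.eventually_scaledVirt_eq ht (e i)] with s hs
  have hgram : (Matrix.gram ℝ fun i ↦ scaledVirt 𝒞 A t (e i) s) =
      (|s - t| ^ 2) • virtGram 𝒞 A e s := by
    ext i j
    simp only [virtGram, Matrix.gram_apply, Matrix.smul_apply, hs, real_inner_smul_left,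
      real_inner_smul_right, smul_eq_mul, sq_abs]
    ring
  rw [hgram, Matrix.det_smul, Fintype.card_fin, pow_mul]

theorem exists_mul_abs_le_gramRoot (hp : 1 ≤ p) (he : LinearIndependent ℝ e) (ht : t ∈ J) :
    ∃ c : ℝ, 0 < c ∧ ∀ᶠ s in 𝓝[J \ {t}] t, c * |s - t| ≤ gramRoot J A e s := by
  let G : ℝ → Matrix (Fin p) (Fin p) ℝ := fun s ↦
    Matrix.gram ℝ fun i ↦ scaledVirt 𝒞 A t (e i) s
  have hG : ContinuousWithinAt (fun s ↦ (G s).det) J t :=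
    (contDiffWithinAt_det fun i j ↦ 𝒞.smooth_inner ht (hA.smooth_scaledVirt ht (e i))
      (hA.smooth_scaledVirt ht (e j))).continuousWithinAt
  let B : ℝ := |(G t).det| + 1
  have hB : 0 < B := by positivity
  have hGB : ∀ᶠ s in 𝓝[J] t, (G s).det < B :=
    hG.eventually_lt_const ((le_abs_self _).trans_lt (lt_add_one _))
  refine ⟨B ^ (-(1 / (2 * (p : ℝ)))), by positivity, ?_⟩
  filter_upwards [nhdsWithin_diff_singleton_le J t hGB, hA.eventually_det_gram_scaledVirt ht,
    nhdsWithin_diff_singleton_le J t (hA.eventually_isInvertible ht), self_mem_nhdsWithin]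
    with s hs hdet hinv hsJ
  have habs : 0 < |s - t| := abs_pos.2 (sub_ne_zero.2 hsJ.2)
  have hle : (virtGram 𝒞 A e s).det ≤ B * (|s - t| ^ (2 * p))⁻¹ := by
    rw [← div_eq_mul_inv, le_div_iff₀ (by positivity), mul_comm, ← hdet]
    exact hs.le
  rw [gramRoot, if_pos (hinv hsJ.2), hA.regularRoot_eq hsJ.1 (hinv hsJ.2),
    ← mul_inv_pow_rpow_neg hB.le habs.le (Nat.one_le_iff_ne_zero.1 hp)]
  exact Real.rpow_le_rpow_of_nonpos (hA.det_virtGram_pos he hsJ.1) hle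
    (neg_nonpos.2 (by positivity))

theorem not_differentiableAt_gramRoot (hJ : UniqueDiffOn ℝ J) (he : Orthonormal ℝ e)
    (ht : t ∈ interior J) {i : Fin p} (hi : e i ∉ (A t).kerᗮ) :
    ¬ DifferentiableAt ℝ (gramRoot J A e) t := by
  have htJ := interior_subset ht
  obtain ⟨c, hc, hle⟩ := hA.exists_mul_abs_le_gramRoot i.pos he.linearIndependent htJ
  have hnhds : 𝓝[J \ {t}] t = 𝓝[≠] t := by
    rw [sdiff_eq, inter_comm,
      nhdsWithin_inter_of_mem' (nhdsWithin_le_nhds (mem_interior_iff_mem_nhds.1 ht))]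
  rw [hnhds] at hle
  exact not_differentiableAt_of_mul_abs_le hc (hA.gramRoot_eq_zero hJ he htJ hi) hle

end MetricConnection.IsLagrange

end Singular

section Concavity

variable {J : Set ℝ} {T : ℝ → Type*} [∀ t, NormedAddCommGroup (T t)]
  [∀ t, InnerProductSpace ℝ (T t)] [∀ t, FiniteDimensional ℝ (T t)]
  {V : Type*} [NormedAddCommGroup V] [InnerProductSpace ℝ V] [FiniteDimensional ℝ V]
  {𝒞 : MetricConnection J T} {A : ∀ t, V →L[ℝ] T t} {t s : ℝ} {v : V} {p : ℕ} {e : Fin p → V}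

namespace MetricConnection.IsLagrange

variable (hA : 𝒞.IsLagrange A)
include hA

theorem continuousOn_gramRoot (hJ : UniqueDiffOn ℝ J) (he : Orthonormal ℝ e) {K : Set ℝ}
    (hK : K ⊆ J) (hpos : ∀ t ∈ K, 0 < gramRoot J A e t) : ContinuousOn (gramRoot J A e) K :=
  fun t ht ↦ (hA.contDiffWithinAt_gramRoot hJ he.linearIndependent (hK ht)
    ((hA.gramRoot_pos_iff hJ he (hK ht)).1 (hpos t ht))).continuousWithinAt.mono hK

theorem hasDerivAt_gramRoot (hJ : UniqueDiffOn ℝ J) (he : Orthonormal ℝ e) (hp : 1 ≤ p)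
    (ht : t ∈ interior J) (hpos : 0 < gramRoot J A e t) :
    HasDerivAt (gramRoot J A e) (gramRoot J A e t * logDerivRoot 𝒞 A e t) t :=
  (hA.hasDerivWithinAt_gramRoot hJ he.linearIndependent hp (interior_subset ht)
    ((hA.gramRoot_pos_iff hJ he (interior_subset ht)).1 hpos)).hasDerivAt
      (mem_interior_iff_mem_nhds.1 ht)

theorem hasDerivAt_gramRoot_mul_logDerivRoot (hJ : UniqueDiffOn ℝ J) (he : Orthonormal ℝ e)
    (hp : 1 ≤ p) (ht : t ∈ interior J) (hpos : 0 < gramRoot J A e t) :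
    HasDerivAt (fun s ↦ gramRoot J A e s * logDerivRoot 𝒞 A e s)
      (gramRoot J A e t * (logDerivRoot₂ 𝒞 A e t + logDerivRoot 𝒞 A e t ^ 2)) t := by
  have htJ := interior_subset ht
  refine ((hA.hasDerivAt_gramRoot hJ he hp ht hpos).mul
    ((hA.hasDerivWithinAt_logDerivRoot hJ he.linearIndependent htJ
      ((hA.gramRoot_pos_iff hJ he htJ).1 hpos)).hasDerivAt
        (mem_interior_iff_mem_nhds.1 ht))).congr_deriv ?_
  ring

theorem logDerivRoot₂_add_sq_le (hJ : UniqueDiffOn ℝ J) (he : Orthonormal ℝ e) (hp : 1 ≤ p)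
    (ht : t ∈ J) (hpos : 0 < gramRoot J A e t) :
    logDerivRoot₂ 𝒞 A e t + logDerivRoot 𝒞 A e t ^ 2 ≤
      -(sumSmallestEigenvalues p (𝒞.R t) / p) := by
  rw [← neg_div, le_div_iff₀' (by positivity)]
  exact hA.riccati_inequality hJ he.linearIndependent hp ht
    ((hA.gramRoot_pos_iff hJ he ht).1 hpos)

theorem concaveOn_gramRoot (hJ : UniqueDiffOn ℝ J) (he : Orthonormal ℝ e) (hp : 1 ≤ p)
    (hR : ∀ t ∈ J, 0 ≤ sumSmallestEigenvalues p (𝒞.R t)) {K : Set ℝ} (hK : K ⊆ J)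
    (hK' : K.OrdConnected) (hpos : ∀ t ∈ K, 0 < gramRoot J A e t) :
    ConcaveOn ℝ K (gramRoot J A e) := by
  refine concaveOn_of_hasDerivWithinAt2_nonpos hK'.convex (hA.continuousOn_gramRoot hJ he hK hpos)
    (fun t ht ↦ (hA.hasDerivAt_gramRoot hJ he hp (interior_mono hK ht)
      (hpos t (interior_subset ht))).hasDerivWithinAt)
    (fun t ht ↦ (hA.hasDerivAt_gramRoot_mul_logDerivRoot hJ he hp (interior_mono hK ht)
      (hpos t (interior_subset ht))).hasDerivWithinAt) fun t ht ↦ ?_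
  have htK := interior_subset ht
  exact mul_nonpos_of_nonneg_of_nonpos (hpos t htK).le
    ((hA.logDerivRoot₂_add_sq_le hJ he hp (hK htK) (hpos t htK)).trans
      (neg_nonpos.2 (div_nonneg (hR t (hK htK)) p.cast_nonneg)))

theorem strictConcaveOn_gramRoot (hJ : UniqueDiffOn ℝ J) (he : Orthonormal ℝ e) (hp : 1 ≤ p)
    (hR : ∀ t ∈ J, 0 < sumSmallestEigenvalues p (𝒞.R t)) {K : Set ℝ} (hK : K ⊆ J)
    (hK' : K.OrdConnected) (hpos : ∀ t ∈ K, 0 < gramRoot J A e t) :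
    StrictConcaveOn ℝ K (gramRoot J A e) := by
  refine strictConcaveOn_of_deriv2_neg hK'.convex (hA.continuousOn_gramRoot hJ he hK hpos)
    fun t ht ↦ ?_
  have htK := interior_subset ht
  have hderiv : deriv (gramRoot J A e) =ᶠ[𝓝 t]
      fun s ↦ gramRoot J A e s * logDerivRoot 𝒞 A e s := by
    filter_upwards [isOpen_interior.mem_nhds ht] with s hs
    exact (hA.hasDerivAt_gramRoot hJ he hp (interior_mono hK hs)
      (hpos s (interior_subset hs))).deriv
  rw [Function.iterate_succ, Function.iterate_one, Function.comp_apply, hderiv.deriv_eq,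
    (hA.hasDerivAt_gramRoot_mul_logDerivRoot hJ he hp (interior_mono hK ht) (hpos t htK)).deriv]
  exact mul_neg_of_pos_of_neg (hpos t htK)
    ((hA.logDerivRoot₂_add_sq_le hJ he hp (hK htK) (hpos t htK)).trans_lt
      (neg_neg_of_pos (div_pos (hR t (hK htK)) (by positivity))))

theorem gramRoot_pos_of_const (hJ : UniqueDiffOn ℝ J) (he : LinearIndependent ℝ e) {a : ℝ}
    (ha : ∀ t ∈ J, gramRoot J A e t = a) (ht : t ∈ J) : 0 < gramRoot J A e t := by
  have : (𝓝[J \ {t}] t).NeBot := neBot_nhdsWithin_diff_singleton hJ ht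
  obtain ⟨s, hs, hsJ⟩ := (((hA.eventually_isInvertible ht).filter_mono
    (nhdsWithin_diff_singleton_le J t)).and self_mem_nhdsWithin).exists
  rw [ha t ht, ← ha s hsJ.1]
  exact hA.gramRoot_pos hJ he hsJ.1 fun i ↦ mem_orthogonal_ker_of_isInvertible (hs hsJ.2) _

theorem logDerivRoot_eq_zero_of_const (hJ : UniqueDiffOn ℝ J) (he : Orthonormal ℝ e)
    (hp : 1 ≤ p) {a : ℝ} (ha : ∀ t ∈ J, gramRoot J A e t = a) (ht : t ∈ J) :
    logDerivRoot 𝒞 A e t = 0 := by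
  have hpos := hA.gramRoot_pos_of_const hJ he.linearIndependent ha ht
  have hder := hA.hasDerivWithinAt_gramRoot hJ he.linearIndependent hp ht
    ((hA.gramRoot_pos_iff hJ he ht).1 hpos)
  have hconst := (hasDerivWithinAt_const t J a).congr_of_mem (f₁ := gramRoot J A e) ha ht
  exact (mul_eq_zero.1 ((hJ t ht).eq_deriv _ hder hconst)).resolve_left hpos.ne'

theorem D_virt_eq_zero_of_const (hJ : UniqueDiffOn ℝ J) (he : Orthonormal ℝ e) (hp : 1 ≤ p)
    (hR : ∀ t ∈ J, 0 ≤ sumSmallestEigenvalues p (𝒞.R t)) {a : ℝ}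
    (ha : ∀ t ∈ J, gramRoot J A e t = a) (ht : t ∈ J) (i : Fin p) :
    𝒞.D (virt 𝒞 A (e i)) t = 0 := by
  have hv := (hA.gramRoot_pos_iff hJ he ht).1
    (hA.gramRoot_pos_of_const hJ he.linearIndependent ha ht)
  have hder := hA.hasDerivWithinAt_logDerivRoot hJ he.linearIndependent ht hv
  have hconst := (hasDerivWithinAt_const t J (0 : ℝ)).congr_of_mem (f₁ := logDerivRoot 𝒞 A e)
    (fun s hs ↦ hA.logDerivRoot_eq_zero_of_const hJ he hp ha hs) ht
  exact hA.D_virt_eq_zero_of_nonneg hJ he.linearIndependent hp ht hv (hR t ht)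
    ((hJ t ht).eq_deriv _ hder hconst).ge i

theorem R_virt_eq_zero_of_isInvertible (hJ : UniqueDiffOn ℝ J) (hv : ∀ t ∈ J, v ∈ (A t).kerᗮ)
    (hD : ∀ t ∈ J, 𝒞.D (virt 𝒞 A v) t = 0) (ht : t ∈ J) (hinv : (A t).IsInvertible) :
    𝒞.R t (virt 𝒞 A v t) = 0 := by
  refine ext_inner_right ℝ fun y ↦ ?_
  obtain ⟨u, rfl⟩ := surjective_of_isInvertible hinv y
  have horth : ∀ s ∈ J, ⟪virt 𝒞 A v s, 𝒞.D (fun s ↦ A s u) s⟫_ℝ = 0 := fun s hs ↦ by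
    rw [← neg_eq_zero, ← hA.inner_D_virt_apply hJ hs (hv s hs) u, hD s hs, inner_zero_left]
  have hprod := 𝒞.hasDerivWithinAt_inner ht (hA.smooth_virt ht (hv t ht))
    (𝒞.smooth_D ht (hA.smooth u t ht))
  have hderiv := (hJ t ht).eq_deriv _ hprod
    ((hasDerivWithinAt_const t J (0 : ℝ)).congr_of_mem horth ht)
  rw [hD t ht, inner_zero_left, zero_add, eq_neg_of_add_eq_zero_left (hA.jacobi u t ht),
    inner_neg_right, ← 𝒞.R_symm, neg_eq_zero] at hderiv
  rw [hderiv, inner_zero_left]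

theorem R_virt_eq_zero (hJ : UniqueDiffOn ℝ J) (hv : ∀ t ∈ J, v ∈ (A t).kerᗮ)
    (hD : ∀ t ∈ J, 𝒞.D (virt 𝒞 A v) t = 0) (ht : t ∈ J) : 𝒞.R t (virt 𝒞 A v t) = 0 := by
  have : (𝓝[J \ {t}] t).NeBot := neBot_nhdsWithin_diff_singleton hJ ht
  have hsmooth := 𝒞.smooth_R ht (hA.smooth_virt ht (hv t ht))
  have hcont := (𝒞.smooth_inner ht hsmooth hsmooth).continuousWithinAt.mono_left
    (nhdsWithin_diff_singleton_le J t)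
  have hzero : (fun s ↦ ⟪𝒞.R s (virt 𝒞 A v s), 𝒞.R s (virt 𝒞 A v s)⟫_ℝ) =ᶠ[𝓝[J \ {t}] t]
      fun _ ↦ 0 := by
    filter_upwards [nhdsWithin_diff_singleton_le J t (hA.eventually_isInvertible ht),
      self_mem_nhdsWithin] with s hs hsJ
    rw [hA.R_virt_eq_zero_of_isInvertible hJ hv hD hsJ.1 (hs hsJ.2), inner_zero_left]
  exact inner_self_eq_zero.1 (tendsto_nhds_unique (hcont.congr' hzero) tendsto_const_nhds)

theorem parallel_virt_of_const (hJ : UniqueDiffOn ℝ J) (he : Orthonormal ℝ e) (hp : 1 ≤ p)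
    (hR : ∀ t ∈ J, 0 ≤ sumSmallestEigenvalues p (𝒞.R t)) {a : ℝ}
    (ha : ∀ t ∈ J, gramRoot J A e t = a) (x : Fin p → ℝ) (ht : t ∈ J) :
    𝒞.Smooth (virt 𝒞 A (∑ i, x i • e i)) t ∧ 𝒞.D (virt 𝒞 A (∑ i, x i • e i)) t = 0 ∧
      𝒞.R t (virt 𝒞 A (∑ i, x i • e i) t) = 0 := by
  have hv : ∀ t ∈ J, ∀ i, e i ∈ (A t).kerᗮ := fun t ht ↦ (hA.gramRoot_pos_iff hJ he ht).1
    (hA.gramRoot_pos_of_const hJ he.linearIndependent ha ht)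
  have hsum : ∀ t ∈ J, ∑ i, x i • e i ∈ (A t).kerᗮ := fun t ht ↦
    Submodule.sum_mem _ fun i _ ↦ Submodule.smul_mem _ _ (hv t ht i)
  have hD : ∀ t ∈ J, 𝒞.D (virt 𝒞 A (∑ i, x i • e i)) t = 0 := fun t ht ↦ by
    have hvirt : virt 𝒞 A (∑ i, x i • e i) = fun s ↦ ∑ i, x i • virt 𝒞 A (e i) s :=
      funext fun s ↦ virt_sum_smul x e s
    rw [hvirt, hA.D_sum_smul _ x ht fun i _ ↦ hA.smooth_virt ht (hv t ht i)]
    simp only [hA.D_virt_eq_zero_of_const hJ he hp hR ha ht, smul_zero, Finset.sum_const_zero]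
  exact ⟨hA.smooth_virt ht (hsum t ht), hD t ht, hA.R_virt_eq_zero hJ hsum hD ht⟩

end MetricConnection.IsLagrange

end Concavity

section NormalSpace

variable {E : Type*} [NormedAddCommGroup E] [NormedSpace ℝ E]
  {M : Type*} [TopologicalSpace M] [ChartedSpace E M]
  [RiemannianBundle (fun x : M ↦ TangentSpace 𝓘(ℝ, E) x)] {c : ℝ → M} {J : Set ℝ} {t : ℝ}

theorem coe_orthogonalProjectionOnto_normalSpace (y : TangentSpace 𝓘(ℝ, E) (c t)) :
    ((normalSpace c J t).orthogonalProjectionOnto y : TangentSpace 𝓘(ℝ, E) (c t)) =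
      y + (-(⟪velocity c J t, y⟫_ℝ / ⟪velocity (E := E) c J t, velocity c J t⟫_ℝ)) •
        velocity c J t := by
  rw [Submodule.coe_orthogonalProjectionOnto_apply, Submodule.starProjection_orthogonal_val,
    Submodule.starProjection_singleton, real_inner_self_eq_norm_sq, neg_smul, sub_eq_add_neg]
  rfl

theorem mem_normalSpace_iff {y : TangentSpace 𝓘(ℝ, E) (c t)} :
    y ∈ normalSpace c J t ↔ ⟪y, velocity c J t⟫_ℝ = 0 := by
  rw [Submodule.mem_orthogonal_singleton_iff_inner_left]

theorem inner_velocity (y : normalSpace (E := E) c J t) :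
    ⟪(y : TangentSpace 𝓘(ℝ, E) (c t)), velocity c J t⟫_ℝ = 0 :=
  mem_normalSpace_iff.1 y.2

variable [FiniteDimensional ℝ E] [IsManifold 𝓘(ℝ, E) ∞ M]

theorem finrank_normalSpace (hc : IsGeodesicOn (E := E) c J) (ht : t ∈ J) :
    Module.finrank ℝ (normalSpace (E := E) c J t) + 1 = Module.finrank ℝ E := by
  have hadd := Submodule.finrank_add_finrank_orthogonal (ℝ ∙ velocity (E := E) c J t)
  rw [finrank_span_singleton (hc.velocity_ne_zero t ht), add_comm] at hadd
  exact hadd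

end NormalSpace

section NormalBundle

variable {E : Type*} [NormedAddCommGroup E] [NormedSpace ℝ E]
  {M : Type*} [TopologicalSpace M] [ChartedSpace E M] [IsManifold 𝓘(ℝ, E) ∞ M]
  {c : ℝ → M} {J : Set ℝ} {t : ℝ} {X Y : ∀ t, TangentSpace 𝓘(ℝ, E) (c t)}

theorem SmoothAlongAt.congr (hX : SmoothAlongAt c J X t) (ht : t ∈ J)
    (h : ∀ᶠ s in 𝓝[J] t, Y s = X s) : SmoothAlongAt c J Y t :=
  ContMDiffWithinAt.congr_of_eventuallyEq hX (h.mono fun s hs ↦ by simp only [hs])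
    (by simp only [h.self_of_nhdsWithin ht])

theorem SmoothAlongAt.add (hX : SmoothAlongAt c J X t) (hY : SmoothAlongAt c J Y t)
    (hc : ContMDiffWithinAt 𝓘(ℝ, ℝ) 𝓘(ℝ, E) ∞ c J t) :
    SmoothAlongAt c J (fun s ↦ X s + Y s) t := by
  have h₀ := mem_chart_source E (c t)
  rw [smoothAlongAt_iff hc h₀] at hX hY ⊢
  simpa only [map_add] using hX.add hY

theorem SmoothAlongAt.smul {f : ℝ → ℝ} (hf : ContDiffWithinAt ℝ ∞ f J t)
    (hX : SmoothAlongAt c J X t) (hc : ContMDiffWithinAt 𝓘(ℝ, ℝ) 𝓘(ℝ, E) ∞ c J t) :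
    SmoothAlongAt c J (fun s ↦ f s • X s) t := by
  have h₀ := mem_chart_source E (c t)
  rw [smoothAlongAt_iff hc h₀] at hX ⊢
  simp only [map_smul]
  exact hf.smul hX

variable [RiemannianBundle (fun x : M ↦ TangentSpace 𝓘(ℝ, E) x)]

theorem covDeriv_congr (h : ∀ s ∈ J, X s = Y s) (ht : t ∈ J) :
    covDeriv c J X t = covDeriv c J Y t := by
  rw [covDeriv, covDeriv, h t ht, derivWithin_congr (fun s hs ↦ by rw [h s hs]) (by rw [h t ht])]

theorem covDeriv_zero (ht : t ∈ J) (h : ∀ s ∈ J, X s = 0) : covDeriv c J X t = 0 := by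
  rw [covDeriv_congr (Y := fun _ ↦ 0) h ht, covDeriv]
  simp only [map_zero, derivWithin_fun_const, Pi.zero_apply, add_zero]

theorem covDeriv_add (hX : SmoothAlongAt c J X t) (hY : SmoothAlongAt c J Y t)
    (hc : ContMDiffWithinAt 𝓘(ℝ, ℝ) 𝓘(ℝ, E) ∞ c J t) :
    covDeriv c J (fun s ↦ X s + Y s) t = covDeriv c J X t + covDeriv c J Y t := by
  have h₀ := mem_chart_source E (c t)
  simp only [covDeriv, map_add]
  rw [derivWithin_fun_add (hX.differentiableWithinAt hc h₀) (hY.differentiableWithinAt hc h₀)]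
  simp only [map_add]
  abel

theorem covDeriv_smul (a : ℝ) (hX : SmoothAlongAt c J X t)
    (hc : ContMDiffWithinAt 𝓘(ℝ, ℝ) 𝓘(ℝ, E) ∞ c J t) :
    covDeriv c J (fun s ↦ a • X s) t = a • covDeriv c J X t := by
  have h₀ := mem_chart_source E (c t)
  simp only [covDeriv, map_smul]
  rw [derivWithin_fun_const_smul _ (hX.differentiableWithinAt hc h₀)]
  simp only [map_smul, smul_add, map_add]

variable [IsContMDiffRiemannianBundle 𝓘(ℝ, E) ∞ E (fun x : M ↦ TangentSpace 𝓘(ℝ, E) x)]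

theorem SmoothAlongAt.normalPart (hX : SmoothAlongAt c J X t) (hc : IsGeodesicOn (E := E) c J)
    (hJ : UniqueDiffOn ℝ J) (ht : t ∈ J) : SmoothAlongAt c J
      (fun s ↦ ((normalSpace c J s).orthogonalProjectionOnto (X s) : TangentSpace 𝓘(ℝ, E) (c s)))
      t := by
  simp only [coe_orthogonalProjectionOnto_normalSpace]
  have hv := smoothAlongAt_velocity hc.smooth hJ ht
  exact hX.add (.smul ((hv.inner hX).div (hv.inner hv)
    (inner_self_ne_zero.2 (hc.velocity_ne_zero t ht))).neg hv (hc.smooth t ht)) (hc.smooth t ht)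

variable [FiniteDimensional ℝ E]

theorem covDeriv_mem_normalSpace {X : ∀ t, normalSpace (E := E) c J t}
    (hX : SmoothAlongAt c J (fun s ↦ (X s : TangentSpace 𝓘(ℝ, E) (c s))) t)
    (hc : IsGeodesicOn (E := E) c J) (hJ : UniqueDiffOn ℝ J) (ht : t ∈ J) :
    covDeriv c J (fun s ↦ (X s : TangentSpace 𝓘(ℝ, E) (c s))) t ∈ normalSpace c J t := by
  have h := hasDerivWithinAt_inner hX (smoothAlongAt_velocity hc.smooth hJ ht) (hc.smooth t ht)
    (hJ t ht)
  simp only [inner_velocity, hc.covDeriv_velocity t ht, inner_zero_right, add_zero] at h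
  exact mem_normalSpace_iff.2 ((hJ t ht).eq_deriv _ h (hasDerivWithinAt_const t J 0))

theorem coe_orthogonalProjectionOnto_covDeriv {X : ∀ t, normalSpace (E := E) c J t}
    (hX : SmoothAlongAt c J (fun s ↦ (X s : TangentSpace 𝓘(ℝ, E) (c s))) t)
    (hc : IsGeodesicOn (E := E) c J) (hJ : UniqueDiffOn ℝ J) (ht : t ∈ J) :
    ((normalSpace c J t).orthogonalProjectionOnto
      (covDeriv c J (fun s ↦ (X s : TangentSpace 𝓘(ℝ, E) (c s))) t) :
        TangentSpace 𝓘(ℝ, E) (c t)) =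
      covDeriv c J (fun s ↦ (X s : TangentSpace 𝓘(ℝ, E) (c s))) t :=
  Submodule.starProjection_eq_self_iff.2 (covDeriv_mem_normalSpace hX hc hJ ht)

theorem coe_curvatureEndomorphism (x : M) (v : TangentSpace 𝓘(ℝ, E) x) (w : (ℝ ∙ v)ᗮ) :
    (curvatureEndomorphism x v w : TangentSpace 𝓘(ℝ, E) x) =
      curvature x (w : TangentSpace 𝓘(ℝ, E) x) v v := by
  refine Submodule.starProjection_eq_self_iff.2 ?_
  rw [Submodule.mem_orthogonal_singleton_iff_inner_left, inner_curvature_comm, curvature_self,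
    inner_zero_left]

theorem isSymmetric_curvatureEndomorphism (x : M) (v : TangentSpace 𝓘(ℝ, E) x) :
    (curvatureEndomorphism x v).IsSymmetric := fun u w ↦ by
  rw [Submodule.coe_inner, Submodule.coe_inner, coe_curvatureEndomorphism,
    coe_curvatureEndomorphism, inner_curvature_comm, real_inner_comm]

theorem smoothAlongAt_update_inv_smul (hX : SmoothAlongAt c J X t)
    (hc : ContMDiffWithinAt 𝓘(ℝ, ℝ) 𝓘(ℝ, E) ∞ c J t) (hJ : J.OrdConnected) (hJ' : J.Nontrivial)
    (ht : t ∈ J) (hXt : X t = 0) :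
    SmoothAlongAt c J (Function.update (fun s ↦ (s - t)⁻¹ • X s) t (covDeriv c J X t)) t := by
  have h₀ := mem_chart_source E (c t)
  have hcoord := contDiffWithinAt_update_inv_smul hJ hJ' ht ((smoothAlongAt_iff hc h₀).1 hX)
    (by rw [hXt, map_zero])
  have hu := uniqueDiffOn_of_ordConnected hJ hJ' t ht
  rw [smoothAlongAt_iff hc h₀]
  refine hcoord.congr_of_mem (fun s _ ↦ ?_) ht
  rcases eq_or_ne s t with rfl | hst
  · rw [Function.update_self, Function.update_self, toCoord_covDeriv hX hc hu h₀, hXt, map_zero,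
      map_zero, add_zero]
  · rw [Function.update_of_ne hst, Function.update_of_ne hst, map_smul]

/-- The metric connection on the normal bundle of a geodesic induced by the Levi-Civita
connection; its curvature endomorphism is `R(·, c')c'`. -/
noncomputable def normalConnection (hc : IsGeodesicOn (E := E) c J) (hJ : J.OrdConnected)
    (hJ' : J.Nontrivial) : MetricConnection J (fun t ↦ normalSpace (E := E) c J t) where
  Smooth X t := SmoothAlongAt c J (fun s ↦ (X s : TangentSpace 𝓘(ℝ, E) (c s))) t
  D X t := (normalSpace c J t).orthogonalProjectionOnto
    (covDeriv c J (fun s ↦ (X s : TangentSpace 𝓘(ℝ, E) (c s))) t)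
  R t := curvatureEndomorphism (c t) (velocity c J t)
  smooth_congr ht hX h := hX.congr ht (h.mono fun s hs ↦ by rw [hs])
  smooth_add ht hX hY := hX.add hY (hc.smooth _ ht)
  smooth_smul ht hf hX := .smul hf hX (hc.smooth _ ht)
  smooth_D ht hX :=
    have hu := uniqueDiffOn_of_ordConnected hJ hJ'
    (hX.covDeriv hc.smooth hu ht).normalPart hc hu ht
  smooth_R ht hX := by
    simp only [coe_curvatureEndomorphism]
    exact hX.curvature hc.smooth (uniqueDiffOn_of_ordConnected hJ hJ') ht
  smooth_inner _ hX hY := hX.inner hY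
  hasDerivWithinAt_inner ht hX hY := by
    have hu := uniqueDiffOn_of_ordConnected hJ hJ'
    simp only [Submodule.coe_inner, coe_orthogonalProjectionOnto_covDeriv hX hc hu ht,
      coe_orthogonalProjectionOnto_covDeriv hY hc hu ht]
    exact hasDerivWithinAt_inner hX hY (hc.smooth _ ht) (hu _ ht)
  smooth_div {X t} ht hX hXt := by
    refine (smoothAlongAt_update_inv_smul hX (hc.smooth t ht) hJ hJ' ht
      (congrArg Subtype.val hXt)).congr ht (.of_forall fun s ↦ ?_)
    refine (Function.apply_update (fun r (y : normalSpace (E := E) c J r) ↦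
      (y : TangentSpace 𝓘(ℝ, E) (c r))) _ t _ s).trans ?_
    rw [coe_orthogonalProjectionOnto_covDeriv hX hc (uniqueDiffOn_of_ordConnected hJ hJ') ht]
    rfl
  D_add ht hX hY := by
    simp only [Submodule.coe_add]
    rw [covDeriv_add hX hY (hc.smooth _ ht), map_add]
  D_smul a _ _ ht hX := by
    simp only [Submodule.coe_smul]
    rw [covDeriv_smul a hX (hc.smooth _ ht), map_smul]
  R_symm t := isSymmetric_curvatureEndomorphism (c t) (velocity c J t)

theorem coe_normalConnection_D {X : ∀ t, normalSpace (E := E) c J t}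
    (hc : IsGeodesicOn (E := E) c J) (hJ : J.OrdConnected) (hJ' : J.Nontrivial)
    (hX : (normalConnection hc hJ hJ').Smooth X t) (ht : t ∈ J) :
    ((normalConnection hc hJ hJ').D X t : TangentSpace 𝓘(ℝ, E) (c t)) =
      covDeriv c J (fun s ↦ (X s : TangentSpace 𝓘(ℝ, E) (c s))) t :=
  coe_orthogonalProjectionOnto_covDeriv hX hc (uniqueDiffOn_of_ordConnected hJ hJ') ht

theorem IsLagrangeTensor.isLagrange {t₀ : ℝ}
    {A : ∀ t, normalSpace (E := E) c J t₀ →L[ℝ] normalSpace (E := E) c J t}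
    (hA : IsLagrangeTensor c J t₀ A) (ht₀ : t₀ ∈ J) (hc : IsGeodesicOn (E := E) c J)
    (hJ : J.OrdConnected) (hJ' : J.Nontrivial) : (normalConnection hc hJ hJ').IsLagrange A := by
  have hu := uniqueDiffOn_of_ordConnected hJ hJ'
  set 𝒞 := normalConnection hc hJ hJ'
  have hs : ∀ u, ∀ t ∈ J, 𝒞.Smooth (fun s ↦ A s u) t := fun u t ht ↦ (hA.jacobi u).1 t ht
  have hD : ∀ u, ∀ t ∈ J, (𝒞.D (fun s ↦ A s u) t : TangentSpace 𝓘(ℝ, E) (c t)) =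
      covDeriv c J (fun s ↦ (A s u : TangentSpace 𝓘(ℝ, E) (c s))) t := fun u t ht ↦
    coe_normalConnection_D hc hJ hJ' (hs u t ht) ht
  have hj : ∀ u, ∀ t ∈ J, 𝒞.D (𝒞.D fun s ↦ A s u) t + 𝒞.R t (A t u) = 0 := fun u t ht ↦ by
    refine Subtype.ext ?_
    rw [Submodule.coe_add, coe_normalConnection_D hc hJ hJ' (𝒞.smooth_D ht (hs u t ht)) ht,
      covDeriv_congr (hD u) ht]
    exact (congrArg _ (coe_curvatureEndomorphism _ _ _)).trans ((hA.jacobi u).2 t ht)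
  obtain ⟨r, hr, hinv⟩ := hA.exists_regular
  refine ⟨hs, hj, fun u w t ht ↦ wronskian_eq_zero hJ hs hj hr (fun u w ↦ ?_) u w ht,
    fun u t ht hAt hDt ↦ ?_, fun t ht ↦ ?_⟩
  · have hsymm := hA.symmetric r hr hinv (A r u) (A r w)
    rw [hinv.inverse_apply_self, hinv.inverse_apply_self] at hsymm
    rw [Submodule.coe_inner, Submodule.coe_inner, hD u r hr, hD w r hr, hsymm]
  · by_contra hne
    obtain ⟨s, hsJ, hAs⟩ := hA.nondegenerate u hne
    refine hAs (Subtype.ext ((hA.jacobi u).eq_zero hJ hu hc.smooth ht ?_ ?_ hsJ))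
    · rw [hAt]; rfl
    · rw [← hD u t ht, hDt]; rfl
  · have ht_rank := finrank_normalSpace hc ht
    have ht₀_rank := finrank_normalSpace hc ht₀
    omega

end NormalBundle

section Main

section OrthonormalBasis

variable {V : Type*} [NormedAddCommGroup V] [InnerProductSpace ℝ V] {W K : Submodule ℝ V}
  {ι : Type*} [Fintype ι] (e : OrthonormalBasis ι ℝ W)

theorem sum_repr_smul_coe_basis {v : V} (hv : v ∈ W) :
    ∑ i, e.repr ⟨v, hv⟩ i • (e i : V) = v := by
  simpa only [Submodule.coe_sum, Submodule.coe_smul] using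
    congrArg Subtype.val (e.sum_repr ⟨v, hv⟩)

theorem isOrtho_iff_forall_basis_mem :
    W ⟂ K ↔ ∀ i, (e i : V) ∈ Kᗮ := by
  refine ⟨fun h i ↦ h (e i).2, fun h v hv ↦ ?_⟩
  rw [← sum_repr_smul_coe_basis e hv]
  exact Submodule.sum_mem _ fun i _ ↦ Submodule.smul_mem _ _ (h i)

theorem orthonormal_coe_basis : Orthonormal ℝ fun i ↦ (e i : V) :=
  e.orthonormal.comp_linearIsometry W.subtypeₗᵢ

end OrthonormalBasis

variable {E : Type*} [NormedAddCommGroup E] [NormedSpace ℝ E] [FiniteDimensional ℝ E]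
  {M : Type*} [TopologicalSpace M] [ChartedSpace E M]
  [RiemannianBundle (fun x : M ↦ TangentSpace 𝓘(ℝ, E) x)]
  {c : ℝ → M} {J K : Set ℝ} {t₀ t : ℝ}
  {A : ∀ t, normalSpace (E := E) c J t₀ →L[ℝ] normalSpace (E := E) c J t}
  {W : Submodule ℝ (normalSpace (E := E) c J t₀)} {p : ℕ}

theorem gW_eq_gramRoot (e : OrthonormalBasis (Fin p) ℝ W) :
    gW A e = gramRoot J A (fun i ↦ (e i : normalSpace (E := E) c J t₀)) :=
  rfl

variable [IsManifold 𝓘(ℝ, E) ∞ M]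
  [IsContMDiffRiemannianBundle 𝓘(ℝ, E) ∞ E (fun x : M ↦ TangentSpace 𝓘(ℝ, E) x)]

namespace IsLagrangeTensor

variable (hA : IsLagrangeTensor c J t₀ A) (ht₀ : t₀ ∈ J) (hc : IsGeodesicOn (E := E) c J)
  (hJ : J.OrdConnected) (hJ' : J.Nontrivial) (e : OrthonormalBasis (Fin p) ℝ W)
include hA ht₀ hc hJ hJ'

theorem concaveOn_gW (hp : 1 ≤ p) (hR : NonnegPCurvature E M p) (hK : K ⊆ J)
    (hK' : K.OrdConnected) (hpos : ∀ t ∈ K, 0 < gW A e t) : ConcaveOn ℝ K (gW A e) :=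
  (hA.isLagrange ht₀ hc hJ hJ').concaveOn_gramRoot (uniqueDiffOn_of_ordConnected hJ hJ')
    (orthonormal_coe_basis e) hp (fun t ht ↦ hR _ _ (hc.velocity_ne_zero t ht)) hK hK' hpos

theorem strictConcaveOn_gW (hp : 1 ≤ p) (hR : PosPCurvature E M p) (hK : K ⊆ J)
    (hK' : K.OrdConnected) (hpos : ∀ t ∈ K, 0 < gW A e t) : StrictConcaveOn ℝ K (gW A e) :=
  (hA.isLagrange ht₀ hc hJ hJ').strictConcaveOn_gramRoot (uniqueDiffOn_of_ordConnected hJ hJ')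
    (orthonormal_coe_basis e) hp (fun t ht ↦ hR _ _ (hc.velocity_ne_zero t ht)) hK hK' hpos

theorem contDiffWithinAt_gW (ht : t ∈ J) (hW : W ⟂ (A t).ker) :
    ContDiffWithinAt ℝ ∞ (gW A e) J t :=
  (hA.isLagrange ht₀ hc hJ hJ').contDiffWithinAt_gramRoot (uniqueDiffOn_of_ordConnected hJ hJ')
    (orthonormal_coe_basis e).linearIndependent ht ((isOrtho_iff_forall_basis_mem e).1 hW)

theorem gW_pos_iff (ht : t ∈ J) : 0 < gW A e t ↔ W ⟂ (A t).ker := by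
  rw [isOrtho_iff_forall_basis_mem e, gW_eq_gramRoot]
  exact (hA.isLagrange ht₀ hc hJ hJ').gramRoot_pos_iff (uniqueDiffOn_of_ordConnected hJ hJ')
    (orthonormal_coe_basis e) ht

theorem contDiffAt_gW_iff (ht : t ∈ interior J) :
    ContDiffAt ℝ ∞ (gW A e) t ↔ W ⟂ (A t).ker := by
  refine ⟨fun hsmooth ↦ (isOrtho_iff_forall_basis_mem e).2 fun i ↦ ?_, fun hW ↦
    (hA.contDiffWithinAt_gW ht₀ hc hJ hJ' e (interior_subset ht) hW).contDiffAt
      (mem_interior_iff_mem_nhds.1 ht)⟩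
  by_contra hi
  exact (hA.isLagrange ht₀ hc hJ hJ').not_differentiableAt_gramRoot
    (uniqueDiffOn_of_ordConnected hJ hJ') (orthonormal_coe_basis e) ht hi
    (hsmooth.differentiableAt (by simp))

theorem exists_parallel_jacobi_extension (hp : 1 ≤ p) (hR : NonnegPCurvature E M p) {a : ℝ}
    (ha : ∀ t ∈ J, gW A e t = a) {v : normalSpace (E := E) c J t₀} (hv : v ∈ W) :
    ∃ Z : ∀ t, TangentSpace 𝓘(ℝ, E) (c t),
      (∀ t ∈ J, (A t).IsInvertible → Z t = adjointInv A t v) ∧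
      IsParallelOn c J Z ∧ IsJacobiFieldOn c J Z := by
  have hL := hA.isLagrange ht₀ hc hJ hJ'
  have hvirt := fun t (ht : t ∈ J) ↦ hL.parallel_virt_of_const
    (uniqueDiffOn_of_ordConnected hJ hJ') (orthonormal_coe_basis e) hp
    (fun t ht ↦ hR _ _ (hc.velocity_ne_zero t ht)) ha (e.repr ⟨v, hv⟩) ht
  rw [sum_repr_smul_coe_basis e hv] at hvirt
  let Z : ∀ t, normalSpace (E := E) c J t := virt (normalConnection hc hJ hJ') A v
  have hsmooth : IsSmoothAlong c J fun t ↦ (Z t : TangentSpace 𝓘(ℝ, E) (c t)) :=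
    fun t ht ↦ (hvirt t ht).1
  have hparallel : ∀ t ∈ J, covDeriv c J (fun t ↦ (Z t : TangentSpace 𝓘(ℝ, E) (c t))) t = 0 :=
    fun t ht ↦ by
      rw [← coe_normalConnection_D hc hJ hJ' (hvirt t ht).1 ht, (hvirt t ht).2.1]
      rfl
  refine ⟨fun t ↦ Z t, fun t ht hinv ↦ ?_, ⟨hsmooth, hparallel⟩, hsmooth, fun t ht ↦ ?_⟩
  · exact congrArg Subtype.val (hL.adjoint_inverse_eq_virt ht hinv v).symm
  · rw [covDeriv_zero ht hparallel, zero_add,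
      ← coe_curvatureEndomorphism (c t) (velocity c J t) (Z t)]
    exact congrArg Subtype.val (hvirt t ht).2.2

end IsLagrangeTensor

end Main

end VirtualJacobi

theorem theoremB_general {E : Type*} [NormedAddCommGroup E] [NormedSpace ℝ E]
    [FiniteDimensional ℝ E]
    {M : Type*} [TopologicalSpace M] [ChartedSpace E M] [IsManifold 𝓘(ℝ, E) ∞ M]
    [RiemannianBundle (fun x : M ↦ TangentSpace 𝓘(ℝ, E) x)]
    [IsContMDiffRiemannianBundle 𝓘(ℝ, E) ∞ E (fun x : M ↦ TangentSpace 𝓘(ℝ, E) x)]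
    (c : ℝ → M) (J : Set ℝ) (hJ : J.OrdConnected) (hJ' : J.Nontrivial)
    (hc : IsGeodesicOn (E := E) c J) (t₀ : ℝ) (ht₀ : t₀ ∈ J)
    (A : ∀ t, normalSpace (E := E) c J t₀ →L[ℝ]
      normalSpace (E := E) c J t)
    (hA : IsLagrangeTensor c J t₀ A)
    (p : ℕ) (hp : 1 ≤ p) (W : Submodule ℝ (normalSpace (E := E) c J t₀))
    (e : OrthonormalBasis (Fin p) ℝ W) :
    -- (a)
    ((NonnegPCurvature E M p → ∀ K ⊆ J, K.OrdConnected →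
        (∀ t ∈ K, 0 < gW A e t) → ConcaveOn ℝ K (gW A e)) ∧
      (PosPCurvature E M p → ∀ K ⊆ J, K.OrdConnected →
        (∀ t ∈ K, 0 < gW A e t) → StrictConcaveOn ℝ K (gW A e))) ∧
    -- (b)
    ((∀ t ∈ J, (ContDiffWithinAt ℝ ∞ (gW A e) J t ∧ 0 < gW A e t) ↔
        W ⟂ (A t).ker) ∧
      (∀ t ∈ interior J, ContDiffAt ℝ ∞ (gW A e) t ↔ W ⟂ (A t).ker)) ∧
    -- (c)
    (NonnegPCurvature E M p → (∃ a, ∀ t ∈ J, gW A e t = a) →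
      ∀ v ∈ W, ∃ Z : ∀ t, TangentSpace 𝓘(ℝ, E) (c t),
        (∀ t ∈ J, (A t).IsInvertible → Z t = adjointInv A t v) ∧
        IsParallelOn c J Z ∧ IsJacobiFieldOn c J Z) := by
  refine ⟨⟨fun hR K hK hK' hpos ↦ hA.concaveOn_gW ht₀ hc hJ hJ' e hp hR hK hK' hpos,
    fun hR K hK hK' hpos ↦ hA.strictConcaveOn_gW ht₀ hc hJ hJ' e hp hR hK hK' hpos⟩,
    ⟨fun t ht ↦ ?_, fun t ht ↦ hA.contDiffAt_gW_iff ht₀ hc hJ hJ' e ht⟩,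
    fun hR ⟨a, ha⟩ v hv ↦ hA.exists_parallel_jacobi_extension ht₀ hc hJ hJ' e hp hR ha hv⟩
  rw [hA.gW_pos_iff ht₀ hc hJ hJ' e ht]
  exact and_iff_right_of_imp (hA.contDiffWithinAt_gW ht₀ hc hJ hJ' e ht)

theorem theoremB {E : Type*} [NormedAddCommGroup E] [NormedSpace ℝ E] [FiniteDimensional ℝ E]
    {M : Type*} [TopologicalSpace M] [T2Space M] [ChartedSpace E M] [IsManifold 𝓘(ℝ, E) ∞ M]
    [RiemannianBundle (fun x : M ↦ TangentSpace 𝓘(ℝ, E) x)]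
    [IsContMDiffRiemannianBundle 𝓘(ℝ, E) ∞ E (fun x : M ↦ TangentSpace 𝓘(ℝ, E) x)]
    (c : ℝ → M) (J : Set ℝ) (hJ : J.OrdConnected) (hJ' : J.Nontrivial)
    (hc : IsGeodesicOn (E := E) c J) (t₀ : ℝ) (ht₀ : t₀ ∈ J)
    (A : ∀ t, normalSpace (E := E) c J t₀ →L[ℝ]
      normalSpace (E := E) c J t)
    (hA : IsLagrangeTensor c J t₀ A)
    (p : ℕ) (hp : 1 ≤ p) (W : Submodule ℝ (normalSpace (E := E) c J t₀))
    (e : OrthonormalBasis (Fin p) ℝ W) :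
    -- (a)
    ((NonnegPCurvature E M p → ∀ K ⊆ J, K.OrdConnected →
        (∀ t ∈ K, 0 < gW A e t) → ConcaveOn ℝ K (gW A e)) ∧
      (PosPCurvature E M p → ∀ K ⊆ J, K.OrdConnected →
        (∀ t ∈ K, 0 < gW A e t) → StrictConcaveOn ℝ K (gW A e))) ∧
    -- (b)
    ((∀ t ∈ J, (ContDiffWithinAt ℝ ∞ (gW A e) J t ∧ 0 < gW A e t) ↔
        W ⟂ (A t).ker) ∧
      (∀ t ∈ interior J, ContDiffAt ℝ ∞ (gW A e) t ↔ W ⟂ (A t).ker)) ∧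
    -- (c)
    (NonnegPCurvature E M p → (∃ a, ∀ t ∈ J, gW A e t = a) →
      ∀ v ∈ W, ∃ Z : ∀ t, TangentSpace 𝓘(ℝ, E) (c t),
        (∀ t ∈ J, (A t).IsInvertible → Z t = adjointInv A t v) ∧
        IsParallelOn c J Z ∧ IsJacobiFieldOn c J Z) :=
  theoremB_general c J hJ hJ' hc t₀ ht₀ A hA p hp W e
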